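/- **Setting.** Let $(\mathcal A,\rho)$ be a metric space of diameter $1$ with a Borel probability measure $\nu$ and closed balls $B(a,r)$, such that (doubling) $0<\nu(B(a,2r))\le 2^d\,\nu(B(a,r))<\infty$ for all $a$ and $r>0$, and (uniformity) $\nu(B(a,2h))\le\alpha\,\nu(B(a',h))$ for all $a,a'\in\mathcal A$, $h>0$. (The interval $[0,1]$ with Lebesgue measure is the basic example.) Contexts and losses $(x_t,\ell_t)$, with $\ell_t:\mathcal A\to[0,1]$, are drawn i.i.d. from a distribution $\mathcal D$ whose marginal on contexts is known; in round $t=1,\dots,T$ the learner sees $x_t$, plays $a_t$ and observes $\ell_t(a_t)$. Let $\Pi$ be a finite set of policies $\pi:\mathcal X\to\mathcal A$ with $|\Pi|\log_2T>1$ (that is, $T\ge2$, and not both $T=2$ and $|\Pi|=1$). Put $\lambda_0(\pi)=\mathbb E\,\ell(\pi(x))$ and $\mathrm{Regret}(T,\Pi)=\mathbb E\sum_{t\le T}\ell_t(a_t)-T\min_{\pi\in\Pi}\lambda_0(\pi)$. Suppose that $L\ge1$ and that $a\mapsto\mathbb E[\ell(a)\mid x]$ is $L$-Lipschitz for every $x$.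 **Complexity.** Let $\Pi_{0,\epsilon}=\{\pi\in\Pi:\lambda_0(\pi)\le\min_{\Pi}\lambda_0+\epsilon\}$, let $\mathcal N_\delta(S)$ be the maximal number of points of $S$ at pairwise distances at least $\delta$, let $M_0(\epsilon,\delta)=\mathbb E_x\,\mathcal N_\delta(\{\pi(x):\pi\in\Pi_{0,\epsilon}\})$, and let $\psi_L(\epsilon_0)=\sup_{\epsilon\ge\epsilon_0}M_0(12L\epsilon,\epsilon)/\epsilon$ be the policy zooming coefficient. For $\gamma>0$ the zooming dimension is $z=\inf\{d'>0:\ M_0(12L\epsilon,\epsilon)\le\gamma\,\epsilon^{-d'}\ \ \forall\epsilon\in(0,1)\}$. **Algorithm** (SmoothPolicyElimination.L with parameters $L,\Pi,T$). Let $K_ha$ be the uniform distribution ($\nu$ restricted to $B(a,h)$ and normalized), identified with its density with respect to $\nu$; $\kappa_h=\sup_{a,a'}(K_ha)(a')$; $\delta_T=5\lceil\log(T|\Pi|\log_2T)\rceil$; $\Pi^{(1)}=\Pi$. In epoch $m=1,2,\dots$ put $h_m=2^{-m}$, $r_m=L2^{-m}$, $\mu_m=\min\{1/2,r_m\}$,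 $V_m=\mathbb E_x\,\nu\big(\bigcup_{\pi\in\Pi^{(m)}}B(\pi(x),h_m)\big)$, $\tilde n_m=\lfloor320\,\kappa_{h_m}V_m/r_m^2\rfloor$, and let $Q_m$ be a distribution on $\Pi^{(m)}$ that minimizes $\max_{\pi\in\Pi^{(m)}}\mathbb E_x\mathbb E_{a\sim K_{h_m}\pi(x)}[1/q_m(a\mid x)]$, where $q_m(a\mid x)=\mu_m+(1-\mu_m)\,\mathbb E_{\pi\sim Q_m}(K_{h_m}\pi(x))(a)$. The epoch has $\tilde n_m\delta_T$ rounds (cut off at $T$), in each of which $a_t\sim q_m(\cdot\mid x_t)$ is played; it is divided into $\delta_T$ consecutive batches of $\tilde n_m$ rounds. Let $\hat L_m(\pi)$ be the median over the batches of the batch averages of $(K_{h_m}\pi(x_t))(a_t)\,\ell_t(a_t)/q_m(a_t\mid x_t)$, and $\Pi^{(m+1)}=\{\pi\in\Pi^{(m)}:\hat L_m(\pi)\le\min_{\pi'\in\Pi^{(m)}}\hat L_m(\pi')+3r_m\}$. (An epoch with $\tilde n_m=0$ is skipped and eliminates nothing.) **Theorem.** There is a constant $C$ that depends only on $\alpha$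 such that, in this setting, SmoothPolicyElimination.L satisfies $$\mathrm{Regret}(T,\Pi)\le C\inf_{0<\epsilon_0<1}\Big(TL\epsilon_0+\frac{\psi_L(\epsilon_0)}{L}\,\log\big(|\Pi|\log_2T\big)\,\log\frac1{\epsilon_0}\Big),$$ and, for every $\gamma>0$ for which the set that defines the zooming dimension $z$ is nonempty, $$\mathrm{Regret}(T,\Pi)\le C\,L^{\frac z{2+z}}\,T^{\frac{1+z}{2+z}}\,\big(\gamma\log(T|\Pi|)\big)^{\frac1{2+z}}.$$ -/

import Mathlib

open MeasureTheory ProbabilityTheory Set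

noncomputable section

namespace ZoomingBandit

/-! ### Metric action space with a base measure -/

/-- The action space is doubling: `ν` is a doubling measure of doubling dimension `d` for the
metric (closed balls), and the diameter is normalized to `1`. -/
structure IsDoublingSpace {A : Type*} [MetricSpace A] [MeasurableSpace A]
    (ν : Measure A) (d : ℝ) : Prop where
  ball_pos : ∀ (a : A) (r : ℝ), 0 < r → 0 < ν (Metric.closedBall a (2 * r))
  doubling : ∀ (a : A) (r : ℝ), 0 < r →
    ν (Metric.closedBall a (2 * r)) ≤ ENNReal.ofReal (2 ^ d) * ν (Metric.closedBall a r)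
  ball_lt_top : ∀ (a : A) (r : ℝ), 0 < r → ν (Metric.closedBall a r) < ⊤
  diam_eq_one : Metric.diam (univ : Set A) = 1

/-- Uniformity of the base measure: `ν (B(a, 2h)) / ν (B(a', h)) ≤ α` for all centres `a, a'` and
all radii `h > 0`. -/
def IsUniformSpace {A : Type*} [MetricSpace A] [MeasurableSpace A]
    (ν : Measure A) (α : ℝ) : Prop :=
  ∀ (a a' : A) (h : ℝ), 0 < h →
    ν (Metric.closedBall a (2 * h)) ≤ ENNReal.ofReal α * ν (Metric.closedBall a' h)

/-- Density with respect to `ν`, at the action `a'`, of the rectangular kernel `K_h a`: the uniform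
distribution on the closed ball of radius `h` around `a`. -/
def rectKernel {A : Type*} [MetricSpace A] [MeasurableSpace A]
    (ν : Measure A) (h : ℝ) (a a' : A) : ℝ :=
  (Metric.closedBall a h).indicator (fun _ => (ν.real (Metric.closedBall a h))⁻¹) a'

/-- `κ_h`, the supremum of the kernel density. -/
def kernelSup {A : Type*} [MetricSpace A] [MeasurableSpace A] (ν : Measure A) (h : ℝ) : ℝ :=
  ⨆ p : A × A, rectKernel ν h p.1 p.2

/-- The `δ`-packing number of `B`: the largest cardinality of a subset of `B` whose distinct points
are at distance at least `δ`. -/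
def packingNumber {A : Type*} [MetricSpace A] (δ : ℝ) (B : Set A) : ℕ :=
  sSup {n : ℕ | ∃ S : Finset A, (S : Set A) ⊆ B ∧
    (∀ a ∈ S, ∀ b ∈ S, a ≠ b → δ ≤ dist a b) ∧ S.card = n}

/-- The median of finitely many reals: the midpoint of the lower and the upper median. -/
def median {n : ℕ} (f : Fin n → ℝ) : ℝ :=
  (sInf {c : ℝ | n ≤ 2 * (Finset.univ.filter fun i => f i ≤ c).card} +
    sSup {c : ℝ | n ≤ 2 * (Finset.univ.filter fun i => c ≤ f i).card}) / 2

/-! ### Stochastic contextual bandits -/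

/-- A stochastic contextual bandit problem with contexts `X`, actions `A` and a finite family of
policies indexed by `ι`. The distribution of a pair (context, loss function) is given by the
marginal law `ctxLaw` of the context `x` and, for each `x`, the conditional law `lossLaw x` of an
outcome `ω`; the outcome `ω` carries the loss function `loss ω : A → [0,1]`. -/
structure Problem (X A Ω ι : Type*) [MeasurableSpace X] [MeasurableSpace A]
    [MeasurableSpace Ω] where
  ctxLaw : Measure X
  lossLaw : Kernel X Ω
  loss : Ω → A → ℝ
  policy : ι → X → A
  isProbabilityMeasure_ctxLaw : IsProbabilityMeasure ctxLaw
  isMarkovKernel_lossLaw : IsMarkovKernel lossLaw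
  measurable_loss : Measurable (Function.uncurry loss)
  loss_mem : ∀ ω a, loss ω a ∈ Icc (0 : ℝ) 1
  measurable_policy : ∀ i, Measurable (policy i)

namespace Problem

variable {X A Ω ι : Type*} [MeasurableSpace X] [MetricSpace A] [MeasurableSpace A]
  [MeasurableSpace Ω] [Fintype ι]

/-- The conditional expected loss `λ(a | x) = E[ℓ(a) | x]`. -/
def condLoss (B : Problem X A Ω ι) (x : X) (a : A) : ℝ := ∫ ω, B.loss ω a ∂(B.lossLaw x)

/-- The expected losses are `L`-Lipschitz in the action. -/
def IsLipschitz (B : Problem X A Ω ι) (L : ℝ) : Prop :=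
  ∀ (x : X) (a a' : A), |B.condLoss x a - B.condLoss x a'| ≤ L * dist a a'

/-- The expected loss `λ_0(π) = E_{(x,ℓ)} ℓ(π(x))` of the policy with index `i`. -/
def expLoss (B : Problem X A Ω ι) (i : ι) : ℝ :=
  ∫ x, ∫ ω, B.loss ω (B.policy i x) ∂(B.lossLaw x) ∂B.ctxLaw

/-- The benchmark: the smallest expected loss of a policy. -/
def benchmark (B : Problem X A Ω ι) : ℝ := ⨅ i, B.expLoss i

/-- The `ε`-optimal policies, for the unsmoothed loss. -/
def nearOptimal (B : Problem X A Ω ι) (ε : ℝ) : Set ι := {i | B.expLoss i ≤ B.benchmark + ε}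

/-- `M_0(ε, δ)`: the expected `δ`-packing number of the set of the actions that the `ε`-optimal
policies choose on a random context. -/
def expPacking (B : Problem X A Ω ι) (ε δ : ℝ) : ℝ :=
  ∫ x, (packingNumber δ ((fun i => B.policy i x) '' B.nearOptimal ε) : ℝ) ∂B.ctxLaw

/-- The policy zooming coefficient `ψ_L(ε₀) = sup_{ε ≥ ε₀} M_0(12 L ε, ε) / ε`. -/
def zoomingCoeff (B : Problem X A Ω ι) (L ε₀ : ℝ) : ℝ :=
  ⨆ ε : Ici ε₀, B.expPacking (12 * L * (ε : ℝ)) (ε : ℝ) / (ε : ℝ)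

/-- The exponents `d > 0` with `M_0(12 L ε, ε) ≤ γ ε ^ (-d)` for all `ε ∈ (0,1)`. -/
def zoomingExponents (B : Problem X A Ω ι) (L γ : ℝ) : Set ℝ :=
  {d | 0 < d ∧ ∀ ε ∈ Ioo (0 : ℝ) 1, B.expPacking (12 * L * ε) ε ≤ γ * ε ^ (-d)}

/-- The zooming dimension for the zooming constant `γ`. -/
def zoomingDim (B : Problem X A Ω ι) (L γ : ℝ) : ℝ := sInf (B.zoomingExponents L γ)

/-! ### The algorithm `SmoothPolicyElimination.L`

Epochs are numbered `m = 1, 2, …`. -/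

/-- The bandwidth `h_m = 2^{-m}`. -/
def bandwidth (m : ℕ) : ℝ := (1 / 2) ^ m

/-- The radius `r_m = L 2^{-m}`. -/
def radius (L : ℝ) (m : ℕ) : ℝ := L * (1 / 2) ^ m

/-- The exploration probability `μ_m = min {1/2, r_m}`. -/
def exploreProb (L : ℝ) (m : ℕ) : ℝ := min (1 / 2) (radius L m)

/-- The number of batches `δ_T = 5 ⌈log (T |Π| log₂ T)⌉`. -/
def numBatches (ι : Type*) [Fintype ι] (T : ℕ) : ℕ :=
  5 * ⌈Real.log ((T : ℝ) * (Fintype.card ι : ℝ) * Real.logb 2 (T : ℝ))⌉₊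

/-- The characteristic volume `E_x ν (⋃_{π ∈ P} B(π(x), h))` of a set `P` of policies. -/
def charVolume (B : Problem X A Ω ι) (ν : Measure A) (h : ℝ) (P : Finset ι) : ℝ :=
  ∫ x, ν.real (⋃ i ∈ P, Metric.closedBall (B.policy i x) h) ∂B.ctxLaw

/-- The batch size `320 κ_{h_m} V_m / r_m²` in epoch `m` with version space `P`, rounded down to an
integer. (It is `0` only if `r_m² > 320`; such an epoch is empty, and eliminates nothing.) -/
def batchSize (B : Problem X A Ω ι) (ν : Measure A) (L : ℝ) (m : ℕ) (P : Finset ι) : ℕ :=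
  ⌊320 * kernelSup ν (bandwidth m) * B.charVolume ν (bandwidth m) P / radius L m ^ 2⌋₊

/-- The length `n_m` of epoch `m` with version space `P`. -/
def epochLength (B : Problem X A Ω ι) (ν : Measure A) (L : ℝ) (T m : ℕ) (P : Finset ι) : ℕ :=
  B.batchSize ν L m P * numBatches ι T

/-- The density `q_m(a | x) = μ_m + (1 - μ_m) ∑_π w(π) (K_{h_m} π(x))(a)` for the weights `w`. -/
def actionDensity (B : Problem X A Ω ι) (ν : Measure A) (L : ℝ) (m : ℕ) (w : ι → ℝ)
    (x : X) (a : A) : ℝ :=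
  exploreProb L m +
    (1 - exploreProb L m) * ∑ i, w i * rectKernel ν (bandwidth m) (B.policy i x) a

/-- The probability distributions on the policies in `P`. -/
def distributionsOn (P : Finset ι) : Set (ι → ℝ) :=
  {w | (∀ i, 0 ≤ w i) ∧ (∀ i ∉ P, w i = 0) ∧ ∑ i, w i = 1}

/-- The objective `max_{π ∈ P} E_x E_{a ∼ K_{h_m} π(x)} [1 / q_m(a | x)]` of the program that is
solved before epoch `m`. -/
def objective (B : Problem X A Ω ι) (ν : Measure A) (L : ℝ) (m : ℕ) (P : Finset ι)
    (w : ι → ℝ) : ℝ :=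
  ⨆ i : P, ∫ x, ∫ a, rectKernel ν (bandwidth m) (B.policy i x) a *
    (1 / B.actionDensity ν L m w x a) ∂ν ∂B.ctxLaw

/-- `Q` solves the optimization problem of the algorithm: for every epoch `m ≥ 1` and every
nonempty version space `P`, the weights `Q m P` are a minimizer of the objective among the
distributions on `P`. -/
def IsSolver (B : Problem X A Ω ι) (ν : Measure A) (L : ℝ)
    (Q : ℕ → Finset ι → ι → ℝ) : Prop :=
  ∀ (m : ℕ) (P : Finset ι), 1 ≤ m → P.Nonempty →
    Q m P ∈ distributionsOn P ∧ IsMinOn (B.objective ν L m P) (distributionsOn P) (Q m P)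

/-- The importance weighted estimate of the smoothed loss of policy `i`, from one round
`z = (x, a, observed loss)` of epoch `m`, played with the weights `w`. -/
def ipsEstimate (B : Problem X A Ω ι) (ν : Measure A) (L : ℝ) (m : ℕ) (w : ι → ℝ) (i : ι)
    (z : X × A × ℝ) : ℝ :=
  rectKernel ν (bandwidth m) (B.policy i z.1) z.2.1 * z.2.2 / B.actionDensity ν L m w z.1 z.2.1

/-- The median-of-means estimate `L̂_m(π_i)` at the end of epoch `m` with version space `P`, if
`s` rounds were played before that epoch. Batch `b` of the epoch consists of the rounds
`s + b ñ, …, s + b ñ + ñ - 1`, rounds being numbered from `0`. It is used only when the history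
`H` contains the whole epoch, so the value `0` for missing rounds plays no role. -/
def lossEstimate (B : Problem X A Ω ι) (ν : Measure A) (L : ℝ) (T : ℕ)
    (Q : ℕ → Finset ι → ι → ℝ) {t : ℕ} (H : Fin t → X × A × ℝ) (m s : ℕ) (P : Finset ι)
    (i : ι) : ℝ :=
  median fun b : Fin (numBatches ι T) =>
    (∑ j ∈ Finset.range (B.batchSize ν L m P),
      if hj : s + (b : ℕ) * B.batchSize ν L m P + j < t then
        B.ipsEstimate ν L m (Q m P) i (H ⟨s + (b : ℕ) * B.batchSize ν L m P + j, hj⟩)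
      else 0) / (B.batchSize ν L m P : ℝ)

open Classical in
/-- `epochState … H k` is the pair of the number of rounds before epoch `k + 1` and the version
space `Π^{(k+1)}` of that epoch. -/
def epochState (B : Problem X A Ω ι) (ν : Measure A) (L : ℝ) (T : ℕ)
    (Q : ℕ → Finset ι → ι → ℝ) {t : ℕ} (H : Fin t → X × A × ℝ) : ℕ → ℕ × Finset ι
  | 0 => (0, Finset.univ)
  | k + 1 =>
    let s := (epochState B ν L T Q H k).1
    let P := (epochState B ν L T Q H k).2
    (s + B.epochLength ν L T (k + 1) P,
      P.filter fun i => ∀ j ∈ P, B.lossEstimate ν L T Q H (k + 1) s P i ≤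
        B.lossEstimate ν L T Q H (k + 1) s P j + 3 * radius L (k + 1))

/-- The number `k` such that the round that follows a history of length `t` lies in epoch `k + 1`:
the first `k` such that epoch `k + 1` is not over after `t` rounds. -/
def currentEpoch (B : Problem X A Ω ι) (ν : Measure A) (L : ℝ) (T : ℕ)
    (Q : ℕ → Finset ι → ι → ℝ) {t : ℕ} (H : Fin t → X × A × ℝ) : ℕ :=
  sInf {k | t < (B.epochState ν L T Q H (k + 1)).1}

/-- The density, with respect to `ν`, of the action that the algorithm plays on context `x` after
the history `H`. -/
def learnerDensity (B : Problem X A Ω ι) (ν : Measure A) (L : ℝ) (T : ℕ)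
    (Q : ℕ → Finset ι → ι → ℝ) {t : ℕ} (H : Fin t → X × A × ℝ) (x : X) (a : A) : ℝ :=
  let k := B.currentEpoch ν L T Q H
  B.actionDensity ν L (k + 1) (Q (k + 1) (B.epochState ν L T Q H k).2) x a

/-- The law of the round (context, action, observed loss) that follows the history `H`: the context
is drawn, the action is drawn by the algorithm given the context, and, independently of the action
given the context, the loss function is drawn. -/
def roundLaw (B : Problem X A Ω ι) (ν : Measure A) (L : ℝ) (T : ℕ)
    (Q : ℕ → Finset ι → ι → ℝ) {t : ℕ} (H : Fin t → X × A × ℝ) : Measure (X × A × ℝ) :=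
  B.ctxLaw.bind fun x =>
    (ν.withDensity fun a => ENNReal.ofReal (B.learnerDensity ν L T Q H x a)).bind fun a =>
      (B.lossLaw x).map fun ω => (x, a, B.loss ω a)

/-- The law of the history of the first `t` rounds of the algorithm. -/
def historyLaw (B : Problem X A Ω ι) (ν : Measure A) (L : ℝ) (T : ℕ)
    (Q : ℕ → Finset ι → ι → ℝ) : (t : ℕ) → Measure (Fin t → X × A × ℝ)
  | 0 => Measure.dirac Fin.elim0
  | t + 1 => (historyLaw B ν L T Q t).bind fun H =>
      (B.roundLaw ν L T Q H).map fun z => (Fin.snoc H z : Fin (t + 1) → X × A × ℝ)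

/-- The regret `E [∑_{t ≤ T} ℓ_t(a_t)] - T min_π λ_0(π)` of `SmoothPolicyElimination.L`, run for
`T` rounds with parameter `L` and with the solver `Q`. -/
def regret (B : Problem X A Ω ι) (ν : Measure A) (L : ℝ) (T : ℕ)
    (Q : ℕ → Finset ι → ι → ℝ) : ℝ :=
  (∫ H, ∑ t, (H t).2.2 ∂(B.historyLaw ν L T Q T)) - (T : ℝ) * B.benchmark

end Problem

end ZoomingBandit

end

set_option linter.unusedSectionVars false

noncomputable section

namespace ZoomingBandit

/-! ### Packings and ball volumes under a doubling and uniform measure. -/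

section Geometry

/-! Smoothing a policy at bandwidth `h_m` costs a bias of at most `L h_m = r_m` and makes its loss
estimable by importance weighting. The second moment of the estimator is at most `2 κ V`, because
some mixture `q` of the kernels has all importance weights at most `2 V`
(`exists_mixture_integral_div_le`) and the solver does at least as well. Chebyshev on each batch and
the median over the batches then give accuracy `r_m / 2`, except with probability `exp (-δ_T / 2)`
(`measure_medianOfMeans_le`).

The threshold `3 r_m` is two errors `r_m / 2` plus two biases `r_m`, so an optimal policy survives,
while every survivor is `6 r_m = 12 r_{m+1}`-optimal. Hence `κ V` is at most `α` times the packing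
number of the near optimal actions (`kernelSup_mul_charVolume_le`), an epoch has `O(α δ_T M_0 /
r_m²)` rounds, and each of them costs at most `14 r_m`. Rounds after epoch `K` cost at most `14
r_{K+1}`. This is `regret_le_sum`.

The probabilistic difficulty is that the batch sizes and the exploration weights depend on the past.
Histories are embedded into infinite sequences. Given the starting time and the version space of an
epoch, its rounds are i.i.d., and `setLIntegral_process_block` transfers the i.i.d. tail bound to
the actual process.

It remains to choose `K`. For the zooming dimension the sum over scales is geometric, and `ε`
balances it against `T L ε`. For the zooming coefficient, `δ_T` contains an extra `log T` that the
claimed bound lacks. If `log (1/ε₀)` is at least a small multiple of `log T`, it replaces `log T`,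
and the sum over scales is at most `ψ` times `O(log |Π|) + 2`, since each packing number is at most
`|Π|`. Otherwise the packing numbers `α^(k+2)` of the few scales in use are a small power of `T`,
absorbed into `T L ε₀`. This dichotomy is in `le_of_forall_scale_of_sup`. -/

lemma card_le_of_subset_image {ι β : Type*} [Fintype ι] (f : ι → β) (J : Set ι) (S : Finset β)
    (hS : (S : Set β) ⊆ f '' J) : S.card ≤ Fintype.card ι := by
  classical
  have : S ⊆ Finset.univ.image f := by
    intro a ha
    obtain ⟨i, -, rfl⟩ := hS ha
    simp
  exact (Finset.card_le_card this).trans Finset.card_image_le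

variable {A : Type*} [MetricSpace A]

/-- A largest packing cannot be enlarged, so it is also a `δ`-net. The bound `c` is needed for the
supremum in `packingNumber` to be attained. -/
lemma exists_maximal_packing {δ : ℝ} (hδ : 0 < δ) {B : Set A} {c : ℕ}
    (hB : ∀ S : Finset A, (S : Set A) ⊆ B →
      (∀ a ∈ S, ∀ b ∈ S, a ≠ b → δ ≤ dist a b) → S.card ≤ c) :
    ∃ S : Finset A, (S : Set A) ⊆ B ∧ (∀ a ∈ S, ∀ b ∈ S, a ≠ b → δ ≤ dist a b) ∧
      S.card = packingNumber δ B ∧ ∀ x ∈ B, ∃ y ∈ S, dist x y < δ := by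
  classical
  have hbdd : BddAbove {n : ℕ | ∃ S : Finset A, (S : Set A) ⊆ B ∧
      (∀ a ∈ S, ∀ b ∈ S, a ≠ b → δ ≤ dist a b) ∧ S.card = n} := by
    refine ⟨c, ?_⟩
    rintro n ⟨S, h1, h2, rfl⟩
    exact hB S h1 h2
  obtain ⟨S, h1, h2, h3⟩ := Nat.sSup_mem (s := {n : ℕ | ∃ S : Finset A, (S : Set A) ⊆ B ∧
      (∀ a ∈ S, ∀ b ∈ S, a ≠ b → δ ≤ dist a b) ∧ S.card = n}) ⟨0, ∅, by simp, by simp, rfl⟩ hbdd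
  refine ⟨S, h1, h2, h3, fun x hx => ?_⟩
  by_contra hcon
  push Not at hcon
  have hxS : x ∉ S := fun h => by
    have := hcon x h
    rw [dist_self] at this
    linarith
  have : (insert x S).card ≤ S.card := by
    rw [h3]
    refine le_csSup hbdd ⟨insert x S, ?_, ?_, rfl⟩
    · intro y hy
      rcases Finset.mem_insert.1 (Finset.mem_coe.1 hy) with rfl | hy
      exacts [hx, h1 hy]
    · intro a ha b hb hab
      rcases Finset.mem_insert.1 ha with rfl | ha <;> rcases Finset.mem_insert.1 hb with rfl | hb
      · exact absurd rfl hab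
      · exact hcon b hb
      · rw [dist_comm]; exact hcon a ‹_›
      · exact h2 a ha b hb hab
  rw [Finset.card_insert_of_notMem hxS] at this
  omega

lemma packingNumber_le {δ : ℝ} {B : Set A} {c : ℕ}
    (hB : ∀ S : Finset A, (S : Set A) ⊆ B →
      (∀ a ∈ S, ∀ b ∈ S, a ≠ b → δ ≤ dist a b) → S.card ≤ c) : packingNumber δ B ≤ c := by
  refine csSup_le ⟨0, ∅, by simp, by simp, rfl⟩ ?_
  rintro n ⟨S, h1, h2, rfl⟩
  exact hB S h1 h2

lemma packingNumber_image_le {ι : Type*} [Fintype ι] (δ : ℝ) (f : ι → A) (J : Set ι) :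
    packingNumber δ (f '' J) ≤ Fintype.card ι :=
  packingNumber_le fun S h _ => card_le_of_subset_image f J S h

/-- Choosing policies instead of points leaves finitely many candidates `I`, each with a condition
that is measurable in the context. This yields the measurability of the packing number. -/
lemma le_packingNumber_image_iff {ι : Type*} [Fintype ι] {δ : ℝ} (hδ : 0 < δ) (f : ι → A)
    (J : Set ι) (n : ℕ) : n ≤ packingNumber δ (f '' J) ↔
      ∃ I : Finset ι, ((I : Set ι) ⊆ J ∧ n ≤ I.card) ∧
        ∀ i ∈ I, ∀ j ∈ I, i ≠ j → δ ≤ dist (f i) (f j) := by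
  classical
  constructor
  · intro h
    obtain ⟨S, h1, h2, h3, -⟩ := exists_maximal_packing hδ
      (fun S h _ => card_le_of_subset_image f J S h)
    rcases isEmpty_or_nonempty ι with hι | hι
    · have hS : S = ∅ := Finset.eq_empty_of_forall_notMem fun a ha =>
        isEmptyElim (h1 ha).choose
      rw [hS, Finset.card_empty] at h3
      exact ⟨∅, by simp; omega, by simp⟩
    have h4 : ∀ a ∈ S, ∃ i ∈ J, f i = a := fun a ha => h1 ha
    choose! g hg1 hg2 using h4
    have hinj : Set.InjOn g S := fun a ha b hb hab => by rw [← hg2 a ha, ← hg2 b hb, hab]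
    refine ⟨S.image g, ⟨?_, ?_⟩, ?_⟩
    · intro i hi
      obtain ⟨a, ha, rfl⟩ := Finset.mem_image.1 (Finset.mem_coe.1 hi)
      exact hg1 a ha
    · rw [Finset.card_image_of_injOn hinj, h3]; exact h
    · intro i hi j hj hij
      obtain ⟨a, ha, rfl⟩ := Finset.mem_image.1 hi
      obtain ⟨b, hb, rfl⟩ := Finset.mem_image.1 hj
      rw [hg2 a ha, hg2 b hb]
      exact h2 a ha b hb fun hab => hij (by rw [hab])
  · rintro ⟨I, ⟨h1, h2⟩, h3⟩
    have hinj : Set.InjOn f I := fun i hi j hj hij => by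
      by_contra hne
      have := h3 i hi j hj hne
      rw [hij, dist_self] at this
      linarith
    refine h2.trans ?_
    rw [← Finset.card_image_of_injOn hinj]
    refine le_csSup ⟨Fintype.card ι, ?_⟩ ⟨I.image f, ?_, ?_, rfl⟩
    · rintro n ⟨S, h1, -, rfl⟩
      exact card_le_of_subset_image f J S h1
    · rw [Finset.coe_image]; exact image_mono h1
    · intro a ha b hb hab
      obtain ⟨i, hi, rfl⟩ := Finset.mem_image.1 ha
      obtain ⟨j, hj, rfl⟩ := Finset.mem_image.1 hb
      exact h3 i hi j hj fun h => hab (by rw [h])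

lemma one_le_packingNumber_image {ι : Type*} [Fintype ι] {δ : ℝ} (hδ : 0 < δ) (f : ι → A)
    {J : Set ι} (hJ : J.Nonempty) : 1 ≤ packingNumber δ (f '' J) := by
  obtain ⟨i, hi⟩ := hJ
  refine (le_packingNumber_image_iff hδ f J 1).2 ⟨{i}, ⟨by simpa using hi, by simp⟩, ?_⟩
  intro a ha b hb hab
  rw [Finset.mem_singleton] at ha hb
  exact absurd (ha.trans hb.symm) hab

variable [MeasurableSpace A] {ν : Measure A} {d α : ℝ}

lemma IsDoublingSpace.closedBall_pos (hd : IsDoublingSpace ν d) (a : A) {r : ℝ} (hr : 0 < r) :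
    0 < ν (Metric.closedBall a r) := by
  have := hd.ball_pos a (r / 2) (by linarith)
  rwa [mul_div_cancel₀ _ two_ne_zero] at this

lemma IsDoublingSpace.closedBall_real_pos (hd : IsDoublingSpace ν d) (a : A) {r : ℝ}
    (hr : 0 < r) : 0 < ν.real (Metric.closedBall a r) :=
  ENNReal.toReal_pos (hd.closedBall_pos a hr).ne' (hd.ball_lt_top a r hr).ne

lemma IsDoublingSpace.dist_le_one (hd : IsDoublingSpace ν d) (a b : A) : dist a b ≤ 1 := by
  rw [← hd.diam_eq_one]
  refine Metric.dist_le_diam_of_mem ?_ (mem_univ a) (mem_univ b)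
  -- `Metric.diam` is zero by default on unbounded sets, so diameter one excludes them.
  by_contra h
  have h1 := Metric.diam_eq_zero_of_unbounded h
  rw [hd.diam_eq_one] at h1
  exact one_ne_zero h1

lemma IsDoublingSpace.closedBall_real_eq_one [IsProbabilityMeasure ν] (hd : IsDoublingSpace ν d)
    (a : A) {r : ℝ} (hr : 1 ≤ r) : ν.real (Metric.closedBall a r) = 1 := by
  have : Metric.closedBall a r = univ :=
    eq_univ_of_forall fun b => (hd.dist_le_one b a).trans hr
  rw [this]; simp

lemma one_le_of_isUniformSpace [IsProbabilityMeasure ν] (hd : IsDoublingSpace ν d)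
    (hu : IsUniformSpace ν α) : 1 ≤ α := by
  obtain ⟨a⟩ := nonempty_of_isProbabilityMeasure ν
  have h := hu a a 1 one_pos
  have h1 : ∀ r : ℝ, 1 ≤ r → ν (Metric.closedBall a r) = 1 := fun r hr => by
    have : Metric.closedBall a r = univ :=
      eq_univ_of_forall fun b => (hd.dist_le_one b a).trans hr
    rw [this]; simp
  rw [h1 _ (by norm_num), h1 _ le_rfl, mul_one] at h
  exact ENNReal.one_le_ofReal.1 h

lemma IsUniformSpace.real_le [IsProbabilityMeasure ν] (hd : IsDoublingSpace ν d)
    (hu : IsUniformSpace ν α) (a a' : A) {h : ℝ} (hh : 0 < h) :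
    ν.real (Metric.closedBall a (2 * h)) ≤ α * ν.real (Metric.closedBall a' h) := by
  have h1 := ENNReal.toReal_mono
    (ENNReal.mul_ne_top ENNReal.ofReal_ne_top (measure_ne_top ν _)) (hu a a' h hh)
  rwa [ENNReal.toReal_mul, ENNReal.toReal_ofReal
    (zero_le_one.trans (one_le_of_isUniformSpace hd hu))] at h1

/-- Doubling the radius `k` times reaches the whole space, of mass one, and every doubling costs a
factor `α`. -/
lemma IsUniformSpace.one_le_pow_mul [IsProbabilityMeasure ν] (hd : IsDoublingSpace ν d)
    (hu : IsUniformSpace ν α) (a : A) (k : ℕ) : ∀ h : ℝ, 0 < h → 1 ≤ 2 ^ k * h →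
      1 ≤ α ^ k * ν.real (Metric.closedBall a h) := by
  have hα := one_le_of_isUniformSpace hd hu
  induction k with
  | zero =>
    intro h _ h2
    rw [pow_zero, one_mul] at h2 ⊢
    rw [hd.closedBall_real_eq_one a h2]
  | succ k ih =>
    intro h h1 h2
    calc (1 : ℝ) ≤ α ^ k * ν.real (Metric.closedBall a (2 * h)) :=
          ih (2 * h) (by linarith) (by rw [pow_succ] at h2; linarith)
      _ ≤ α ^ k * (α * ν.real (Metric.closedBall a h)) := by
          gcongr; exact hu.real_le hd a a h1
      _ = _ := by ring

/-- The balls of radius `δ / 3` around the points of a packing are disjoint, and each has mass at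
least `α ^ (-k)`. -/
lemma IsUniformSpace.card_le_pow [BorelSpace A] [IsProbabilityMeasure ν]
    (hd : IsDoublingSpace ν d) (hu : IsUniformSpace ν α) {δ : ℝ} (hδ : 0 < δ) {k : ℕ}
    (hk : 3 ≤ 2 ^ k * δ) (S : Finset A) (hS : ∀ a ∈ S, ∀ b ∈ S, a ≠ b → δ ≤ dist a b) :
    (S.card : ℝ) ≤ α ^ k := by
  have hα := one_le_of_isUniformSpace hd hu
  have h1 : ν.real (⋃ a ∈ S, Metric.closedBall a (δ / 3)) =
      ∑ a ∈ S, ν.real (Metric.closedBall a (δ / 3)) := by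
    refine measureReal_biUnion_finset (fun a ha b hb hab => ?_)
      (fun a _ => Metric.isClosed_closedBall.measurableSet)
    have := hS a ha b hb hab
    exact Metric.closedBall_disjoint_closedBall (by linarith)
  have h2 : ∀ a ∈ S, 1 ≤ α ^ k * ν.real (Metric.closedBall a (δ / 3)) := fun a _ =>
    hu.one_le_pow_mul hd a k _ (by linarith) (by linarith)
  calc (S.card : ℝ) = ∑ a ∈ S, 1 := by simp
    _ ≤ ∑ a ∈ S, α ^ k * ν.real (Metric.closedBall a (δ / 3)) := Finset.sum_le_sum h2
    _ = α ^ k * ν.real (⋃ a ∈ S, Metric.closedBall a (δ / 3)) := by rw [h1, Finset.mul_sum]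
    _ ≤ α ^ k * 1 := by gcongr; exact measureReal_le_one
    _ = _ := mul_one _

/-- The packing bound makes the space totally bounded. Second countability is what makes the
distance jointly measurable on products. -/
lemma IsUniformSpace.secondCountableTopology [BorelSpace A] [IsProbabilityMeasure ν]
    (hd : IsDoublingSpace ν d) (hu : IsUniformSpace ν α) : SecondCountableTopology A := by
  refine Metric.secondCountable_of_almost_dense_set fun ε hε => ?_
  obtain ⟨k, hk⟩ := pow_unbounded_of_one_lt (3 / ε) (one_lt_two (α := ℝ))
  rw [div_lt_iff₀ hε] at hk
  obtain ⟨S, -, -, -, h⟩ := exists_maximal_packing (B := univ) hε (c := ⌊α ^ k⌋₊)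
    fun S _ hS => Nat.le_floor (hu.card_le_pow hd hε hk.le S hS)
  exact ⟨S, S.countable_toSet, fun x =>
    let ⟨y, hy, h1⟩ := h x (mem_univ x); ⟨y, hy, h1.le⟩⟩

lemma packingNumber_half_pow_le [BorelSpace A] [IsProbabilityMeasure ν]
    (hd : IsDoublingSpace ν d) (hu : IsUniformSpace ν α) (m : ℕ) (B : Set A) :
    (packingNumber ((1 / 2) ^ m : ℝ) B : ℝ) ≤ α ^ (m + 2) := by
  have hα := one_le_of_isUniformSpace hd hu
  refine le_trans (Nat.cast_le.2 (packingNumber_le (c := ⌊α ^ (m + 2)⌋₊) fun S _ hS => ?_))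
    (Nat.floor_le (by positivity))
  refine Nat.le_floor (hu.card_le_pow hd (by positivity) ?_ S hS)
  -- The exponent `m + 2` suffices because `2 ^ (m + 2) * (1 / 2) ^ m = 4 ≥ 3`.
  rw [pow_add, mul_right_comm, ← mul_pow]
  norm_num

/-! ### The rectangular kernel -/

lemma rectKernel_nonneg (h : ℝ) (a a' : A) : 0 ≤ rectKernel ν h a a' :=
  indicator_nonneg (fun _ _ => inv_nonneg.2 measureReal_nonneg) _

lemma measurable_closedBall_real [BorelSpace A] [SecondCountableTopology A] [IsFiniteMeasure ν]
    (h : ℝ) : Measurable fun a => ν.real (Metric.closedBall a h) := by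
  have : MeasurableSet {p : A × A | dist p.2 p.1 ≤ h} :=
    measurableSet_le (measurable_snd.dist measurable_fst) measurable_const
  exact (measurable_measure_prodMk_left this).ennreal_toReal

lemma measurable_rectKernel [BorelSpace A] [SecondCountableTopology A] [IsFiniteMeasure ν]
    (h : ℝ) : Measurable fun p : A × A => rectKernel ν h p.1 p.2 := by
  have hs : MeasurableSet {p : A × A | dist p.2 p.1 ≤ h} :=
    measurableSet_le (measurable_snd.dist measurable_fst) measurable_const
  have := (((measurable_closedBall_real (ν := ν) h).inv).comp
    (measurable_fst (α := A) (β := A))).indicator hs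
  convert this using 1
  ext p
  simp [rectKernel, indicator]

lemma integral_rectKernel [BorelSpace A] (hd : IsDoublingSpace ν d) {h : ℝ} (hh : 0 < h) (a : A) :
    ∫ a', rectKernel ν h a a' ∂ν = 1 := by
  have h1 := hd.closedBall_real_pos a hh
  unfold rectKernel
  rw [integral_indicator Metric.isClosed_closedBall.measurableSet, setIntegral_const, smul_eq_mul,
    mul_inv_cancel₀ h1.ne']

variable [IsProbabilityMeasure ν]

lemma rectKernel_le_div (hd : IsDoublingSpace ν d) (hu : IsUniformSpace ν α) {h : ℝ} (hh : 0 < h)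
    (a a' b : A) : rectKernel ν h a a' ≤ α / ν.real (Metric.closedBall b (2 * h)) := by
  have hα := one_le_of_isUniformSpace hd hu
  have h1 := hd.closedBall_real_pos a hh
  have h2 := hd.closedBall_real_pos b (r := 2 * h) (by linarith)
  classical
  unfold rectKernel
  rw [indicator_apply]
  split_ifs
  swap
  · positivity
  rw [inv_eq_one_div, div_le_div_iff₀ h1 h2, one_mul]
  exact hu.real_le hd b a hh

lemma rectKernel_le_kernelSup (hd : IsDoublingSpace ν d) (hu : IsUniformSpace ν α) {h : ℝ}
    (hh : 0 < h) (a a' : A) : rectKernel ν h a a' ≤ kernelSup ν h :=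
  le_ciSup (f := fun p : A × A => rectKernel ν h p.1 p.2)
    ⟨α / ν.real (Metric.closedBall a (2 * h)), by
      rintro _ ⟨p, rfl⟩; exact rectKernel_le_div hd hu hh p.1 p.2 a⟩ (a, a')

/-- With `one_le_kernelSup_mul`, this says that `κ_h` is the inverse volume of a ball of radius
about `h`, up to `α`. Uniformity makes the centre irrelevant. -/
lemma kernelSup_mul_le (hd : IsDoublingSpace ν d) (hu : IsUniformSpace ν α) {h : ℝ}
    (hh : 0 < h) (a : A) : kernelSup ν h * ν.real (Metric.closedBall a (2 * h)) ≤ α := by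
  have : Nonempty (A × A) := ⟨(a, a)⟩
  rw [← le_div_iff₀ (hd.closedBall_real_pos a (by linarith))]
  exact ciSup_le fun p => rectKernel_le_div hd hu hh p.1 p.2 a

lemma one_le_kernelSup_mul (hd : IsDoublingSpace ν d) (hu : IsUniformSpace ν α) {h : ℝ}
    (hh : 0 < h) (a : A) : 1 ≤ kernelSup ν h * ν.real (Metric.closedBall a h) := by
  have h1 := hd.closedBall_real_pos a hh
  rw [← div_le_iff₀ h1, one_div]
  have := rectKernel_le_kernelSup hd hu hh a a
  rwa [rectKernel, indicator_of_mem (Metric.mem_closedBall_self hh.le)] at this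

lemma kernelSup_pos (hd : IsDoublingSpace ν d) (hu : IsUniformSpace ν α) {h : ℝ}
    (hh : 0 < h) : 0 < kernelSup ν h := by
  obtain ⟨a⟩ := nonempty_of_isProbabilityMeasure ν
  have h1 := hd.closedBall_real_pos a hh
  have := one_le_kernelSup_mul hd hu hh a
  exact pos_of_mul_pos_left (by linarith) h1.le

end Geometry

namespace Problem

instance {X A Ω ι : Type*} [MeasurableSpace X] [MeasurableSpace A] [MeasurableSpace Ω]
    (B : Problem X A Ω ι) : IsProbabilityMeasure B.ctxLaw := B.isProbabilityMeasure_ctxLaw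

instance {X A Ω ι : Type*} [MeasurableSpace X] [MeasurableSpace A] [MeasurableSpace Ω]
    (B : Problem X A Ω ι) : IsMarkovKernel B.lossLaw := B.isMarkovKernel_lossLaw

/-! ### Expected losses and the benchmark. -/

section Loss

variable {X A Ω ι : Type*} [MeasurableSpace X] [MetricSpace A] [MeasurableSpace A]
  [MeasurableSpace Ω] (B : Problem X A Ω ι)

lemma measurable_condLoss : Measurable fun p : X × A => B.condLoss p.1 p.2 := by
  have h : StronglyMeasurable (Function.uncurry fun (p : X × A) (ω : Ω) => B.loss ω p.2) :=
    (B.measurable_loss.comp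
      (measurable_snd.prodMk (measurable_snd.comp measurable_fst))).stronglyMeasurable
  exact (h.integral_kernel_prod_right' (κ := B.lossLaw.comap Prod.fst measurable_fst)).measurable

lemma measurable_loss_left (a : A) : Measurable fun ω => B.loss ω a :=
  B.measurable_loss.comp (measurable_id.prodMk measurable_const)

lemma integrable_loss (x : X) (a : A) : Integrable (fun ω => B.loss ω a) (B.lossLaw x) :=
  Integrable.of_bound (B.measurable_loss_left a).aestronglyMeasurable 1
    (ae_of_all _ fun ω => by
      rw [Real.norm_eq_abs, abs_of_nonneg (B.loss_mem ω a).1]; exact (B.loss_mem ω a).2)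

lemma condLoss_nonneg (x : X) (a : A) : 0 ≤ B.condLoss x a :=
  integral_nonneg fun ω => (B.loss_mem ω a).1

lemma condLoss_le_one (x : X) (a : A) : B.condLoss x a ≤ 1 := by
  calc B.condLoss x a ≤ ∫ _, (1 : ℝ) ∂(B.lossLaw x) :=
        integral_mono (B.integrable_loss x a) (integrable_const _) fun ω => (B.loss_mem ω a).2
    _ = 1 := by simp

lemma measurable_condLoss_policy (i : ι) : Measurable fun x => B.condLoss x (B.policy i x) :=
  B.measurable_condLoss.comp (measurable_id.prodMk (B.measurable_policy i))

lemma integrable_condLoss_policy (i : ι) :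
    Integrable (fun x => B.condLoss x (B.policy i x)) B.ctxLaw :=
  Integrable.of_bound (B.measurable_condLoss_policy i).aestronglyMeasurable 1
    (ae_of_all _ fun x => by
      rw [Real.norm_eq_abs, abs_of_nonneg (B.condLoss_nonneg _ _)]; exact B.condLoss_le_one _ _)

lemma expLoss_nonneg (i : ι) : 0 ≤ B.expLoss i :=
  integral_nonneg fun x => B.condLoss_nonneg x _

lemma expLoss_le_one (i : ι) : B.expLoss i ≤ 1 := by
  calc B.expLoss i ≤ ∫ _, (1 : ℝ) ∂B.ctxLaw :=
        integral_mono (B.integrable_condLoss_policy i) (integrable_const _)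
          fun x => B.condLoss_le_one x _
    _ = 1 := by simp

variable [Fintype ι]

lemma benchmark_le (i : ι) : B.benchmark ≤ B.expLoss i :=
  ciInf_le ⟨0, by rintro _ ⟨j, rfl⟩; exact B.expLoss_nonneg j⟩ i

lemma benchmark_nonneg : 0 ≤ B.benchmark := Real.iInf_nonneg fun i => B.expLoss_nonneg i

lemma exists_expLoss_eq_benchmark [Nonempty ι] : ∃ i, B.expLoss i = B.benchmark :=
  exists_eq_ciInf_of_finite

lemma nearOptimal_nonempty [Nonempty ι] {ε : ℝ} (hε : 0 ≤ ε) : (B.nearOptimal ε).Nonempty := by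
  obtain ⟨i, hi⟩ := B.exists_expLoss_eq_benchmark
  exact ⟨i, by rw [nearOptimal, mem_ofPred_eq, hi]; linarith⟩

lemma mem_nearOptimal_of_one_le {ε : ℝ} (hε : 1 ≤ ε) (i : ι) : i ∈ B.nearOptimal ε := by
  rw [nearOptimal, mem_ofPred_eq]
  linarith [B.expLoss_le_one i, B.benchmark_nonneg]

end Loss

/-! ### The characteristic volume and its bound by packing numbers. -/

section Volume

variable {X A Ω ι : Type*} [MeasurableSpace X] [MetricSpace A] [MeasurableSpace A] [BorelSpace A]
  [SecondCountableTopology A] [MeasurableSpace Ω] [Fintype ι] {ν : Measure A} {d α : ℝ}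
  (B : Problem X A Ω ι)

lemma measurable_packingNumber {δ : ℝ} (hδ : 0 < δ) (J : Set ι) :
    Measurable fun x => packingNumber δ ((fun i => B.policy i x) '' J) := by
  refine measurable_of_Ici fun n => ?_
  have : (fun x => packingNumber δ ((fun i => B.policy i x) '' J)) ⁻¹' Ici n =
      ⋃ I : Finset ι, {x | ((I : Set ι) ⊆ J ∧ n ≤ I.card) ∧
        ∀ i ∈ I, ∀ j ∈ I, i ≠ j → δ ≤ dist (B.policy i x) (B.policy j x)} := by
    ext x
    simp only [mem_preimage, mem_Ici, mem_iUnion, mem_ofPred_eq]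
    exact le_packingNumber_image_iff hδ _ J n
  rw [this]
  refine MeasurableSet.iUnion fun I => (MeasurableSet.const _).inter ?_
  have : {x | ∀ i ∈ I, ∀ j ∈ I, i ≠ j → δ ≤ dist (B.policy i x) (B.policy j x)} =
      ⋂ i ∈ I, ⋂ j ∈ I, {x | i ≠ j → δ ≤ dist (B.policy i x) (B.policy j x)} := by
    ext x; simp
  change MeasurableSet {x | ∀ i ∈ I, ∀ j ∈ I, i ≠ j → δ ≤ dist (B.policy i x) (B.policy j x)}
  rw [this]
  refine I.measurableSet_biInter fun i _ => I.measurableSet_biInter fun j _ => ?_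
  exact (MeasurableSet.const _).imp
    (measurableSet_le measurable_const ((B.measurable_policy i).dist (B.measurable_policy j)))

lemma integrable_packingNumber {δ : ℝ} (hδ : 0 < δ) (J : Set ι) :
    Integrable (fun x => (packingNumber δ ((fun i => B.policy i x) '' J) : ℝ)) B.ctxLaw :=
  Integrable.of_bound
    (measurable_from_top.comp (B.measurable_packingNumber hδ J)).aestronglyMeasurable
    (Fintype.card ι) (ae_of_all _ fun x => by
      rw [Real.norm_eq_abs, abs_of_nonneg (Nat.cast_nonneg _)]
      exact_mod_cast packingNumber_image_le _ _ _)

lemma expPacking_le_of_forall {δ ε c : ℝ} (hδ : 0 < δ)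
    (h : ∀ x, (packingNumber δ ((fun i => B.policy i x) '' B.nearOptimal ε) : ℝ) ≤ c) :
    B.expPacking ε δ ≤ c := by
  calc B.expPacking ε δ ≤ ∫ _, c ∂B.ctxLaw :=
        integral_mono (B.integrable_packingNumber hδ _) (integrable_const _) h
    _ = c := by simp

lemma expPacking_le_card {δ : ℝ} (hδ : 0 < δ) (ε : ℝ) :
    B.expPacking ε δ ≤ Fintype.card ι :=
  B.expPacking_le_of_forall hδ fun _ => by exact_mod_cast packingNumber_image_le _ _ _

lemma one_le_expPacking [Nonempty ι] {δ ε : ℝ} (hδ : 0 < δ) (hε : 0 ≤ ε) :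
    1 ≤ B.expPacking ε δ := by
  calc (1 : ℝ) = ∫ _, (1 : ℝ) ∂B.ctxLaw := by simp
    _ ≤ _ := integral_mono (integrable_const _) (B.integrable_packingNumber hδ _) fun x => by
      exact Nat.one_le_cast.2 (one_le_packingNumber_image hδ _ (B.nearOptimal_nonempty hε))

variable [IsProbabilityMeasure ν]

lemma expPacking_half_pow_le (hd : IsDoublingSpace ν d) (hu : IsUniformSpace ν α) (m : ℕ)
    (ε : ℝ) : B.expPacking ε ((1 / 2) ^ m) ≤ α ^ (m + 2) :=
  B.expPacking_le_of_forall (by positivity) fun _ => packingNumber_half_pow_le hd hu m _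

/-- The set of the pairs (context, action) whose action is `h`-close to the action that some
policy in `P` chooses. -/
def region (h : ℝ) (P : Finset ι) : Set (X × A) :=
  {p | ∃ i ∈ P, dist p.2 (B.policy i p.1) ≤ h}

lemma measurableSet_region (h : ℝ) (P : Finset ι) : MeasurableSet (B.region h P) := by
  have : B.region h P = ⋃ i ∈ P, {p : X × A | dist p.2 (B.policy i p.1) ≤ h} := by
    ext p; simp [region]
  rw [this]
  exact P.measurableSet_biUnion fun i _ => measurableSet_le
    (measurable_snd.dist ((B.measurable_policy i).comp measurable_fst)) measurable_const

lemma prodMk_preimage_region (h : ℝ) (P : Finset ι) (x : X) :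
    Prod.mk x ⁻¹' B.region h P = ⋃ i ∈ P, Metric.closedBall (B.policy i x) h := by
  ext a; simp [region]

lemma measurable_volume_section (h : ℝ) (P : Finset ι) :
    Measurable fun x => ν.real (⋃ i ∈ P, Metric.closedBall (B.policy i x) h) := by
  simp_rw [← prodMk_preimage_region]
  exact (measurable_measure_prodMk_left (B.measurableSet_region h P)).ennreal_toReal

lemma integrable_volume_section (h : ℝ) (P : Finset ι) :
    Integrable (fun x => ν.real (⋃ i ∈ P, Metric.closedBall (B.policy i x) h)) B.ctxLaw :=
  Integrable.of_bound (B.measurable_volume_section h P).aestronglyMeasurable 1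
    (ae_of_all _ fun x => by
      rw [Real.norm_eq_abs, abs_of_nonneg measureReal_nonneg]; exact measureReal_le_one)

/-- In this form the volume is the mass of the support `U` in `exists_mixture_integral_div_le`,
applied on the product of contexts and actions. -/
lemma charVolume_eq_prod (h : ℝ) (P : Finset ι) :
    B.charVolume ν h P = (B.ctxLaw.prod ν).real (B.region h P) := by
  have hm : Measurable fun x => ν (Prod.mk x ⁻¹' B.region h P) :=
    measurable_measure_prodMk_left (B.measurableSet_region h P)
  rw [measureReal_def, Measure.prod_apply (B.measurableSet_region h P),
    ← integral_toReal hm.aemeasurable (ae_of_all _ fun x => measure_lt_top _ _)]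
  simp_rw [prodMk_preimage_region]
  rfl

lemma charVolume_nonneg (h : ℝ) (P : Finset ι) : 0 ≤ B.charVolume ν h P :=
  integral_nonneg fun _ => measureReal_nonneg

/-- A single ball suffices. As a consequence, a batch can have size zero only if `r_m ^ 2 > 320`. -/
lemma one_le_kernelSup_mul_charVolume (hd : IsDoublingSpace ν d) (hu : IsUniformSpace ν α)
    {h : ℝ} (hh : 0 < h) {P : Finset ι} (hP : P.Nonempty) :
    1 ≤ kernelSup ν h * B.charVolume ν h P := by
  obtain ⟨i, hi⟩ := hP
  have hκ := kernelSup_pos hd hu hh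
  rw [mul_comm, ← div_le_iff₀ hκ]
  calc 1 / kernelSup ν h = ∫ _, 1 / kernelSup ν h ∂B.ctxLaw := by simp
    _ ≤ _ := integral_mono (integrable_const _) (B.integrable_volume_section h P) fun x => ?_
  have h1 := one_le_kernelSup_mul hd hu hh (B.policy i x)
  rw [mul_comm, ← div_le_iff₀ hκ] at h1
  exact h1.trans (measureReal_mono
    (subset_biUnion_of_mem (s := (P : Set ι)) (u := fun i => Metric.closedBall (B.policy i x) h) hi)
    (measure_ne_top _ _))

/-- A maximal `h`-packing of the actions on context `x` is an `h`-net, so the balls of radius `2 h`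
around it cover the union of the balls of radius `h`. Each has volume at most `α / κ_h`. -/
lemma kernelSup_mul_charVolume_le (hd : IsDoublingSpace ν d) (hu : IsUniformSpace ν α)
    {h ε : ℝ} (hh : 0 < h) {P : Finset ι} (hP : (P : Set ι) ⊆ B.nearOptimal ε) :
    kernelSup ν h * B.charVolume ν h P ≤ α * B.expPacking ε h := by
  have hκ := kernelSup_pos hd hu hh
  unfold charVolume expPacking
  rw [← integral_const_mul, ← integral_const_mul]
  refine integral_mono ((B.integrable_volume_section h P).const_mul _)
    ((B.integrable_packingNumber hh _).const_mul _) fun x => ?_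
  obtain ⟨S, h1, -, h3, h4⟩ := exists_maximal_packing hh
    (fun S h _ => card_le_of_subset_image (fun i => B.policy i x) (B.nearOptimal ε) S h)
  have hsub : (⋃ i ∈ P, Metric.closedBall (B.policy i x) h) ⊆
      ⋃ a ∈ S, Metric.closedBall a (2 * h) := by
    refine iUnion₂_subset fun i hi b hb => ?_
    obtain ⟨a, ha, hab⟩ := h4 _ ⟨i, hP hi, rfl⟩
    refine mem_biUnion (Finset.mem_coe.2 ha) ?_
    rw [Metric.mem_closedBall] at hb ⊢
    linarith [dist_triangle b (B.policy i x) a]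
  calc kernelSup ν h * ν.real (⋃ i ∈ P, Metric.closedBall (B.policy i x) h)
      ≤ kernelSup ν h * ∑ a ∈ S, ν.real (Metric.closedBall a (2 * h)) := by
        gcongr
        exact (measureReal_mono hsub (measure_ne_top _ _)).trans (measureReal_biUnion_finset_le _ _)
    _ = ∑ a ∈ S, kernelSup ν h * ν.real (Metric.closedBall a (2 * h)) := Finset.mul_sum _ _ _
    _ ≤ ∑ _a ∈ S, α := Finset.sum_le_sum fun a _ => kernelSup_mul_le hd hu hh a
    _ = α * packingNumber h ((fun i => B.policy i x) '' B.nearOptimal ε) := by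
        rw [Finset.sum_const, nsmul_eq_mul, h3, mul_comm]

end Volume

end Problem

/-! ### A mixture of kernels with small importance weights. -/

lemma sub_two_mul_sq_le_log {x : ℝ} (hx : -(1 / 2) ≤ x) : x - 2 * x ^ 2 ≤ Real.log (1 + x) := by
  have h0 : 0 < 1 + x := by linarith
  have h1 := Real.one_sub_inv_le_log_of_pos h0
  have h2 : 1 - (1 + x)⁻¹ = x / (1 + x) := by field_simp; ring
  refine le_trans ?_ (h2 ▸ h1)
  rw [le_div_iff₀ h0]
  nlinarith [mul_nonneg (sq_nonneg x) (by linarith : 0 ≤ 1 + 2 * x)]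

namespace Problem

lemma integrable_of_measurable_of_mem_Icc {Y : Type*} [MeasurableSpace Y] {ρ : Measure Y}
    [IsFiniteMeasure ρ] {f : Y → ℝ} (hf : Measurable f) {a b : ℝ} (h : ∀ y, f y ∈ Icc a b) :
    Integrable f ρ :=
  Integrable.of_bound hf.aestronglyMeasurable (max |a| |b|)
    (ae_of_all _ fun y => abs_le_max_abs_abs (h y).1 (h y).2)

lemma weightedSum_mem_Icc {ι : Type*} [Fintype ι] {P : Finset ι} {w : ι → ℝ}
    (hw : w ∈ distributionsOn P) {k : ι → ℝ} {a b : ℝ} (hk : ∀ i ∈ P, k i ∈ Icc a b) :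
    ∑ i, w i * k i ∈ Icc a b := by
  obtain ⟨h1, h2, h3⟩ := hw
  have key : ∀ c : ℝ, ∑ i, w i * c = c := fun c => by rw [← Finset.sum_mul, h3, one_mul]
  constructor
  · rw [← key a]
    refine Finset.sum_le_sum fun i _ => ?_
    by_cases hi : i ∈ P
    · exact mul_le_mul_of_nonneg_left (hk i hi).1 (h1 i)
    · simp [h2 i hi]
  · rw [← key b]
    refine Finset.sum_le_sum fun i _ => ?_
    by_cases hi : i ∈ P
    · exact mul_le_mul_of_nonneg_left (hk i hi).2 (h1 i)
    · simp [h2 i hi]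

/-- For any family of nonnegative bounded functions supported in `U`, some mixture `q` of them,
smoothed by the constant `μ ≤ 1/2`, has all importance weights `∫ K i / q` at most `2 ρ(U)`, up to
an arbitrarily small error: an almost maximizer of `∫_U log q` will do. -/
lemma exists_mixture_integral_div_le {Y ι : Type*} [MeasurableSpace Y] [Fintype ι] (ρ : Measure Y)
    [IsProbabilityMeasure ρ] {P : Finset ι} (hP : P.Nonempty) {U : Set Y}
    {k : ι → Y → ℝ} {κ μ : ℝ} (hk : ∀ i, Measurable (k i)) (hκ : ∀ i y, k i y ∈ Icc 0 κ)
    (hsupp : ∀ i ∈ P, ∀ y ∉ U, k i y = 0) (hμ : 0 < μ) (hμ' : μ ≤ 1 / 2) {ε : ℝ} (hε : 0 < ε) :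
    ∃ w ∈ distributionsOn P, ∀ i ∈ P,
      ∫ y, k i y * (1 / (μ + (1 - μ) * ∑ j, w j * k j y)) ∂ρ ≤ 2 * ρ.real U + ε := by
  classical
  have hκ0 : 0 ≤ κ := by
    obtain ⟨i, _⟩ := hP
    obtain ⟨y⟩ := nonempty_of_isProbabilityMeasure ρ
    exact (hκ i y).1.trans (hκ i y).2
  set q : (ι → ℝ) → Y → ℝ := fun w y => μ + (1 - μ) * ∑ j, w j * k j y with hq
  have hqm : ∀ w, Measurable (q w) := fun w =>
    measurable_const.add (measurable_const.mul
      (Finset.measurable_sum _ fun j _ => measurable_const.mul (hk j)))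
  have hqb : ∀ w ∈ distributionsOn P, ∀ y, q w y ∈ Icc μ (1 + κ) := fun w hw y => by
    have := weightedSum_mem_Icc hw fun i _ => hκ i y
    constructor
    · have : 0 ≤ (1 - μ) * ∑ j, w j * k j y := mul_nonneg (by linarith) this.1
      simp only [hq]; linarith
    · have : (1 - μ) * ∑ j, w j * k j y ≤ 1 * κ :=
        mul_le_mul (by linarith) this.2 this.1 zero_le_one
      simp only [hq]; linarith
  have hlogb : ∀ w ∈ distributionsOn P, ∀ y,
      Real.log (q w y) ∈ Icc (Real.log μ) (Real.log (1 + κ)) := fun w hw y =>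
    ⟨Real.log_le_log hμ (hqb w hw y).1, Real.log_le_log (hμ.trans_le (hqb w hw y).1)
      (hqb w hw y).2⟩
  have hlogi : ∀ w ∈ distributionsOn P, Integrable (fun y => Real.log (q w y)) ρ := fun w hw =>
    integrable_of_measurable_of_mem_Icc (hqm w).log (hlogb w hw)
  -- The derivative of `F` at `w` towards policy `i` is at least `(1 - μ) ∫ k i / q - ρ(U)`. At a
  -- maximizer it is nonpositive, which is the claim up to the factor `1 / (1 - μ) ≤ 2`.
  set F : (ι → ℝ) → ℝ := fun w => ∫ y in U, Real.log (q w y) ∂ρ with hF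
  set b : ℝ := κ / μ + 1 with hb
  have hb1 : 1 ≤ b := by have : 0 ≤ κ / μ := by positivity
                         linarith
  -- The step towards `i`. Since `b` bounds the relative increment `u` below, `|s u| ≤ 1/2` keeps
  -- the logarithm under control, and the second order error is at most `s ε / 4`.
  set s : ℝ := min (1 / (2 * b)) (ε / (8 * b ^ 2)) with hs
  have hs0 : 0 < s := lt_min (by positivity) (by positivity)
  have hsb : s * b ≤ 1 / 2 := by
    have := min_le_left (1 / (2 * b)) (ε / (8 * b ^ 2))
    rw [← hs, le_div_iff₀ (by positivity)] at this
    linarith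
  have hs1 : s ≤ 1 := by nlinarith
  have hse : 2 * s * b ^ 2 ≤ ε / 4 := by
    have := min_le_right (1 / (2 * b)) (ε / (8 * b ^ 2))
    rw [← hs, le_div_iff₀ (by positivity)] at this
    linarith
  obtain ⟨i₀, hi₀⟩ := hP
  have hne : (F '' distributionsOn P).Nonempty := by
    refine ⟨_, Pi.single i₀ 1, ⟨fun i => ?_, fun i hi => ?_, ?_⟩, rfl⟩
    · by_cases h : i = i₀
      · subst h; simp
      · simp [h]
    · have : i ≠ i₀ := fun h => hi (h ▸ hi₀)
      simp [this]
    · simp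
  have hbdd : BddAbove (F '' distributionsOn P) := by
    refine ⟨∫ _ in U, Real.log (1 + κ) ∂ρ, ?_⟩
    rintro _ ⟨w, hw, rfl⟩
    exact integral_mono (hlogi w hw).integrableOn (integrable_const _)
      fun y => (hlogb w hw y).2
  -- An approximate maximizer is enough, so neither continuity of `F` nor compactness of the simplex
  -- is used. The slack is small compared with the step `s`.
  obtain ⟨_, ⟨w, hw, rfl⟩, hwF⟩ := exists_lt_of_lt_csSup hne
    (show sSup (F '' distributionsOn P) - s * (ε / 4) < sSup (F '' distributionsOn P) by
      have : 0 < s * (ε / 4) := by positivity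
      linarith)
  refine ⟨w, hw, fun i hi => ?_⟩
  set v : ι → ℝ := fun j => (1 - s) * w j + s * (if j = i then 1 else 0) with hv
  have hvP : v ∈ distributionsOn P := by
    obtain ⟨h1, h2, h3⟩ := hw
    refine ⟨fun j => ?_, fun j hj => ?_, ?_⟩
    · have : (0 : ℝ) ≤ if j = i then 1 else 0 := by split_ifs <;> norm_num
      have := h1 j
      have : 0 ≤ 1 - s := by linarith
      positivity
    · have : j ≠ i := fun h => hj (h ▸ hi)
      simp [hv, h2 j hj, this]
    · simp only [hv, Finset.sum_add_distrib, ← Finset.mul_sum, h3]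
      simp
  have hqv : ∀ y, q v y = q w y + s * ((1 - μ) * (k i y - ∑ j, w j * k j y)) := fun y => by
    have : ∑ j, v j * k j y = (1 - s) * ∑ j, w j * k j y + s * k i y := by
      simp only [hv, add_mul, Finset.sum_add_distrib, Finset.mul_sum, mul_assoc]
      congr 1
      simp
    simp only [hq, this]
    ring
  have hqi : Integrable (fun y => k i y * (1 / q w y)) ρ := by
    refine integrable_of_measurable_of_mem_Icc ((hk i).mul (measurable_const.div (hqm w)))
      (a := 0) (b := κ * (1 / μ)) fun y => ?_
    have h1 := hμ.trans_le (hqb w hw y).1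
    exact ⟨mul_nonneg (hκ i y).1 (by positivity), mul_le_mul (hκ i y).2
      (one_div_le_one_div_of_le hμ (hqb w hw y).1) (by positivity) hκ0⟩
  have hpt : ∀ y, s * ((1 - μ) * (k i y * (1 / q w y))) - (s + 2 * s ^ 2 * b ^ 2) ≤
      Real.log (q v y) - Real.log (q w y) := fun y => by
    have hqpos : 0 < q w y := hμ.trans_le (hqb w hw y).1
    have hqpos' : 0 < q v y := hμ.trans_le (hqb v hvP y).1
    have hsum := weightedSum_mem_Icc hw fun i _ => hκ i y
    set u : ℝ := (1 - μ) * (k i y - ∑ j, w j * k j y) / q w y with hu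
    have hub : |u| ≤ b := by
      rw [hu, abs_div, abs_of_pos hqpos, div_le_iff₀ hqpos, abs_mul,
        abs_of_nonneg (by linarith : 0 ≤ 1 - μ)]
      have h1 : |k i y - ∑ j, w j * k j y| ≤ κ :=
        abs_le.2 ⟨by linarith [(hκ i y).1, hsum.2], by linarith [(hκ i y).2, hsum.1]⟩
      calc (1 - μ) * |k i y - ∑ j, w j * k j y| ≤ 1 * κ :=
            mul_le_mul (by linarith) h1 (abs_nonneg _) zero_le_one
        _ = κ / μ * μ := by field_simp
        _ ≤ b * q w y := mul_le_mul (by linarith) (hqb w hw y).1 hμ.le (by linarith)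
    -- The subtracted mixture term is part of `q`, so its quotient by `q` is at most one.
    have hu1 : (1 - μ) * (k i y * (1 / q w y)) - 1 ≤ u := by
      have h1 : (1 - μ) * (∑ j, w j * k j y) / q w y ≤ 1 := by
        rw [div_le_one hqpos]; simp only [hq]; linarith
      have h2 : u = (1 - μ) * (k i y * (1 / q w y)) - (1 - μ) * (∑ j, w j * k j y) / q w y := by
        rw [hu]; field_simp
      linarith
    have h3 : q v y = q w y * (1 + s * u) := by
      rw [hqv, hu]; field_simp
    have h4 : |s * u| ≤ 1 / 2 := by
      rw [abs_mul, abs_of_pos hs0]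
      exact (mul_le_mul_of_nonneg_left hub hs0.le).trans hsb
    have h5 := sub_two_mul_sq_le_log (abs_le.1 h4).1
    have h6 : 0 < 1 + s * u := by linarith [(abs_le.1 h4).1]
    rw [h3, Real.log_mul hqpos.ne' h6.ne', add_sub_cancel_left]
    refine le_trans ?_ h5
    have h7 : u ^ 2 ≤ b ^ 2 := sq_le_sq' (abs_le.1 hub).1 (abs_le.1 hub).2
    have h8 : s ^ 2 * u ^ 2 ≤ s ^ 2 * b ^ 2 := by gcongr
    have h9 := mul_le_mul_of_nonneg_left hu1 hs0.le
    rw [mul_pow]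
    linarith
  -- The constant terms are integrated over `U` only. This produces `ρ(U)` instead of `1`, and loses
  -- nothing since `k i` vanishes outside `U`.
  have hint := integral_mono (μ := ρ.restrict U)
    (((hqi.const_mul (1 - μ)).const_mul s).sub (integrable_const _)).integrableOn
    ((hlogi v hvP).sub (hlogi w hw)).integrableOn hpt
  simp only [Pi.sub_apply] at hint
  rw [integral_sub (((hqi.const_mul (1 - μ)).const_mul s)).integrableOn (integrable_const _),
    integral_sub (hlogi v hvP).integrableOn (hlogi w hw).integrableOn, integral_const_mul,
    integral_const_mul, integral_const, smul_eq_mul, measureReal_restrict_apply_univ,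
    setIntegral_eq_integral_of_forall_compl_eq_zero
      (fun y hy => by rw [hsupp i hi y hy, zero_mul])] at hint
  have hFv : F v ≤ sSup (F '' distributionsOn P) := le_csSup hbdd ⟨v, hvP, rfl⟩
  have hF' : F v - F w ≤ s * (ε / 4) := by linarith
  have hU1 : ρ.real U ≤ 1 := measureReal_le_one
  have hG0 : 0 ≤ ∫ y, k i y * (1 / q w y) ∂ρ := integral_nonneg fun y =>
    mul_nonneg (hκ i y).1 (one_div_nonneg.2 (hμ.le.trans (hqb w hw y).1))
  set G := ∫ y, k i y * (1 / q w y) ∂ρ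
  have h10 : s * ((1 - μ) * G) ≤ s * (ρ.real U + ε / 4 + ε / 4) := by
    have : ρ.real U * (2 * s ^ 2 * b ^ 2) ≤ 1 * (2 * s ^ 2 * b ^ 2) := by gcongr
    have := mul_le_mul_of_nonneg_left hse hs0.le
    nlinarith [hint, hF']
  have h11 := le_of_mul_le_mul_left h10 hs0
  nlinarith

lemma bandwidth_pos (m : ℕ) : 0 < bandwidth m := by unfold bandwidth; positivity

lemma radius_eq (L : ℝ) (m : ℕ) : radius L m = L * bandwidth m := rfl

lemma radius_pos {L : ℝ} (hL : 1 ≤ L) (m : ℕ) : 0 < radius L m := by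
  unfold radius; positivity

lemma exploreProb_pos {L : ℝ} (hL : 1 ≤ L) (m : ℕ) : 0 < exploreProb L m :=
  lt_min (by norm_num) (radius_pos hL m)

lemma exploreProb_le_half (L : ℝ) (m : ℕ) : exploreProb L m ≤ 1 / 2 := min_le_left _ _

lemma exploreProb_le_radius (L : ℝ) (m : ℕ) : exploreProb L m ≤ radius L m := min_le_right _ _

/-! ### The exploration density chosen by the solver. -/

section Density

variable {X A Ω ι : Type*} [MeasurableSpace X] [MetricSpace A] [MeasurableSpace A] [BorelSpace A]
  [SecondCountableTopology A] [MeasurableSpace Ω] [Fintype ι] {ν : Measure A} {d α L : ℝ}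
  (B : Problem X A Ω ι) [IsProbabilityMeasure ν]

lemma measurable_rectKernel_policy (h : ℝ) (i : ι) :
    Measurable fun p : X × A => rectKernel ν h (B.policy i p.1) p.2 :=
  (measurable_rectKernel (ν := ν) h).comp
    (((B.measurable_policy i).comp measurable_fst).prodMk measurable_snd)

lemma measurable_actionDensity (L : ℝ) (m : ℕ) (w : ι → ℝ) :
    Measurable fun p : X × A => B.actionDensity ν L m w p.1 p.2 :=
  measurable_const.add (measurable_const.mul (Finset.measurable_sum _ fun i _ =>
    measurable_const.mul (B.measurable_rectKernel_policy _ i)))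

lemma rectKernel_mem_Icc (hd : IsDoublingSpace ν d) (hu : IsUniformSpace ν α) {h : ℝ}
    (hh : 0 < h) (a a' : A) : rectKernel ν h a a' ∈ Icc 0 (kernelSup ν h) :=
  ⟨rectKernel_nonneg h a a', rectKernel_le_kernelSup hd hu hh a a'⟩

lemma actionDensity_mem_Icc (hd : IsDoublingSpace ν d) (hu : IsUniformSpace ν α) (hL : 1 ≤ L)
    (m : ℕ) {P : Finset ι} {w : ι → ℝ} (hw : w ∈ distributionsOn P) (x : X) (a : A) :
    B.actionDensity ν L m w x a ∈
      Icc (exploreProb L m) (1 + kernelSup ν (bandwidth m)) := by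
  have h1 := weightedSum_mem_Icc hw fun i _ =>
    rectKernel_mem_Icc hd hu (bandwidth_pos m) (B.policy i x) a
  have h2 := exploreProb_le_half L m
  have h3 := exploreProb_pos hL m
  unfold actionDensity
  constructor
  · have := mul_nonneg (by linarith : 0 ≤ 1 - exploreProb L m) h1.1
    linarith
  · have := mul_le_mul (by linarith : 1 - exploreProb L m ≤ 1) h1.2 h1.1 zero_le_one
    linarith

/-- Importance weights of the exploration distribution of the algorithm. -/
lemma integral_rectKernel_div_actionDensity_le (hd : IsDoublingSpace ν d)
    (hu : IsUniformSpace ν α) (hL : 1 ≤ L) {Q : ℕ → Finset ι → ι → ℝ} (hQ : B.IsSolver ν L Q)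
    {m : ℕ} (hm : 1 ≤ m) {P : Finset ι} {i : ι} (hi : i ∈ P) :
    ∫ x, ∫ a, rectKernel ν (bandwidth m) (B.policy i x) a *
      (1 / B.actionDensity ν L m (Q m P) x a) ∂ν ∂B.ctxLaw ≤
        2 * B.charVolume ν (bandwidth m) P := by
  have hμ := exploreProb_pos hL m
  have hP : P.Nonempty := ⟨i, hi⟩
  obtain ⟨-, hmin⟩ := hQ m P hm hP
  have hfin : ∀ w, BddAbove (range fun j : P => ∫ x, ∫ a, rectKernel ν (bandwidth m)
      (B.policy j x) a * (1 / B.actionDensity ν L m w x a) ∂ν ∂B.ctxLaw) :=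
    fun w => (finite_range _).bddAbove
  refine (le_ciSup (hfin (Q m P)) ⟨i, hi⟩).trans (le_of_forall_pos_le_add fun ε hε => ?_)
  -- The solver's minimum is compared with the mixture that exists on the product space.
  obtain ⟨w, hw, hwb⟩ := exists_mixture_integral_div_le (B.ctxLaw.prod ν) hP
    (U := B.region (bandwidth m) P)
    (k := fun j p => rectKernel ν (bandwidth m) (B.policy j p.1) p.2)
    (fun j => B.measurable_rectKernel_policy _ j)
    (fun j p => rectKernel_mem_Icc hd hu (bandwidth_pos m) _ _)
    (fun j hj p hp => indicator_of_notMem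
      (s := Metric.closedBall (B.policy j p.1) (bandwidth m)) (fun h => hp ⟨j, hj, h⟩) _)
    hμ (exploreProb_le_half L m) hε
  refine (hmin hw).trans ?_
  have : Nonempty P := ⟨⟨i, hi⟩⟩
  refine ciSup_le fun j => ?_
  rw [charVolume_eq_prod]
  refine le_trans (le_of_eq ?_) (hwb j j.2)
  rw [integral_prod]
  · rfl
  · have hw' := fun p : X × A => B.actionDensity_mem_Icc hd hu hL m hw p.1 p.2
    refine integrable_of_measurable_of_mem_Icc (a := 0)
      (b := kernelSup ν (bandwidth m) * (1 / exploreProb L m))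
      ((B.measurable_rectKernel_policy _ _).mul
        (measurable_const.div (B.measurable_actionDensity L m w))) fun p => ?_
    have hk := rectKernel_mem_Icc hd hu (bandwidth_pos m) (B.policy j p.1) p.2
    exact ⟨mul_nonneg hk.1 (one_div_nonneg.2 (hμ.le.trans (hw' p).1)),
      mul_le_mul hk.2 (one_div_le_one_div_of_le hμ (hw' p).1)
        (one_div_nonneg.2 (hμ.le.trans (hw' p).1)) (hk.1.trans hk.2)⟩

end Density

/-- The law of a round (context, action, observed loss) that is played in epoch `m` with the
weights `w`. -/
def playLaw {X A Ω ι : Type*} [MeasurableSpace X] [MetricSpace A] [MeasurableSpace A]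
    [MeasurableSpace Ω] [Fintype ι] (B : Problem X A Ω ι) (ν : Measure A) (L : ℝ) (m : ℕ)
    (w : ι → ℝ) : Measure (X × A × ℝ) :=
  B.ctxLaw.bind fun x =>
    (ν.withDensity fun a => ENNReal.ofReal (B.actionDensity ν L m w x a)).bind fun a =>
      (B.lossLaw x).map fun ω => (x, a, B.loss ω a)

/-- The expected loss of the policy `i`, smoothed with bandwidth `h`. -/
def smoothLoss {X A Ω ι : Type*} [MeasurableSpace X] [MetricSpace A] [MeasurableSpace A]
    [MeasurableSpace Ω] (B : Problem X A Ω ι) (ν : Measure A) (h : ℝ) (i : ι) : ℝ :=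
  ∫ p : X × A, rectKernel ν h (B.policy i p.1) p.2 * B.condLoss p.1 p.2 ∂(B.ctxLaw.prod ν)

/-! ### Expectations over one round: unbiasedness, second moment, bias and expected loss. -/

section PlayLaw

variable {X A Ω ι : Type*} [MeasurableSpace X] [MetricSpace A] [MeasurableSpace A] [BorelSpace A]
  [SecondCountableTopology A] [MeasurableSpace Ω] [Fintype ι] {ν : Measure A} {d α L : ℝ}
  (B : Problem X A Ω ι) [IsProbabilityMeasure ν]

lemma measurable_outcome :
    Measurable fun z : (X × A) × Ω => (z.1.1, z.1.2, B.loss z.2 z.1.2) :=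
  (measurable_fst.comp measurable_fst).prodMk ((measurable_snd.comp measurable_fst).prodMk
    (B.measurable_loss.comp (measurable_snd.prodMk (measurable_snd.comp measurable_fst))))

lemma measurable_outcome_right (p : X × A) :
    Measurable fun ω : Ω => (p.1, p.2, B.loss ω p.2) :=
  measurable_const.prodMk (measurable_const.prodMk (B.measurable_loss_left p.2))

lemma measurable_lintegral_outcome {F : X × A × ℝ → ENNReal} (hF : Measurable F) :
    Measurable fun p : X × A => ∫⁻ ω, F (p.1, p.2, B.loss ω p.2) ∂(B.lossLaw p.1) := by
  have h : Measurable fun z : (X × A) × Ω => F (z.1.1, z.1.2, B.loss z.2 z.1.2) :=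
    hF.comp B.measurable_outcome
  have h2 := h.lintegral_kernel_prod_right'
    (κ := (B.lossLaw.comap Prod.fst measurable_fst : Kernel (X × A) Ω))
  simp only [Kernel.comap_apply] at h2
  exact h2

lemma measurable_map_lossLaw :
    Measurable fun p : X × A => (B.lossLaw p.1).map fun ω => (p.1, p.2, B.loss ω p.2) := by
  refine Measure.measurable_of_measurable_coe _ fun s hs => ?_
  have h1 : Measurable (s.indicator (1 : X × A × ℝ → ENNReal)) := measurable_one.indicator hs
  convert B.measurable_lintegral_outcome h1 using 1
  ext p
  rw [← lintegral_indicator_one hs, lintegral_map h1 (B.measurable_outcome_right p)]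

lemma lintegral_actionLaw_bind (L : ℝ) (m : ℕ) (w : ι → ℝ) (x : X) {F : X × A × ℝ → ENNReal}
    (hF : Measurable F) :
    ∫⁻ z, F z ∂((ν.withDensity fun a => ENNReal.ofReal (B.actionDensity ν L m w x a)).bind
        fun a => (B.lossLaw x).map fun ω => (x, a, B.loss ω a)) =
      ∫⁻ a, ENNReal.ofReal (B.actionDensity ν L m w x a) *
        ∫⁻ ω, F (x, a, B.loss ω a) ∂(B.lossLaw x) ∂ν := by
  have hq : Measurable fun a => ENNReal.ofReal (B.actionDensity ν L m w x a) :=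
    ((B.measurable_actionDensity L m w).comp (measurable_prodMk_left (x := x))).ennreal_ofReal
  have hm : Measurable fun a : A => (B.lossLaw x).map fun ω => (x, a, B.loss ω a) :=
    B.measurable_map_lossLaw.comp (measurable_prodMk_left (x := x))
  have hl : ∀ a : A, ∫⁻ z, F z ∂((B.lossLaw x).map fun ω => (x, a, B.loss ω a)) =
      ∫⁻ ω, F (x, a, B.loss ω a) ∂(B.lossLaw x) := fun a =>
    lintegral_map hF (B.measurable_outcome_right (x, a))
  have hF' : Measurable fun a => ∫⁻ ω, F (x, a, B.loss ω a) ∂(B.lossLaw x) :=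
    (B.measurable_lintegral_outcome hF).comp (measurable_prodMk_left (x := x))
  rw [Measure.lintegral_bind hm.aemeasurable hF.aemeasurable]
  simp_rw [hl]
  rw [lintegral_withDensity_eq_lintegral_mul _ hq hF']
  rfl

lemma lintegral_playLaw (L : ℝ) (m : ℕ) (w : ι → ℝ) {F : X × A × ℝ → ENNReal}
    (hF : Measurable F) : ∫⁻ z, F z ∂(B.playLaw ν L m w) =
      ∫⁻ p : X × A, ENNReal.ofReal (B.actionDensity ν L m w p.1 p.2) *
        ∫⁻ ω, F (p.1, p.2, B.loss ω p.2) ∂(B.lossLaw p.1) ∂(B.ctxLaw.prod ν) := by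
  have hq : Measurable fun p : X × A => ENNReal.ofReal (B.actionDensity ν L m w p.1 p.2) :=
    (B.measurable_actionDensity L m w).ennreal_ofReal
  have hmeas : Measurable fun x =>
      (ν.withDensity fun a => ENNReal.ofReal (B.actionDensity ν L m w x a)).bind
        fun a => (B.lossLaw x).map fun ω => (x, a, B.loss ω a) := by
    refine Measure.measurable_of_measurable_coe _ fun s hs => ?_
    have h1 : Measurable (s.indicator (1 : X × A × ℝ → ENNReal)) := measurable_one.indicator hs
    have h2 := (hq.mul (B.measurable_lintegral_outcome h1)).lintegral_prod_right' (ν := ν)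
    convert h2 using 1
    ext x
    rw [← lintegral_indicator_one hs, B.lintegral_actionLaw_bind L m w x h1]
    rfl
  rw [playLaw, Measure.lintegral_bind hmeas.aemeasurable hF.aemeasurable,
    lintegral_prod (fun p : X × A => ENNReal.ofReal (B.actionDensity ν L m w p.1 p.2) *
      ∫⁻ ω, F (p.1, p.2, B.loss ω p.2) ∂(B.lossLaw p.1))
      (hq.mul (B.measurable_lintegral_outcome hF)).aemeasurable]
  exact lintegral_congr fun x => B.lintegral_actionLaw_bind L m w x hF

/-- Context and action have a density with respect to the product measure. Written this way, real
integrals over a round reduce to iterated integrals over the context-action pair and the outcome. -/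
lemma playLaw_eq_map (L : ℝ) (m : ℕ) (w : ι → ℝ) : B.playLaw ν L m w =
    ((((B.ctxLaw.prod ν).withDensity fun p =>
        ENNReal.ofReal (B.actionDensity ν L m w p.1 p.2)) ⊗ₘ
      (B.lossLaw.comap Prod.fst measurable_fst : Kernel (X × A) Ω))).map
        fun z => (z.1.1, z.1.2, B.loss z.2 z.1.2) := by
  have hq : Measurable fun p : X × A => ENNReal.ofReal (B.actionDensity ν L m w p.1 p.2) :=
    (B.measurable_actionDensity L m w).ennreal_ofReal
  refine Measure.ext_of_lintegral _ fun F hF => ?_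
  have hF' : Measurable fun z : (X × A) × Ω => F (z.1.1, z.1.2, B.loss z.2 z.1.2) :=
    hF.comp B.measurable_outcome
  rw [B.lintegral_playLaw L m w hF, lintegral_map hF B.measurable_outcome,
    Measure.lintegral_compProd hF']
  simp only [Kernel.comap_apply]
  rw [lintegral_withDensity_eq_lintegral_mul _ hq (B.measurable_lintegral_outcome hF)]
  rfl

lemma integrable_rectKernel_mul (hd : IsDoublingSpace ν d) (hu : IsUniformSpace ν α) {h : ℝ}
    (hh : 0 < h) (i : ι) {f : X × A → ℝ} (hf : Measurable f) {c : ℝ} (hc : ∀ p, |f p| ≤ c) :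
    Integrable (fun p : X × A => rectKernel ν h (B.policy i p.1) p.2 * f p)
      (B.ctxLaw.prod ν) := by
  refine Integrable.of_bound ((B.measurable_rectKernel_policy h i).mul hf).aestronglyMeasurable
    (kernelSup ν h * c) (ae_of_all _ fun p => ?_)
  have hk := rectKernel_mem_Icc hd hu hh (B.policy i p.1) p.2
  rw [norm_mul, Real.norm_eq_abs, Real.norm_eq_abs, abs_of_nonneg hk.1]
  exact mul_le_mul hk.2 (hc p) (abs_nonneg _) (hk.1.trans hk.2)

lemma abs_condLoss_le_one (p : X × A) : |B.condLoss p.1 p.2| ≤ 1 := by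
  rw [abs_of_nonneg (B.condLoss_nonneg _ _)]; exact B.condLoss_le_one _ _

lemma integral_rectKernel_policy (hd : IsDoublingSpace ν d) (hu : IsUniformSpace ν α) {h : ℝ}
    (hh : 0 < h) (i : ι) :
    ∫ p : X × A, rectKernel ν h (B.policy i p.1) p.2 ∂(B.ctxLaw.prod ν) = 1 := by
  have := B.integrable_rectKernel_mul hd hu hh i (f := fun _ => 1) measurable_const
    (c := 1) (by simp)
  simp only [mul_one] at this
  rw [integral_prod _ this]
  simp [integral_rectKernel hd hh]

/-- Averages with respect to the density of the played action. -/
lemma integral_actionDensity_mul (hd : IsDoublingSpace ν d) (hu : IsUniformSpace ν α)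
    (L : ℝ) (m : ℕ) (w : ι → ℝ) {f : X × A → ℝ} (hf : Measurable f) {c : ℝ}
    (hc : ∀ p, |f p| ≤ c) :
    ∫ p : X × A, B.actionDensity ν L m w p.1 p.2 * f p ∂(B.ctxLaw.prod ν) =
      exploreProb L m * ∫ p, f p ∂(B.ctxLaw.prod ν) + (1 - exploreProb L m) *
        ∑ i, w i * ∫ p : X × A, rectKernel ν (bandwidth m) (B.policy i p.1) p.2 * f p
          ∂(B.ctxLaw.prod ν) := by
  have hi := fun i => B.integrable_rectKernel_mul hd hu (bandwidth_pos m) i hf hc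
  have hf' : Integrable f (B.ctxLaw.prod ν) :=
    Integrable.of_bound hf.aestronglyMeasurable c (ae_of_all _ hc)
  have : ∀ p : X × A, B.actionDensity ν L m w p.1 p.2 * f p = exploreProb L m * f p +
      (1 - exploreProb L m) *
        ∑ i, w i * (rectKernel ν (bandwidth m) (B.policy i p.1) p.2 * f p) := fun p => by
    unfold actionDensity
    rw [add_mul, mul_assoc (1 - exploreProb L m), Finset.sum_mul]
    simp_rw [mul_assoc]
  simp_rw [this]
  rw [integral_add (hf'.const_mul _)
    ((integrable_finsetSum _ fun i _ => (hi i).const_mul _).const_mul _), integral_const_mul,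
    integral_const_mul, integral_finsetSum _ fun i _ => (hi i).const_mul _]
  simp_rw [integral_const_mul]

variable {P : Finset ι} {w : ι → ℝ}

lemma isProbabilityMeasure_actionLaw (hd : IsDoublingSpace ν d) (hu : IsUniformSpace ν α)
    (hL : 1 ≤ L) (m : ℕ) (hw : w ∈ distributionsOn P) :
    IsProbabilityMeasure ((B.ctxLaw.prod ν).withDensity fun p =>
      ENNReal.ofReal (B.actionDensity ν L m w p.1 p.2)) := by
  constructor
  have h1 := B.integral_actionDensity_mul hd hu L m w (f := fun _ => (1 : ℝ)) measurable_const
    (c := 1) (by simp)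
  have h2 := fun p : X × A => B.actionDensity_mem_Icc hd hu hL m hw p.1 p.2
  simp only [mul_one, B.integral_rectKernel_policy hd hu (bandwidth_pos m), hw.2.2] at h1
  rw [withDensity_apply _ MeasurableSet.univ, Measure.restrict_univ,
    ← ofReal_integral_eq_lintegral_ofReal
      (integrable_of_measurable_of_mem_Icc (B.measurable_actionDensity L m w) h2)
      (ae_of_all _ fun p => (exploreProb_pos hL m).le.trans (h2 p).1), h1]
  simp

lemma isProbabilityMeasure_playLaw (hd : IsDoublingSpace ν d) (hu : IsUniformSpace ν α)
    (hL : 1 ≤ L) (m : ℕ) (hw : w ∈ distributionsOn P) :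
    IsProbabilityMeasure (B.playLaw ν L m w) := by
  have := B.isProbabilityMeasure_actionLaw hd hu hL m hw
  rw [playLaw_eq_map]
  exact Measure.isProbabilityMeasure_map B.measurable_outcome.aemeasurable

/-- The third coordinate of a round ranges over all of `ℝ`. Bounds such as a loss in `[0,1]` hold
only on genuine outcomes, hence almost surely. -/
lemma ae_playLaw (L : ℝ) (m : ℕ) (w : ι → ℝ) {p : X × A × ℝ → Prop}
    (hp : MeasurableSet {z | p z}) (h : ∀ x a ω, p (x, a, B.loss ω a)) :
    ∀ᵐ z ∂(B.playLaw ν L m w), p z := by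
  rw [playLaw_eq_map, ae_map_iff B.measurable_outcome.aemeasurable hp]
  exact ae_of_all _ fun z => h _ _ _

/-- The expectation over a round of a statistic that is bounded on the possible outcomes. -/
lemma integral_playLaw (hd : IsDoublingSpace ν d) (hu : IsUniformSpace ν α)
    (hL : 1 ≤ L) (m : ℕ) (hw : w ∈ distributionsOn P) {F : X × A × ℝ → ℝ} (hF : Measurable F)
    {c : ℝ} (hc : ∀ x a ω, |F (x, a, B.loss ω a)| ≤ c) :
    ∫ z, F z ∂(B.playLaw ν L m w) =
      ∫ p : X × A, B.actionDensity ν L m w p.1 p.2 *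
        ∫ ω, F (p.1, p.2, B.loss ω p.2) ∂(B.lossLaw p.1) ∂(B.ctxLaw.prod ν) := by
  have hq : Measurable fun p : X × A => ENNReal.ofReal (B.actionDensity ν L m w p.1 p.2) :=
    (B.measurable_actionDensity L m w).ennreal_ofReal
  have := B.isProbabilityMeasure_actionLaw hd hu hL m hw
  have hF' : Measurable fun z : (X × A) × Ω => F (z.1.1, z.1.2, B.loss z.2 z.1.2) :=
    hF.comp B.measurable_outcome
  rw [playLaw_eq_map, integral_map B.measurable_outcome.aemeasurable hF.aestronglyMeasurable,
    Measure.integral_compProd (Integrable.of_bound hF'.aestronglyMeasurable c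
      (ae_of_all _ fun z => hc _ _ _))]
  simp only [Kernel.comap_apply]
  rw [integral_withDensity_eq_integral_toReal_smul hq (ae_of_all _ fun _ => ENNReal.ofReal_lt_top)]
  refine integral_congr_ae (ae_of_all _ fun p => ?_)
  simp only [smul_eq_mul]
  rw [ENNReal.toReal_ofReal
    ((exploreProb_pos hL m).le.trans (B.actionDensity_mem_Icc hd hu hL m hw p.1 p.2).1)]

lemma measurable_ipsEstimate (L : ℝ) (m : ℕ) (w : ι → ℝ) (i : ι) :
    Measurable (B.ipsEstimate ν L m w i) := by
  have h : Measurable fun z : X × A × ℝ => (z.1, z.2.1) :=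
    measurable_fst.prodMk (measurable_fst.comp measurable_snd)
  have h1 : Measurable fun z : X × A × ℝ =>
      rectKernel ν (bandwidth m) (B.policy i z.1) z.2.1 :=
    (B.measurable_rectKernel_policy (bandwidth m) i).comp h
  have h2 : Measurable fun z : X × A × ℝ => B.actionDensity ν L m w z.1 z.2.1 := by
    have := (B.measurable_actionDensity (ν := ν) L m w).comp h
    simpa only [Function.comp_def] using this
  have h3 : Measurable fun z : X × A × ℝ => z.2.2 := measurable_snd.comp measurable_snd
  have h4 : Measurable fun z : X × A × ℝ =>
      rectKernel ν (bandwidth m) (B.policy i z.1) z.2.1 * z.2.2 := h1.mul h3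
  exact h4.div h2

lemma abs_ipsEstimate_le (hd : IsDoublingSpace ν d) (hu : IsUniformSpace ν α)
    (hL : 1 ≤ L) (m : ℕ) (hw : w ∈ distributionsOn P) (i : ι) (x : X) (a : A) (ω : Ω) :
    |B.ipsEstimate ν L m w i (x, a, B.loss ω a)| ≤
      kernelSup ν (bandwidth m) / exploreProb L m := by
  have hμ := exploreProb_pos hL m
  have hq := (B.actionDensity_mem_Icc hd hu hL m hw x a).1
  have hk := rectKernel_mem_Icc hd hu (bandwidth_pos m) (B.policy i x) a
  have hl := B.loss_mem ω a
  unfold ipsEstimate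
  rw [abs_div, abs_of_nonneg (mul_nonneg hk.1 hl.1), abs_of_pos (hμ.trans_le hq)]
  refine div_le_div₀ (hk.1.trans hk.2) ?_ hμ hq
  exact (mul_le_mul hk.2 hl.2 hl.1 (hk.1.trans hk.2)).trans (mul_one _).le

lemma memLp_ipsEstimate (hd : IsDoublingSpace ν d) (hu : IsUniformSpace ν α)
    (hL : 1 ≤ L) (m : ℕ) (hw : w ∈ distributionsOn P) (i : ι) :
    MemLp (B.ipsEstimate ν L m w i) 2 (B.playLaw ν L m w) := by
  have := B.isProbabilityMeasure_playLaw hd hu hL m hw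
  have hm := B.measurable_ipsEstimate (ν := ν) L m w i
  refine MemLp.of_bound hm.aestronglyMeasurable
    (kernelSup ν (bandwidth m) / exploreProb L m) (B.ae_playLaw L m w ?_ ?_)
  · exact measurableSet_le hm.norm measurable_const
  · exact B.abs_ipsEstimate_le hd hu hL m hw i

/-- The density of the played action, positive because of `μ_m`, cancels the denominator of the
estimate. -/
lemma integral_ipsEstimate (hd : IsDoublingSpace ν d) (hu : IsUniformSpace ν α)
    (hL : 1 ≤ L) (m : ℕ) (hw : w ∈ distributionsOn P) (i : ι) :
    ∫ z, B.ipsEstimate ν L m w i z ∂(B.playLaw ν L m w) = B.smoothLoss ν (bandwidth m) i := by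
  rw [B.integral_playLaw hd hu hL m hw (B.measurable_ipsEstimate L m w i)
    (B.abs_ipsEstimate_le hd hu hL m hw i)]
  refine integral_congr_ae (ae_of_all _ fun p => ?_)
  have hq := (exploreProb_pos hL m).trans_le (B.actionDensity_mem_Icc hd hu hL m hw p.1 p.2).1
  simp only [ipsEstimate]
  rw [integral_div, integral_const_mul, mul_div_cancel₀ _ hq.ne']
  rfl

/-- After one cancellation of `q` there remains at most `K² / q`. One factor `K` is bounded by `κ`,
and the integral of `K / q` is the objective, at most `2 V`. -/
lemma integral_ipsEstimate_sq_le (hd : IsDoublingSpace ν d) (hu : IsUniformSpace ν α)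
    (hL : 1 ≤ L) {Q : ℕ → Finset ι → ι → ℝ} (hQ : B.IsSolver ν L Q)
    {m : ℕ} (hm : 1 ≤ m) {P : Finset ι} {i : ι} (hi : i ∈ P) :
    ∫ z, B.ipsEstimate ν L m (Q m P) i z ^ 2 ∂(B.playLaw ν L m (Q m P)) ≤
      2 * (kernelSup ν (bandwidth m) * B.charVolume ν (bandwidth m) P) := by
  have hw := (hQ m P hm ⟨i, hi⟩).1
  have hμ := exploreProb_pos hL m
  have hκ := kernelSup_pos hd hu (bandwidth_pos m) (ν := ν)
  rw [B.integral_playLaw hd hu hL m hw ((B.measurable_ipsEstimate L m _ i).pow_const 2)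
    (c := (kernelSup ν (bandwidth m) / exploreProb L m) ^ 2) (fun x a ω => by
      rw [abs_pow]
      exact pow_le_pow_left₀ (abs_nonneg _) (B.abs_ipsEstimate_le hd hu hL m hw i x a ω) 2)]
  have hq := fun p : X × A =>
    hμ.trans_le (B.actionDensity_mem_Icc hd hu hL m hw p.1 p.2).1
  have hint := B.integrable_rectKernel_mul hd hu (bandwidth_pos m) i
    (f := fun p => 1 / B.actionDensity ν L m (Q m P) p.1 p.2)
    (measurable_const.div (B.measurable_actionDensity L m _)) (c := 1 / exploreProb L m)
    (fun p => by
      rw [abs_of_pos (one_div_pos.2 (hq p))]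
      exact one_div_le_one_div_of_le hμ (B.actionDensity_mem_Icc hd hu hL m hw p.1 p.2).1)
  have hV := B.integral_rectKernel_div_actionDensity_le hd hu hL hQ hm hi
  rw [← integral_prod _ hint] at hV
  calc _ ≤ ∫ p : X × A, kernelSup ν (bandwidth m) *
        (rectKernel ν (bandwidth m) (B.policy i p.1) p.2 *
          (1 / B.actionDensity ν L m (Q m P) p.1 p.2)) ∂(B.ctxLaw.prod ν) := by
        refine integral_mono_of_nonneg (ae_of_all _ fun p =>
          mul_nonneg (hq p).le (integral_nonneg fun ω => sq_nonneg _)) (hint.const_mul _)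
          (ae_of_all _ fun p => ?_)
        have hk := rectKernel_mem_Icc hd hu (bandwidth_pos m) (B.policy i p.1) p.2
        have h1 : ∫ ω, B.ipsEstimate ν L m (Q m P) i (p.1, p.2, B.loss ω p.2) ^ 2
            ∂(B.lossLaw p.1) ≤ ∫ _, (rectKernel ν (bandwidth m) (B.policy i p.1) p.2 /
              B.actionDensity ν L m (Q m P) p.1 p.2) ^ 2 ∂(B.lossLaw p.1) := by
          refine integral_mono_of_nonneg (ae_of_all _ fun ω => sq_nonneg _) (integrable_const _)
            (ae_of_all _ fun ω => ?_)
          have hl := B.loss_mem ω p.2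
          have h2 := hq p
          simp only [ipsEstimate]
          refine pow_le_pow_left₀ (div_nonneg (mul_nonneg hk.1 hl.1) h2.le) ?_ 2
          gcongr
          exact mul_le_of_le_one_right hk.1 hl.2
        rw [integral_const, probReal_univ, one_smul] at h1
        refine (mul_le_mul_of_nonneg_left h1 (hq p).le).trans ?_
        have h3 : B.actionDensity ν L m (Q m P) p.1 p.2 *
            (rectKernel ν (bandwidth m) (B.policy i p.1) p.2 /
              B.actionDensity ν L m (Q m P) p.1 p.2) ^ 2 =
            rectKernel ν (bandwidth m) (B.policy i p.1) p.2 *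
              (rectKernel ν (bandwidth m) (B.policy i p.1) p.2 *
                (1 / B.actionDensity ν L m (Q m P) p.1 p.2)) := by
          have := (hq p).ne'
          field_simp
        rw [h3]
        exact mul_le_mul_of_nonneg_right hk.2
          (mul_nonneg hk.1 (one_div_nonneg.2 (hq p).le))
    _ ≤ kernelSup ν (bandwidth m) * (2 * B.charVolume ν (bandwidth m) P) := by
        rw [integral_const_mul]
        exact mul_le_mul_of_nonneg_left hV hκ.le
    _ = _ := by ring

/-- The kernel is supported in the ball of radius `h` around the policy's action, where the
conditional loss varies by at most `L h`. -/
lemma abs_smoothLoss_sub_le (hd : IsDoublingSpace ν d) (hu : IsUniformSpace ν α)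
    (hlip : B.IsLipschitz L) (hL : 1 ≤ L) {h : ℝ} (hh : 0 < h) (i : ι) :
    |B.smoothLoss ν h i - B.expLoss i| ≤ L * h := by
  have hm : Measurable fun p : X × A => B.condLoss p.1 (B.policy i p.1) :=
    (B.measurable_condLoss_policy i).comp measurable_fst
  have hi1 := B.integrable_rectKernel_mul hd hu hh i B.measurable_condLoss
    (fun p => B.abs_condLoss_le_one p)
  have hi2 := B.integrable_rectKernel_mul hd hu hh i hm (c := 1)
    (fun p => B.abs_condLoss_le_one (p.1, B.policy i p.1))
  have h1 : B.expLoss i = ∫ p : X × A, rectKernel ν h (B.policy i p.1) p.2 *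
      B.condLoss p.1 (B.policy i p.1) ∂(B.ctxLaw.prod ν) := by
    rw [integral_prod _ hi2]
    simp only [integral_mul_const, integral_rectKernel hd hh, one_mul]
    rfl
  rw [h1, smoothLoss]
  rw [← integral_sub hi1 hi2]
  refine (abs_integral_le_integral_abs).trans ?_
  have hi3 := B.integrable_rectKernel_mul hd hu hh i (f := fun _ => L * h) measurable_const
    (c := |L * h|) (fun _ => le_rfl)
  calc _ ≤ ∫ p : X × A, rectKernel ν h (B.policy i p.1) p.2 * (L * h) ∂(B.ctxLaw.prod ν) := by
        refine integral_mono_of_nonneg (ae_of_all _ fun p => abs_nonneg _) hi3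
          (ae_of_all _ fun p => ?_)
        simp only [← mul_sub, abs_mul, abs_of_nonneg (rectKernel_nonneg (ν := ν) h (B.policy i p.1) p.2)]
        by_cases hp : p.2 ∈ Metric.closedBall (B.policy i p.1) h
        · refine mul_le_mul_of_nonneg_left ((hlip p.1 p.2 _).trans ?_) (rectKernel_nonneg _ _ _)
          exact mul_le_mul_of_nonneg_left hp (zero_le_one.trans hL)
        · rw [rectKernel, indicator_of_notMem hp, zero_mul, zero_mul]
    _ = L * h := by
        rw [integral_mul_const, B.integral_rectKernel_policy hd hu hh, one_mul]

/-- The expected loss of a round is at most the loss of the worst policy in use, up to the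
exploration probability and the bias of the smoothing. -/
lemma integral_loss_playLaw_le (hd : IsDoublingSpace ν d) (hu : IsUniformSpace ν α)
    (hlip : B.IsLipschitz L) (hL : 1 ≤ L) (m : ℕ) (hw : w ∈ distributionsOn P) {c : ℝ}
    (hc : ∀ i ∈ P, B.expLoss i ≤ c) :
    ∫ z, z.2.2 ∂(B.playLaw ν L m w) ≤ c + 2 * radius L m := by
  have hμ := exploreProb_pos hL m
  have hμ2 := exploreProb_le_half L m
  have hr := radius_pos hL m
  -- The nonnegativity allows the factor `1 - μ_m` to be dropped at the end. Uniform exploration has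
  -- mass `μ_m ≤ r_m` and costs at most one, and the smoothing bias adds another `r_m`.
  have hc0 : 0 ≤ c + radius L m := by
    obtain ⟨i, hi⟩ : P.Nonempty := by
      by_contra h
      rw [Finset.not_nonempty_iff_eq_empty] at h
      subst h
      have h3 := hw.2.2
      rw [Finset.sum_eq_zero fun i _ => hw.2.1 i (Finset.notMem_empty i)] at h3
      exact zero_ne_one h3
    linarith [hc i hi, B.expLoss_nonneg i]
  rw [B.integral_playLaw hd hu hL m hw (F := fun z => z.2.2)
    (measurable_snd.comp measurable_snd) (c := 1)
    (fun x a ω => by rw [abs_of_nonneg (B.loss_mem ω a).1]; exact (B.loss_mem ω a).2)]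
  change ∫ p : X × A, B.actionDensity ν L m w p.1 p.2 * B.condLoss p.1 p.2
    ∂(B.ctxLaw.prod ν) ≤ _
  rw [B.integral_actionDensity_mul hd hu L m w B.measurable_condLoss
    (fun p => B.abs_condLoss_le_one p)]
  have h1 : ∫ p : X × A, B.condLoss p.1 p.2 ∂(B.ctxLaw.prod ν) ≤ 1 := by
    calc _ ≤ ∫ _, (1 : ℝ) ∂(B.ctxLaw.prod ν) :=
          integral_mono_of_nonneg (ae_of_all _ fun p => B.condLoss_nonneg _ _)
            (integrable_const _) (ae_of_all _ fun p => B.condLoss_le_one _ _)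
      _ = 1 := by simp
  have h2 : ∑ i, w i * ∫ p : X × A, rectKernel ν (bandwidth m) (B.policy i p.1) p.2 *
      B.condLoss p.1 p.2 ∂(B.ctxLaw.prod ν) ≤ c + radius L m :=
    (weightedSum_mem_Icc hw (a := -(1 + radius L m)) fun i hi => by
      have h4 := abs_le.1 (B.abs_smoothLoss_sub_le hd hu hlip hL (bandwidth_pos m) i)
      rw [← radius_eq] at h4
      change B.smoothLoss ν (bandwidth m) i ∈ _
      exact ⟨by linarith [B.expLoss_nonneg i], by linarith [hc i hi]⟩).2
  have h3 := exploreProb_le_radius L m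
  have h5 := mul_le_mul_of_nonneg_left h1 hμ.le
  have h6 := mul_le_mul_of_nonneg_left h2 (by linarith : 0 ≤ 1 - exploreProb L m)
  nlinarith

lemma integral_loss_playLaw_le_one (hd : IsDoublingSpace ν d) (hu : IsUniformSpace ν α)
    (hL : 1 ≤ L) (m : ℕ) (hw : w ∈ distributionsOn P) :
    ∫ z, z.2.2 ∂(B.playLaw ν L m w) ≤ 1 := by
  have := B.isProbabilityMeasure_playLaw hd hu hL m hw
  have hm : Measurable fun z : X × A × ℝ => z.2.2 := measurable_snd.comp measurable_snd
  calc _ ≤ ∫ _, (1 : ℝ) ∂(B.playLaw ν L m w) :=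
        integral_mono_of_nonneg
          (B.ae_playLaw L m w (measurableSet_le measurable_const hm)
            fun x a ω => (B.loss_mem ω a).1) (integrable_const _)
          (B.ae_playLaw L m w (measurableSet_le hm measurable_const)
            fun x a ω => (B.loss_mem ω a).2)
    _ = 1 := by simp

end PlayLaw

end Problem

/-! ### Medians -/

section Median

variable {n : ℕ}

/-- A strict majority of the values lies in `[θ - e, θ + e]`, so the lower and the upper median both
do. -/
lemma abs_median_sub_le {f : Fin n → ℝ} {θ e : ℝ}
    (h : 2 * (Finset.univ.filter fun i => e < |f i - θ|).card < n) : |median f - θ| ≤ e := by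
  classical
  have hgood : n < 2 * (Finset.univ.filter fun i => |f i - θ| ≤ e).card := by
    have h1 := Finset.card_filter_add_card_filter_not (s := (Finset.univ : Finset (Fin n)))
      (fun i => e < |f i - θ|)
    simp only [not_lt, Finset.card_univ, Fintype.card_fin] at h1
    omega
  have key : ∀ p : Fin n → Prop, ∀ [DecidablePred p], (∀ i, p i → e < |f i - θ|) →
      ¬ n ≤ 2 * (Finset.univ.filter p).card := fun p _ hp hn => by
    have : (Finset.univ.filter p).card ≤ (Finset.univ.filter fun i => e < |f i - θ|).card :=
      Finset.card_le_card fun i hi => by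
        rw [Finset.mem_filter] at hi ⊢
        exact ⟨hi.1, hp i hi.2⟩
    omega
  have key2 : ∀ p : Fin n → Prop, ∀ [DecidablePred p], (∀ i, |f i - θ| ≤ e → p i) →
      n ≤ 2 * (Finset.univ.filter p).card := fun p _ hp => by
    have : (Finset.univ.filter fun i => |f i - θ| ≤ e).card ≤ (Finset.univ.filter p).card :=
      Finset.card_le_card fun i hi => by
        rw [Finset.mem_filter] at hi ⊢
        exact ⟨hi.1, hp i hi.2⟩
    omega
  have h1 : θ + e ∈ {c : ℝ | n ≤ 2 * (Finset.univ.filter fun i => f i ≤ c).card} :=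
    key2 _ fun i hi => by linarith [(abs_le.1 hi).2]
  have h2 : θ - e ∈ {c : ℝ | n ≤ 2 * (Finset.univ.filter fun i => c ≤ f i).card} :=
    key2 _ fun i hi => by linarith [(abs_le.1 hi).1]
  have h3 : ∀ c ∈ {c : ℝ | n ≤ 2 * (Finset.univ.filter fun i => f i ≤ c).card}, θ - e ≤ c :=
    fun c hc => by
      by_contra hcon
      exact key _ (fun i hi => by rw [lt_abs]; right; linarith) hc
  have h4 : ∀ c ∈ {c : ℝ | n ≤ 2 * (Finset.univ.filter fun i => c ≤ f i).card}, c ≤ θ + e :=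
    fun c hc => by
      by_contra hcon
      exact key _ (fun i hi => by rw [lt_abs]; left; linarith) hc
  have h5 := csInf_le ⟨_, h3⟩ h1
  have h6 := le_csInf ⟨_, h1⟩ h3
  have h7 := le_csSup ⟨_, h4⟩ h2
  have h8 := csSup_le ⟨_, h2⟩ h4
  unfold median
  rw [abs_le]
  constructor <;> linarith

/-- The count of values below `c` increases with `c`, so the infimum is below a level as soon as
some rational threshold below that level is admissible. -/
lemma measurable_sInf_card_le (n : ℕ) : Measurable fun f : Fin n → ℝ =>
    sInf {c : ℝ | n ≤ 2 * (Finset.univ.filter fun i => f i ≤ c).card} := by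
  rcases Nat.eq_zero_or_pos n with rfl | hn
  -- For `n = 0` the set is unbounded below, but there is only one function on `Fin 0`.
  · exact Subsingleton.measurable
  refine measurable_of_Iio fun c => ?_
  have hset : (fun f : Fin n → ℝ =>
      sInf {c : ℝ | n ≤ 2 * (Finset.univ.filter fun i => f i ≤ c).card}) ⁻¹' Iio c =
      ⋃ q : {q : ℚ // (q : ℝ) < c},
        {f : Fin n → ℝ | n ≤ 2 * (Finset.univ.filter fun i => f i ≤ (q : ℝ)).card} := by
    ext f
    have hle : ∀ i, |f i| ≤ ∑ j, |f j| := fun i =>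
      Finset.single_le_sum (f := fun j => |f j|) (fun j _ => abs_nonneg _) (Finset.mem_univ i)
    have hne : {c : ℝ | n ≤ 2 * (Finset.univ.filter fun i => f i ≤ c).card}.Nonempty := by
      refine ⟨∑ i, |f i|, ?_⟩
      have : (Finset.univ.filter fun i => f i ≤ ∑ j, |f j|) = Finset.univ :=
        Finset.filter_true_of_mem fun i _ => (le_abs_self _).trans (hle i)
      rw [mem_ofPred_eq, this, Finset.card_univ, Fintype.card_fin]
      omega
    have hbdd : BddBelow {c : ℝ | n ≤ 2 * (Finset.univ.filter fun i => f i ≤ c).card} := by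
      refine ⟨-∑ i, |f i|, fun c hc => ?_⟩
      by_contra hcon
      have : (Finset.univ.filter fun i => f i ≤ c) = ∅ :=
        Finset.filter_false_of_mem fun i _ => by
          have := hle i
          have := neg_abs_le (f i)
          linarith
      rw [mem_ofPred_eq, this, Finset.card_empty] at hc
      omega
    simp only [mem_preimage, mem_Iio, mem_iUnion, Subtype.exists, exists_prop]
    constructor
    · intro h
      obtain ⟨x, hx, hxc⟩ := exists_lt_of_csInf_lt hne h
      obtain ⟨q, hq1, hq2⟩ := exists_rat_btwn hxc
      refine ⟨q, hq2, ?_⟩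
      rw [mem_ofPred_eq] at hx ⊢
      have : (Finset.univ.filter fun i => f i ≤ x).card ≤
          (Finset.univ.filter fun i => f i ≤ (q : ℝ)).card :=
        Finset.card_le_card (Finset.monotone_filter_right _ fun i _ hi => hi.trans hq1.le)
      omega
    · rintro ⟨q, hq, h⟩
      exact (csInf_le hbdd h).trans_lt hq
  rw [hset]
  refine MeasurableSet.iUnion fun q => measurableSet_le measurable_const
    (Measurable.const_mul ?_ 2)
  simp_rw [Finset.card_filter]
  exact Finset.measurable_sum _ fun i _ =>
    Measurable.ite (measurableSet_le (measurable_pi_apply i) measurable_const)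
      measurable_const measurable_const

lemma measurable_median (n : ℕ) : Measurable (median : (Fin n → ℝ) → ℝ) := by
  have h1 := measurable_sInf_card_le n
  have h2 : (fun f : Fin n → ℝ =>
      sSup {c : ℝ | n ≤ 2 * (Finset.univ.filter fun i => c ≤ f i).card}) =
      fun f => - sInf {c : ℝ | n ≤ 2 * (Finset.univ.filter fun i => (-f) i ≤ c).card} := by
    ext f
    rw [Real.sInf_def, neg_neg]
    congr 1
    ext c
    simp
  have h3 : Measurable fun f : Fin n → ℝ =>
      sSup {c : ℝ | n ≤ 2 * (Finset.univ.filter fun i => c ≤ f i).card} := by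
    rw [h2]
    exact (h1.comp measurable_neg).neg
  exact (h1.add h3).div_const 2

end Median

/-! ### The median of means -/

section MedianOfMeans

variable {Z : Type*} [MeasurableSpace Z] (ρ : Measure Z) [IsProbabilityMeasure ρ]

lemma map_infinitePi_of_injective {κ : Type*} {g : κ → ℕ} (hg : g.Injective) :
    (Measure.infinitePi fun _ : ℕ => ρ).map (fun w k => w (g k)) =
      Measure.infinitePi fun _ : κ => ρ := by
  have h0 : iIndepFun (fun (k : ℕ) (w : ℕ → Z) => w k) (Measure.infinitePi fun _ : ℕ => ρ) :=
    iIndepFun_infinitePi (X := fun _ z => z) (fun _ => measurable_id)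
  have h1 := (h0.precomp hg).map_fun_eq_infinitePi_map fun k => measurable_pi_apply (g k)
  rw [h1]
  congr 1
  ext1 k
  exact Measure.infinitePi_map_eval (fun _ : ℕ => ρ) (g k)

/-- Distinct batches read disjoint sets of coordinates. The joint law of all of them is a product
over pairs (batch, position), and currying groups it by batch. -/
lemma iIndepFun_blocks (s N n : ℕ) :
    iIndepFun (fun (b : Fin N) (w : ℕ → Z) (j : Fin n) => w (s + b * n + j))
      (Measure.infinitePi fun _ : ℕ => ρ) := by
  have hinj : Function.Injective fun p : Fin N × Fin n => s + (p.1 : ℕ) * n + p.2 := by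
    rintro ⟨b, j⟩ ⟨b', j'⟩ h
    simp only at h
    have h0 : (b : ℕ) * n + j = b' * n + j' := by omega
    have h1 : (j : ℕ) = j' := by
      have := congrArg (· % n) h0
      simpa [Nat.mod_eq_of_lt j.2, Nat.mod_eq_of_lt j'.2] using this
    have hn : 0 < n := j.pos
    have h2 : (b : ℕ) = b' := Nat.eq_of_mul_eq_mul_right hn (by omega)
    exact Prod.ext (Fin.ext h2) (Fin.ext h1)
  rw [iIndepFun_iff_map_fun_eq_infinitePi_map fun b => by fun_prop]
  have h1 := map_infinitePi_of_injective ρ hinj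
  have h2 : ∀ b : Fin N, (Measure.infinitePi fun _ : ℕ => ρ).map
      (fun (w : ℕ → Z) (j : Fin n) => w (s + b * n + j)) = Measure.infinitePi fun _ : Fin n => ρ :=
    fun b => map_infinitePi_of_injective ρ (g := fun j : Fin n => s + b * n + j)
      fun j j' h => Fin.ext (by simp only at h; omega)
  simp_rw [h2]
  rw [← Measure.infinitePi_map_curry (fun (_ : Fin N) (_ : Fin n) => ρ), ← h1,
    Measure.map_map (MeasurableEquiv.measurable _) (by fun_prop)]
  rfl

variable {ρ}

/-- Chebyshev's inequality, with the variance bounded by the second moment. -/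
lemma measure_batch_le {f : Z → ℝ} (hf : Measurable f) (hf2 : MemLp f 2 ρ) {v e : ℝ}
    (hv : ∫ z, f z ^ 2 ∂ρ ≤ v) (he : 0 < e) {n : ℕ} (hn : 0 < n) (s : ℕ) :
    (Measure.infinitePi fun _ : ℕ => ρ)
      {w | e < |(∑ j ∈ Finset.range n, f (w (s + j))) / n - ∫ z, f z ∂ρ|} ≤
        ENNReal.ofReal (v / (n * e ^ 2)) := by
  set P := Measure.infinitePi fun _ : ℕ => ρ
  have hmp : ∀ k : ℕ, MeasurePreserving (fun w : ℕ → Z => w k) P ρ := fun k =>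
    measurePreserving_eval_infinitePi (fun _ : ℕ => ρ) k
  have hLp : ∀ k : ℕ, MemLp (fun w : ℕ → Z => f (w k)) 2 P := fun k =>
    hf2.comp_measurePreserving (hmp k)
  have hind : iIndepFun (fun (k : ℕ) (w : ℕ → Z) => f (w k)) P :=
    iIndepFun_infinitePi (X := fun _ => f) (fun _ => hf)
  set Y : (ℕ → Z) → ℝ := fun w => ∑ j ∈ Finset.range n, f (w (s + j)) with hY
  have hYeq : Y = ∑ j ∈ Finset.range n, fun w : ℕ → Z => f (w (s + j)) := by
    ext w; simp [hY]
  have hYLp : MemLp Y 2 P := memLp_finsetSum _ fun j _ => hLp (s + j)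
  have hmean : ∫ w, Y w ∂P = n * ∫ z, f z ∂ρ := by
    rw [hY, integral_finsetSum _ fun j _ => (hLp (s + j)).integrable one_le_two]
    have : ∀ k : ℕ, ∫ w, f (w k) ∂P = ∫ z, f z ∂ρ := fun k => by
      rw [← (hmp k).map_eq]
      exact (integral_map (hmp k).measurable.aemeasurable hf.aestronglyMeasurable).symm
    simp [this]
  have hvar : Var[Y; P] ≤ n * v := by
    rw [hYeq, IndepFun.variance_sum (fun j _ => hLp (s + j))
      (fun i _ j _ hij => hind.indepFun (by omega))]
    have : ∀ k : ℕ, Var[fun w : ℕ → Z => f (w k); P] ≤ v := fun k => by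
      rw [(hmp k).variance_fun_comp hf.aemeasurable]
      exact (variance_le_expectation_sq hf.aestronglyMeasurable).trans hv
    calc _ ≤ ∑ _j ∈ Finset.range n, v := Finset.sum_le_sum fun j _ => this (s + j)
      _ = n * v := by simp
  have hn' : (0 : ℝ) < n := Nat.cast_pos.2 hn
  have hc := meas_ge_le_variance_div_sq hYLp (c := n * e) (by positivity)
  rw [hmean] at hc
  refine (measure_mono fun w hw => ?_).trans (hc.trans (ENNReal.ofReal_le_ofReal ?_))
  · rw [mem_ofPred_eq] at hw ⊢
    have : Y w - n * ∫ z, f z ∂ρ = n * (Y w / n - ∫ z, f z ∂ρ) := by field_simp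
    rw [this, abs_mul, abs_of_pos hn']
    exact mul_le_mul_of_nonneg_left hw.le hn'.le
  · rw [div_le_div_iff₀ (by positivity) (by positivity)]
    calc Var[Y; P] * (n * e ^ 2) ≤ (n * v) * (n * e ^ 2) := by gcongr
      _ = v * (n * e) ^ 2 := by ring

/-- This combines a union over at most `2 ^ N` sets of batches with failure probability `1 / 20` for
each of `k ≥ N / 2` batches. The number `20` works because `y ^ 2 = 1 / (4 e)` and `e < 5`. -/
lemma two_pow_mul_pow_le {N k : ℕ} (hk : N ≤ 2 * k) :
    (2 : ℝ) ^ N * (1 / 20) ^ k ≤ Real.exp (-(N : ℝ) / 2) := by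
  set y : ℝ := Real.exp (-(1 / 2)) / 2 with hy
  have hy0 : 0 < y := by positivity
  have hy1 : y ≤ 1 := by
    have : Real.exp (-(1 / 2)) ≤ 1 := Real.exp_le_one_iff.2 (by norm_num)
    linarith
  have hy2 : 1 / 20 ≤ y ^ 2 := by
    have h1 : y ^ 2 = Real.exp (-1) / 4 := by
      rw [hy, div_pow, ← Real.exp_nat_mul]; norm_num
    rw [h1, Real.exp_neg, div_le_div_iff₀ (by norm_num) (by norm_num), one_mul,
      ← div_le_iff₀ (by norm_num), le_inv_comm₀ (by norm_num) (Real.exp_pos 1)]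
    linarith [Real.exp_one_lt_d9]
  calc (2 : ℝ) ^ N * (1 / 20) ^ k ≤ 2 ^ N * (y ^ 2) ^ k := by gcongr
    _ = 2 ^ N * y ^ (2 * k) := by rw [pow_mul]
    _ ≤ 2 ^ N * y ^ N := by gcongr 2 ^ N * ?_; exact pow_le_pow_of_le_one hy0.le hy1 hk
    _ = (Real.exp (-(1 / 2))) ^ N := by rw [← mul_pow, hy]; congr 1; ring
    _ = Real.exp (-(N : ℝ) / 2) := by rw [← Real.exp_nat_mul]; congr 1; ring

/-- Deviation of the median of `N` means of `n` i.i.d. variables. -/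
lemma measure_medianOfMeans_le {f : Z → ℝ} (hf : Measurable f) (hf2 : MemLp f 2 ρ) {v e : ℝ}
    (hv : ∫ z, f z ^ 2 ∂ρ ≤ v) (he : 0 < e) {n : ℕ} (hn : 0 < n) (hve : 20 * v ≤ n * e ^ 2)
    (s N : ℕ) :
    (Measure.infinitePi fun _ : ℕ => ρ)
      {w | e < |(median fun b : Fin N =>
        (∑ j ∈ Finset.range n, f (w (s + b * n + j))) / n) - ∫ z, f z ∂ρ|} ≤
        ENNReal.ofReal (Real.exp (-(N : ℝ) / 2)) := by
  classical
  set P := Measure.infinitePi fun _ : ℕ => ρ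
  set θ := ∫ z, f z ∂ρ
  set bad : Fin N → Set (ℕ → Z) := fun b =>
    {w | e < |(∑ j ∈ Finset.range n, f (w (s + b * n + j))) / n - θ|} with hbad
  have hn' : (0 : ℝ) < n := Nat.cast_pos.2 hn
  have hbad_le : ∀ b, P (bad b) ≤ ENNReal.ofReal (1 / 20) := fun b => by
    refine (measure_batch_le hf hf2 hv he hn (s + b * n)).trans (ENNReal.ofReal_le_ofReal ?_)
    rw [div_le_div_iff₀ (by positivity) (by norm_num)]
    linarith
  have hind := iIndepFun_blocks ρ s N n
  have hinter : ∀ J : Finset (Fin N), P (⋂ b ∈ J, bad b) ≤ ENNReal.ofReal ((1 / 20) ^ J.card) := by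
    intro J
    have hS : MeasurableSet {z : Fin n → Z | e < |(∑ j, f (z j)) / n - θ|} := by
      refine measurableSet_lt measurable_const (continuous_abs.measurable.comp ?_)
      exact ((Finset.measurable_sum _ fun j _ => hf.comp (measurable_pi_apply j)).div_const _).sub_const _
    have h1 := hind.measure_inter_preimage_eq_mul J (fun _ _ => hS)
    have h2 : ∀ b : Fin N, (fun (w : ℕ → Z) (j : Fin n) => w (s + b * n + j)) ⁻¹'
        {z : Fin n → Z | e < |(∑ j, f (z j)) / n - θ|} = bad b := fun b => by
      ext w
      simp only [hbad, mem_preimage, mem_ofPred_eq, Finset.sum_range]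
    simp only [h2] at h1
    rw [h1]
    calc ∏ b ∈ J, P (bad b) ≤ ∏ _b ∈ J, ENNReal.ofReal (1 / 20) :=
          Finset.prod_le_prod' fun b _ => hbad_le b
      _ = _ := by rw [Finset.prod_const, ENNReal.ofReal_pow (by norm_num)]
  have hsub : {w : ℕ → Z | e < |(median fun b : Fin N =>
        (∑ j ∈ Finset.range n, f (w (s + b * n + j))) / n) - θ|} ⊆
      ⋃ J ∈ (Finset.univ : Finset (Finset (Fin N))).filter (fun J => N ≤ 2 * J.card),
        ⋂ b ∈ J, bad b := by
    intro w hw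
    by_contra hcon
    rw [mem_ofPred_eq] at hw
    refine absurd (abs_median_sub_le ?_) (not_le.2 hw)
    by_contra h
    push Not at h
    refine hcon (mem_biUnion (x := Finset.univ.filter fun b : Fin N => w ∈ bad b) ?_ ?_)
    · simpa [hbad] using h
    · simp
  refine (measure_mono hsub).trans ((measure_biUnion_finset_le _ _).trans ?_)
  calc _ ≤ ∑ J ∈ (Finset.univ : Finset (Finset (Fin N))).filter (fun J => N ≤ 2 * J.card),
        ENNReal.ofReal (Real.exp (-(N : ℝ) / 2) / 2 ^ N) := by
        refine Finset.sum_le_sum fun J hJ => (hinter J).trans (ENNReal.ofReal_le_ofReal ?_)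
        rw [le_div_iff₀ (by positivity), mul_comm]
        exact two_pow_mul_pow_le (Finset.mem_filter.1 hJ).2
    _ ≤ ∑ _J : Finset (Fin N), ENNReal.ofReal (Real.exp (-(N : ℝ) / 2) / 2 ^ N) :=
        Finset.sum_le_sum_of_subset (Finset.filter_subset _ _)
    _ = ENNReal.ofReal (Real.exp (-(N : ℝ) / 2)) := by
        rw [Finset.sum_const, Finset.card_univ, Fintype.card_finset, Fintype.card_fin,
          nsmul_eq_mul, ← ENNReal.ofReal_natCast, ← ENNReal.ofReal_mul (by positivity)]
        congr 1
        push_cast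
        field_simp

end MedianOfMeans

/-! ### Processes that are built by drawing one coordinate at a time -/

section Resampling

variable {Z : Type*} [MeasurableSpace Z]

lemma measurable_update_prod (t : ℕ) :
    Measurable fun p : (ℕ → Z) × Z => Function.update p.1 t p.2 := by
  refine measurable_pi_iff.2 fun n => ?_
  by_cases h : n = t
  · subst h; simpa using measurable_snd
  · simp only [Function.update_of_ne h]
    exact (measurable_pi_apply n).comp measurable_fst

/-- Drawing one coordinate of an i.i.d. sequence again does not change its law. -/
lemma lintegral_infinitePi_update (ρ : Measure Z) [IsProbabilityMeasure ρ] (t : ℕ)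
    {F : (ℕ → Z) → ENNReal} (hF : Measurable F) :
    ∫⁻ w, ∫⁻ z, F (Function.update w t z) ∂ρ ∂(Measure.infinitePi fun _ : ℕ => ρ) =
      ∫⁻ w, F w ∂(Measure.infinitePi fun _ : ℕ => ρ) := by
  classical
  have hu := measurable_update_prod (Z := Z) t
  have key : ((Measure.infinitePi fun _ : ℕ => ρ).prod ρ).map
      (fun p => Function.update p.1 t p.2) = Measure.infinitePi fun _ : ℕ => ρ := by
    refine Measure.eq_infinitePi _ fun s B hB => ?_
    rw [Measure.map_apply hu (MeasurableSet.pi s.countable_toSet fun i _ => hB i)]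
    by_cases ht : t ∈ s
    · have : (fun p : (ℕ → Z) × Z => Function.update p.1 t p.2) ⁻¹' ((s : Set ℕ).pi B) =
          (((s.erase t : Finset ℕ) : Set ℕ).pi B) ×ˢ B t := by
        ext p
        simp only [mem_preimage, mem_pi, Finset.mem_coe, mem_prod, Finset.mem_erase]
        constructor
        · intro h
          refine ⟨fun i hi => ?_, ?_⟩
          · simpa [Function.update_of_ne hi.1] using h i hi.2
          · simpa using h t ht
        · rintro ⟨h1, h2⟩ i hi
          by_cases hit : i = t
          · subst hit; simpa using h2
          · simpa [Function.update_of_ne hit] using h1 i ⟨hit, hi⟩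
      rw [this, Measure.prod_prod, Measure.infinitePi_pi _ fun i _ => hB i,
        Finset.prod_erase_mul s (fun i => ρ (B i)) ht]
    · have : (fun p : (ℕ → Z) × Z => Function.update p.1 t p.2) ⁻¹' ((s : Set ℕ).pi B) =
          ((s : Set ℕ).pi B) ×ˢ univ := by
        ext p
        simp only [mem_preimage, mem_pi, Finset.mem_coe, mem_prod, mem_univ, and_true]
        refine forall₂_congr fun i hi => ?_
        have : i ≠ t := fun h => ht (h ▸ hi)
        rw [Function.update_of_ne this]
      rw [this, Measure.prod_prod, Measure.infinitePi_pi _ fun i _ => hB i, measure_univ, mul_one]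
  conv_rhs => rw [← key]
  rw [lintegral_map hF hu]
  exact (lintegral_prod _ (hF.comp hu).aemeasurable).symm

lemma dependsOn_lintegral_update {ρ : Measure Z} {F : (ℕ → Z) → ENNReal} {S : Set ℕ} {t : ℕ}
    (hF : DependsOn F (insert t S)) :
    DependsOn (fun w => ∫⁻ z, F (Function.update w t z) ∂ρ) S := by
  intro w w' h
  refine lintegral_congr fun z => hF fun i hi => ?_
  by_cases hit : i = t
  · subst hit; simp
  · rw [Function.update_of_ne hit, Function.update_of_ne hit]
    exact h i (hi.resolve_left hit)

variable {K : ℕ → (ℕ → Z) → Measure Z} {μ : ℕ → Measure (ℕ → Z)}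

/-- Statistics of the first `t` coordinates do not depend on the later draws. -/
lemma lintegral_process_of_dependsOn (hK : ∀ t w, IsProbabilityMeasure (K t w))
    (hμ : ∀ t (F : (ℕ → Z) → ENNReal), Measurable F →
      ∫⁻ w, F w ∂(μ (t + 1)) = ∫⁻ w, ∫⁻ z, F (Function.update w t z) ∂(K t w) ∂(μ t))
    {F : (ℕ → Z) → ENNReal} (hF : Measurable F) {t T : ℕ} (htT : t ≤ T)
    (hdep : DependsOn F (Iio t)) : ∫⁻ w, F w ∂(μ T) = ∫⁻ w, F w ∂(μ t) := by
  induction T, htT using Nat.le_induction with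
  | base => rfl
  | succ T hT ih =>
    rw [hμ T F hF, ← ih]
    refine lintegral_congr fun w => ?_
    have : ∀ z, F (Function.update w T z) = F w := fun z => hdep fun i hi => by
      rw [mem_Iio] at hi
      rw [Function.update_of_ne (by omega)]
    simp [this]

/-- If the draws are i.i.d. in a block of rounds that starts at time `s`, on an event `E` that is
determined by the first `s` coordinates, then the statistics of the block are independent of `E`
and distributed as for an i.i.d. sequence. -/
lemma setLIntegral_process_block (ρ : Measure Z) [IsProbabilityMeasure ρ]
    (hμ : ∀ t (F : (ℕ → Z) → ENNReal), Measurable F →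
      ∫⁻ w, F w ∂(μ (t + 1)) = ∫⁻ w, ∫⁻ z, F (Function.update w t z) ∂(K t w) ∂(μ t))
    {E : Set (ℕ → Z)} (hE : MeasurableSet E) {s : ℕ}
    (hdepE : ∀ w w' : ℕ → Z, (∀ i < s, w i = w' i) → w ∈ E → w' ∈ E) (u : ℕ)
    (hR : ∀ w ∈ E, ∀ t, s ≤ t → t < s + u → K t w = ρ) :
    ∀ {F : (ℕ → Z) → ENNReal}, Measurable F → DependsOn F (Ico s (s + u)) →
      ∫⁻ w in E, F w ∂(μ (s + u)) =
        μ s E * ∫⁻ w, F w ∂(Measure.infinitePi fun _ : ℕ => ρ) := by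
  induction u with
  | zero =>
    intro F hF hdep
    obtain ⟨z⟩ := nonempty_of_isProbabilityMeasure ρ
    have : ∀ w, F w = F fun _ => z := fun w => hdep fun i hi => by simp at hi
    simp_rw [this]
    simp [mul_comm]
  | succ u ih =>
    intro F hF hdep
    have hFu : Measurable fun p : (ℕ → Z) × Z => F (Function.update p.1 (s + u) p.2) :=
      hF.comp (measurable_update_prod (s + u))
    have hF' : Measurable fun w => ∫⁻ z, F (Function.update w (s + u) z) ∂ρ :=
      hFu.lintegral_prod_right'
    have hins : insert (s + u) (Ico s (s + u)) = Ico s (s + (u + 1)) := by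
      ext i; simp only [mem_insert_iff, mem_Ico]; omega
    have hdep' := dependsOn_lintegral_update (ρ := ρ) (t := s + u) (S := Ico s (s + u))
      (F := F) (by rwa [hins])
    -- The last coordinate of the block is integrated out under both laws. On `E` the process draws
    -- it from `ρ`, and the remaining function depends on a block shorter by one.
    rw [← lintegral_infinitePi_update ρ (s + u) hF,
      ← ih (fun w hw t h1 h2 => hR w hw t h1 (by omega)) hF' hdep',
      ← lintegral_indicator hE, ← lintegral_indicator hE, ← add_assoc,
      hμ (s + u) _ (hF.indicator hE)]
    refine lintegral_congr fun w => ?_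
    have hmem : ∀ z, Function.update w (s + u) z ∈ E ↔ w ∈ E := fun z =>
      ⟨hdepE _ _ fun i hi => by rw [Function.update_of_ne (by omega)],
        hdepE _ _ fun i hi => by rw [Function.update_of_ne (by omega)]⟩
    by_cases hw : w ∈ E
    · rw [indicator_of_mem hw, hR w hw (s + u) (by omega) (by omega)]
      exact lintegral_congr fun z => indicator_of_mem ((hmem z).2 hw) _
    · rw [indicator_of_notMem hw]
      have : ∀ z, E.indicator F (Function.update w (s + u) z) = 0 := fun z =>
        indicator_of_notMem (fun h => hw ((hmem z).1 h)) _
      simp [this]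

/-- The algorithm's decisions take countably many values, so measurability of anything built from
them reduces to measurability of level sets. -/
lemma measurable_comp_of_countable {Y β γ : Type*} [MeasurableSpace Y] [MeasurableSpace β]
    [Countable γ] {c : Y → γ} (hc : ∀ x, MeasurableSet {y | c y = x}) (g : γ → β) :
    Measurable fun y => g (c y) := by
  let _ : MeasurableSpace γ := ⊤
  exact (measurable_from_top (f := g)).comp (measurable_to_countable' hc)

end Resampling

namespace Problem

/-! ### Epochs as functions of an infinite history. -/

section Sequence

variable {X A Ω ι : Type*} [MeasurableSpace X] [MetricSpace A] [MeasurableSpace A]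
  [MeasurableSpace Ω] [Fintype ι] (B : Problem X A Ω ι) (ν : Measure A) (L : ℝ) (T : ℕ)
  (Q : ℕ → Finset ι → ι → ℝ)

/-- The median-of-means estimate of the algorithm, as a function of an infinite history. -/
def seqEstimate (w : ℕ → X × A × ℝ) (m s : ℕ) (P : Finset ι) (i : ι) : ℝ :=
  median fun b : Fin (numBatches ι T) =>
    (∑ j ∈ Finset.range (B.batchSize ν L m P),
      B.ipsEstimate ν L m (Q m P) i (w (s + (b : ℕ) * B.batchSize ν L m P + j))) /
        (B.batchSize ν L m P : ℝ)

open Classical in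
/-- The starting time and the version space of the epochs, as functions of an infinite history. -/
def seqState (w : ℕ → X × A × ℝ) : ℕ → ℕ × Finset ι
  | 0 => (0, Finset.univ)
  | k + 1 =>
    ((seqState w k).1 + B.epochLength ν L T (k + 1) (seqState w k).2,
      (seqState w k).2.filter fun i => ∀ j ∈ (seqState w k).2,
        B.seqEstimate ν L T Q w (k + 1) (seqState w k).1 (seqState w k).2 i ≤
          B.seqEstimate ν L T Q w (k + 1) (seqState w k).1 (seqState w k).2 j +
            3 * radius L (k + 1))

/-- The number `k` such that the round at time `t` lies in epoch `k + 1`. -/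
def seqEpoch (w : ℕ → X × A × ℝ) (t : ℕ) : ℕ :=
  sInf {k | t < (B.seqState ν L T Q w (k + 1)).1}

lemma batch_index_lt {s n N b j : ℕ} (hb : b < N) (hj : j < n) : s + b * n + j < s + n * N := by
  have : (b + 1) * n ≤ N * n := Nat.mul_le_mul_right n hb
  rw [add_mul, one_mul, mul_comm N n] at this
  omega

variable {B ν L T Q}

lemma lossEstimate_eq_seqEstimate (w : ℕ → X × A × ℝ) {t m s : ℕ} {P : Finset ι}
    (h : s + B.epochLength ν L T m P ≤ t) (i : ι) :
    B.lossEstimate ν L T Q (fun n : Fin t => w n) m s P i = B.seqEstimate ν L T Q w m s P i := by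
  unfold lossEstimate seqEstimate
  congr 1
  ext b
  congr 1
  refine Finset.sum_congr rfl fun j hj => ?_
  have := batch_index_lt (s := s) b.2 (Finset.mem_range.1 hj)
  rw [dif_pos (lt_of_lt_of_le this h)]

lemma seqEstimate_congr {w w' : ℕ → X × A × ℝ} {m s : ℕ} {P : Finset ι}
    (h : ∀ n, s ≤ n → n < s + B.epochLength ν L T m P → w n = w' n) (i : ι) :
    B.seqEstimate ν L T Q w m s P i = B.seqEstimate ν L T Q w' m s P i := by
  unfold seqEstimate
  congr 1
  ext b
  congr 1
  refine Finset.sum_congr rfl fun j hj => ?_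
  rw [h _ (by omega) (batch_index_lt b.2 (Finset.mem_range.1 hj))]

lemma seqState_fst_le_succ (w : ℕ → X × A × ℝ) (k : ℕ) :
    (B.seqState ν L T Q w k).1 ≤ (B.seqState ν L T Q w (k + 1)).1 := Nat.le_add_right _ _

lemma monotone_seqState_fst (w : ℕ → X × A × ℝ) :
    Monotone fun k => (B.seqState ν L T Q w k).1 :=
  monotone_nat_of_le_succ (seqState_fst_le_succ w)

lemma mem_seqState_snd_succ {w : ℕ → X × A × ℝ} {k : ℕ} {i : ι} :
    i ∈ (B.seqState ν L T Q w (k + 1)).2 ↔ i ∈ (B.seqState ν L T Q w k).2 ∧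
      ∀ j ∈ (B.seqState ν L T Q w k).2,
        B.seqEstimate ν L T Q w (k + 1) (B.seqState ν L T Q w k).1 (B.seqState ν L T Q w k).2 i ≤
          B.seqEstimate ν L T Q w (k + 1) (B.seqState ν L T Q w k).1 (B.seqState ν L T Q w k).2 j +
            3 * radius L (k + 1) := by
  simp [seqState]

lemma seqState_snd_succ_subset (w : ℕ → X × A × ℝ) (k : ℕ) :
    (B.seqState ν L T Q w (k + 1)).2 ⊆ (B.seqState ν L T Q w k).2 :=
  fun _ hi => (mem_seqState_snd_succ.1 hi).1

lemma antitone_seqState_snd (w : ℕ → X × A × ℝ) :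
    Antitone fun k => (B.seqState ν L T Q w k).2 :=
  antitone_nat_of_succ_le (seqState_snd_succ_subset w)

lemma seqState_snd_nonempty [Nonempty ι] (hL : 1 ≤ L) (w : ℕ → X × A × ℝ) (k : ℕ) :
    (B.seqState ν L T Q w k).2.Nonempty := by
  induction k with
  | zero => exact Finset.univ_nonempty
  | succ k ih =>
    obtain ⟨i, hi, hmin⟩ := Finset.exists_min_image _ (fun i =>
      B.seqEstimate ν L T Q w (k + 1) (B.seqState ν L T Q w k).1 (B.seqState ν L T Q w k).2 i) ih
    refine ⟨i, mem_seqState_snd_succ.2 ⟨hi, fun j hj => ?_⟩⟩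
    have := radius_pos hL (k + 1)
    linarith [hmin j hj]

lemma epochState_eq_seqState (w : ℕ → X × A × ℝ) {t : ℕ} : ∀ {k : ℕ},
    (B.seqState ν L T Q w k).1 ≤ t →
      B.epochState ν L T Q (fun n : Fin t => w n) k = B.seqState ν L T Q w k := by
  intro k
  induction k with
  | zero => intro _; rfl
  | succ k ih =>
    intro h
    have h1 := ih ((seqState_fst_le_succ w k).trans h)
    have h2 := fun i => lossEstimate_eq_seqEstimate (Q := Q) w (m := k + 1)
      (s := (B.seqState ν L T Q w k).1) (P := (B.seqState ν L T Q w k).2) h i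
    simp only [epochState, seqState, h1, h2]
    congr

/-- The length of an epoch is fixed by its initial version space, so its end is already known while
the epoch is running. -/
lemma epochState_succ_fst_eq (w : ℕ → X × A × ℝ) {t k : ℕ}
    (h : (B.seqState ν L T Q w k).1 ≤ t) :
    (B.epochState ν L T Q (fun n : Fin t => w n) (k + 1)).1 =
      (B.seqState ν L T Q w (k + 1)).1 := by
  simp only [epochState, seqState, epochState_eq_seqState w h]

/-- The stopping time property: the state at the start of an epoch is determined by the rounds
before that start. -/
lemma seqState_congr {w w' : ℕ → X × A × ℝ} : ∀ {k : ℕ},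
    (∀ n < (B.seqState ν L T Q w k).1, w n = w' n) →
      B.seqState ν L T Q w k = B.seqState ν L T Q w' k := by
  intro k
  induction k with
  | zero => intro _; rfl
  | succ k ih =>
    intro h
    have h1 := ih fun n hn => h n (hn.trans_le (seqState_fst_le_succ w k))
    have h2 := fun i => seqEstimate_congr (B := B) (ν := ν) (L := L) (T := T) (Q := Q)
      (m := k + 1) (s := (B.seqState ν L T Q w k).1) (P := (B.seqState ν L T Q w k).2)
      (fun n _ hn => h n hn) i
    simp only [seqState, ← h1, h2]

end Sequence

/-! ### The current epoch and the measurability of the epoch states. -/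

section Epoch

variable {X A Ω ι : Type*} [MeasurableSpace X] [MetricSpace A] [MeasurableSpace A] [BorelSpace A]
  [SecondCountableTopology A] [MeasurableSpace Ω] [Fintype ι] [Nonempty ι] {B : Problem X A Ω ι}
  {ν : Measure A} [IsProbabilityMeasure ν] {d α L : ℝ} {T : ℕ} {Q : ℕ → Finset ι → ι → ℝ}

/-- Once `r_m ≤ 1`, each epoch has at least one round. So the infimum in `seqEpoch` is over a
nonempty set and is not a default value. -/
lemma exists_lt_seqState_fst (hd : IsDoublingSpace ν d) (hu : IsUniformSpace ν α) (hL : 1 ≤ L)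
    (hN : 0 < numBatches ι T) (w : ℕ → X × A × ℝ) (t : ℕ) :
    ∃ k, t < (B.seqState ν L T Q w (k + 1)).1 := by
  obtain ⟨K, hK⟩ := exists_pow_lt_of_lt_one (show 0 < 1 / L by positivity)
    (show (1 / 2 : ℝ) < 1 by norm_num)
  have hlen : ∀ k, K ≤ k → (B.seqState ν L T Q w k).1 + 1 ≤ (B.seqState ν L T Q w (k + 1)).1 := by
    intro k hk
    have hr := radius_pos hL (k + 1)
    have hr1 : radius L (k + 1) ≤ 1 := by
      have h1 : (1 / 2 : ℝ) ^ (k + 1) ≤ (1 / 2) ^ K :=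
        pow_le_pow_of_le_one (by norm_num) (by norm_num) (by omega)
      have h2 : L * (1 / 2 : ℝ) ^ (k + 1) ≤ L * (1 / L) := by gcongr; linarith
      rw [mul_one_div_cancel (by positivity)] at h2
      exact h2
    have hκV := B.one_le_kernelSup_mul_charVolume hd hu (bandwidth_pos (k + 1))
      (seqState_snd_nonempty (B := B) (ν := ν) (T := T) (Q := Q) hL w k)
    have hb : 1 ≤ B.batchSize ν L (k + 1) (B.seqState ν L T Q w k).2 := by
      refine Nat.le_floor ?_
      rw [Nat.cast_one, le_div_iff₀ (by positivity)]
      nlinarith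
    have : 1 ≤ B.epochLength ν L T (k + 1) (B.seqState ν L T Q w k).2 := Nat.mul_pos hb hN
    exact Nat.add_le_add_left this _
  have hgrow : ∀ j, j ≤ (B.seqState ν L T Q w (K + j)).1 := by
    intro j
    induction j with
    | zero => exact Nat.zero_le _
    | succ j ih =>
      have := hlen (K + j) (by omega)
      rw [← add_assoc]
      omega
  refine ⟨K + t, lt_of_lt_of_le (Nat.lt_succ_self t) ?_⟩
  have := hgrow (t + 1)
  rwa [← add_assoc] at this

lemma lt_seqState_succ_seqEpoch (hd : IsDoublingSpace ν d) (hu : IsUniformSpace ν α) (hL : 1 ≤ L)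
    (hN : 0 < numBatches ι T) (w : ℕ → X × A × ℝ) (t : ℕ) :
    t < (B.seqState ν L T Q w (B.seqEpoch ν L T Q w t + 1)).1 :=
  Nat.sInf_mem (exists_lt_seqState_fst (B := B) (Q := Q) hd hu hL hN w t)

lemma seqState_seqEpoch_le (w : ℕ → X × A × ℝ) (t : ℕ) :
    (B.seqState ν L T Q w (B.seqEpoch ν L T Q w t)).1 ≤ t := by
  rcases h : B.seqEpoch ν L T Q w t with _ | k
  · exact Nat.zero_le _
  · by_contra hcon
    push Not at hcon
    have : B.seqEpoch ν L T Q w t ≤ k := Nat.sInf_le hcon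
    omega

lemma seqEpoch_eq_iff (hd : IsDoublingSpace ν d) (hu : IsUniformSpace ν α) (hL : 1 ≤ L)
    (hN : 0 < numBatches ι T) (w : ℕ → X × A × ℝ) (t k : ℕ) :
    B.seqEpoch ν L T Q w t = k ↔
      (B.seqState ν L T Q w k).1 ≤ t ∧ t < (B.seqState ν L T Q w (k + 1)).1 := by
  constructor
  · rintro rfl
    exact ⟨seqState_seqEpoch_le w t, lt_seqState_succ_seqEpoch hd hu hL hN w t⟩
  · rintro ⟨h1, h2⟩
    have h3 : B.seqEpoch ν L T Q w t ≤ k := Nat.sInf_le h2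
    refine le_antisymm h3 ?_
    by_contra hcon
    push Not at hcon
    have h4 := lt_seqState_succ_seqEpoch (B := B) (Q := Q) hd hu hL hN w t
    have h5 := monotone_seqState_fst (B := B) (ν := ν) (L := L) (T := T) (Q := Q) w
      (show B.seqEpoch ν L T Q w t + 1 ≤ k by omega)
    simp only at h5
    omega

/-- Beyond the running epoch, `epochState` uses default values for missing rounds and need not agree
with `seqState`. The infimum only involves epochs up to the running one, where the end times agree.
-/
lemma currentEpoch_eq_seqEpoch (hd : IsDoublingSpace ν d) (hu : IsUniformSpace ν α) (hL : 1 ≤ L)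
    (hN : 0 < numBatches ι T) (w : ℕ → X × A × ℝ) (t : ℕ) :
    B.currentEpoch ν L T Q (fun n : Fin t => w n) = B.seqEpoch ν L T Q w t := by
  have h1 := seqState_seqEpoch_le (B := B) (ν := ν) (L := L) (T := T) (Q := Q) w t
  have h2 := lt_seqState_succ_seqEpoch (B := B) (Q := Q) hd hu hL hN w t
  have hmem : B.seqEpoch ν L T Q w t ∈
      {k | t < (B.epochState ν L T Q (fun n : Fin t => w n) (k + 1)).1} := by
    rw [mem_ofPred_eq, epochState_succ_fst_eq w h1]
    exact h2
  refine le_antisymm (Nat.sInf_le hmem) (le_csInf ⟨_, hmem⟩ fun k hk => ?_)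
  by_contra hcon
  push Not at hcon
  have h3 : (B.seqState ν L T Q w (k + 1)).1 ≤ t :=
    (monotone_seqState_fst w hcon).trans h1
  rw [mem_ofPred_eq, epochState_eq_seqState w h3] at hk
  omega

/-- The history enters the law of the next round only through the epoch and its version space. Both
are constant during an epoch, which is why the rounds of an epoch are conditionally i.i.d. -/
lemma roundLaw_eq_playLaw (hd : IsDoublingSpace ν d) (hu : IsUniformSpace ν α) (hL : 1 ≤ L)
    (hN : 0 < numBatches ι T) (w : ℕ → X × A × ℝ) (t : ℕ) :
    B.roundLaw ν L T Q (fun n : Fin t => w n) =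
      B.playLaw ν L (B.seqEpoch ν L T Q w t + 1) (Q (B.seqEpoch ν L T Q w t + 1)
        (B.seqState ν L T Q w (B.seqEpoch ν L T Q w t)).2) := by
  have h1 := seqState_seqEpoch_le (B := B) (ν := ν) (L := L) (T := T) (Q := Q) w t
  rw [← epochState_eq_seqState w h1, ← currentEpoch_eq_seqEpoch hd hu hL hN w t]
  rfl

lemma measurable_seqEstimate (m s : ℕ) (P : Finset ι) (i : ι) :
    Measurable fun w : ℕ → X × A × ℝ => B.seqEstimate ν L T Q w m s P i := by
  refine (measurable_median _).comp (measurable_pi_iff.2 fun b => ?_)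
  exact (Finset.measurable_sum _ fun j _ =>
    (B.measurable_ipsEstimate L m (Q m P) i).comp (measurable_pi_apply _)).div_const _

lemma measurableSet_seqState_eq (k : ℕ) : ∀ c : ℕ × Finset ι,
    MeasurableSet {w : ℕ → X × A × ℝ | B.seqState ν L T Q w k = c} := by
  classical
  induction k with
  | zero =>
    intro c
    simp only [seqState]
    exact MeasurableSet.const _
  | succ k ih =>
    intro c
    have hsplit : {w : ℕ → X × A × ℝ | B.seqState ν L T Q w (k + 1) = c} =
        ⋃ c' : ℕ × Finset ι, {w | B.seqState ν L T Q w k = c'} ∩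
          {w | (c'.1 + B.epochLength ν L T (k + 1) c'.2, c'.2.filter fun i => ∀ j ∈ c'.2,
            B.seqEstimate ν L T Q w (k + 1) c'.1 c'.2 i ≤
              B.seqEstimate ν L T Q w (k + 1) c'.1 c'.2 j + 3 * radius L (k + 1)) = c} := by
      ext w
      simp only [mem_iUnion, mem_inter_iff, mem_ofPred_eq, exists_eq_left']
      simp only [seqState]
    rw [hsplit]
    refine MeasurableSet.iUnion fun c' => (ih c').inter ?_
    have hset : ∀ i, MeasurableSet {w : ℕ → X × A × ℝ | ∀ j ∈ c'.2,
        B.seqEstimate ν L T Q w (k + 1) c'.1 c'.2 i ≤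
          B.seqEstimate ν L T Q w (k + 1) c'.1 c'.2 j + 3 * radius L (k + 1)} := fun i => by
      have : {w : ℕ → X × A × ℝ | ∀ j ∈ c'.2,
        B.seqEstimate ν L T Q w (k + 1) c'.1 c'.2 i ≤
          B.seqEstimate ν L T Q w (k + 1) c'.1 c'.2 j + 3 * radius L (k + 1)} =
          ⋂ j ∈ c'.2, {w | B.seqEstimate ν L T Q w (k + 1) c'.1 c'.2 i ≤
          B.seqEstimate ν L T Q w (k + 1) c'.1 c'.2 j + 3 * radius L (k + 1)} := by
        ext w; simp
      rw [this]
      exact c'.2.measurableSet_biInter fun j _ => measurableSet_le (measurable_seqEstimate _ _ _ i)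
        ((measurable_seqEstimate _ _ _ j).add_const _)
    have heq : {w : ℕ → X × A × ℝ | (c'.1 + B.epochLength ν L T (k + 1) c'.2,
          c'.2.filter fun i => ∀ j ∈ c'.2,
            B.seqEstimate ν L T Q w (k + 1) c'.1 c'.2 i ≤
              B.seqEstimate ν L T Q w (k + 1) c'.1 c'.2 j + 3 * radius L (k + 1)) = c} =
        {_w | c'.1 + B.epochLength ν L T (k + 1) c'.2 = c.1} ∩
          ⋂ i, {w | (i ∈ c'.2 ∧ ∀ j ∈ c'.2, B.seqEstimate ν L T Q w (k + 1) c'.1 c'.2 i ≤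
              B.seqEstimate ν L T Q w (k + 1) c'.1 c'.2 j + 3 * radius L (k + 1)) ↔ i ∈ c.2} := by
      ext w
      simp only [mem_ofPred_eq, mem_inter_iff, mem_iInter, Prod.ext_iff, Finset.ext_iff,
        Finset.mem_filter]
    rw [heq]
    refine (MeasurableSet.const _).inter (MeasurableSet.iInter fun i => ?_)
    exact ((MeasurableSet.const _).inter (hset i)).iff (MeasurableSet.const _)

lemma measurableSet_seqState_mem (k : ℕ) (S : Set (ℕ × Finset ι)) :
    MeasurableSet {w : ℕ → X × A × ℝ | B.seqState ν L T Q w k ∈ S} := by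
  have : {w : ℕ → X × A × ℝ | B.seqState ν L T Q w k ∈ S} =
      ⋃ c ∈ S, {w | B.seqState ν L T Q w k = c} := by
    ext w; simp
  rw [this]
  exact MeasurableSet.biUnion (to_countable S) fun c _ => measurableSet_seqState_eq k c

lemma measurable_comp_seqEpoch (hd : IsDoublingSpace ν d) (hu : IsUniformSpace ν α) (hL : 1 ≤ L)
    (hN : 0 < numBatches ι T) (t : ℕ) {β : Type*} [MeasurableSpace β] (g : ℕ → Finset ι → β) :
    Measurable fun w : ℕ → X × A × ℝ => g (B.seqEpoch ν L T Q w t)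
      (B.seqState ν L T Q w (B.seqEpoch ν L T Q w t)).2 := by
  refine measurable_comp_of_countable (γ := ℕ × Finset ι)
    (c := fun w => (B.seqEpoch ν L T Q w t,
      (B.seqState ν L T Q w (B.seqEpoch ν L T Q w t)).2)) (fun x => ?_) (fun x => g x.1 x.2)
  have : {w : ℕ → X × A × ℝ | (B.seqEpoch ν L T Q w t,
      (B.seqState ν L T Q w (B.seqEpoch ν L T Q w t)).2) = x} =
      {w | B.seqState ν L T Q w x.1 ∈ {c : ℕ × Finset ι | c.1 ≤ t ∧ c.2 = x.2}} ∩
      {w | B.seqState ν L T Q w (x.1 + 1) ∈ {c : ℕ × Finset ι | t < c.1}} := by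
    ext w
    simp only [mem_ofPred_eq, mem_inter_iff, Prod.ext_iff]
    constructor
    · rintro ⟨h1, h2⟩
      have := (seqEpoch_eq_iff hd hu hL hN w t x.1).1 h1
      rw [h1] at h2
      exact ⟨⟨this.1, h2⟩, this.2⟩
    · rintro ⟨⟨h1, h2⟩, h3⟩
      have := (seqEpoch_eq_iff hd hu hL hN w t x.1).2 ⟨h1, h3⟩
      rw [this]
      exact ⟨rfl, h2⟩
  rw [this]
  exact (measurableSet_seqState_mem _ _).inter (measurableSet_seqState_mem _ _)

end Epoch

end Problem

/-! ### Finite histories embedded into infinite sequences. -/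

section Padding

variable {Z : Type*}

/-- The infinite sequence that starts with `H` and continues with the constant `z₀`. -/
def padSeq (z₀ : Z) {t : ℕ} (H : Fin t → Z) (n : ℕ) : Z :=
  if h : n < t then H ⟨n, h⟩ else z₀

lemma padSeq_restrict (z₀ : Z) {t : ℕ} (H : Fin t → Z) :
    (fun n : Fin t => padSeq z₀ H n) = H := by
  ext n
  simp [padSeq]

/-- Appending a round becomes the update of one coordinate, the form in which the lemmas on
resampling apply. -/
lemma padSeq_snoc (z₀ : Z) {t : ℕ} (H : Fin t → Z) (z : Z) :
    padSeq z₀ (Fin.snoc H z : Fin (t + 1) → Z) = Function.update (padSeq z₀ H) t z := by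
  ext n
  rcases lt_trichotomy n t with h | h | h
  · rw [Function.update_of_ne h.ne]
    simp [padSeq, Fin.snoc, h, Nat.lt_succ_of_lt h]
  · subst h
    simp [padSeq, Fin.snoc]
  · rw [Function.update_of_ne h.ne']
    simp [padSeq, not_lt.2 h.le, show ¬ n < t + 1 by omega]

variable [MeasurableSpace Z]

lemma measurable_padSeq (z₀ : Z) (t : ℕ) :
    Measurable (padSeq z₀ : (Fin t → Z) → ℕ → Z) := by
  refine measurable_pi_iff.2 fun n => ?_
  by_cases h : n < t
  · simp only [padSeq, h, dif_pos]
    exact measurable_pi_apply _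
  · simp only [padSeq, h, dif_neg, not_false_eq_true]
    exact measurable_const

lemma measurable_snoc (t : ℕ) :
    Measurable fun p : (Fin t → Z) × Z => (Fin.snoc p.1 p.2 : Fin (t + 1) → Z) := by
  refine measurable_pi_iff.2 fun n => ?_
  refine Fin.lastCases ?_ (fun i => ?_) n
  · simp only [Fin.snoc_last]; exact measurable_snd
  · simp only [Fin.snoc_castSucc]; exact (measurable_pi_apply i).comp measurable_fst

end Padding

namespace Problem

/-- The law of the first `t` rounds, as a law of infinite sequences. -/
def seqLaw {X A Ω ι : Type*} [MeasurableSpace X] [MetricSpace A] [MeasurableSpace A]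
    [MeasurableSpace Ω] [Fintype ι] (B : Problem X A Ω ι) (ν : Measure A) (L : ℝ) (T : ℕ)
    (Q : ℕ → Finset ι → ι → ℝ) (z₀ : X × A × ℝ) (t : ℕ) : Measure (ℕ → X × A × ℝ) :=
  (B.historyLaw ν L T Q t).map (padSeq z₀)

/-! ### The law of the algorithm and the accuracy of its estimates. -/

section SeqLaw

variable {X A Ω ι : Type*} [MeasurableSpace X] [MetricSpace A] [MeasurableSpace A] [BorelSpace A]
  [SecondCountableTopology A] [MeasurableSpace Ω] [Fintype ι] [Nonempty ι] {B : Problem X A Ω ι}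
  {ν : Measure A} [IsProbabilityMeasure ν] {d α L : ℝ} {T : ℕ} {Q : ℕ → Finset ι → ι → ℝ}

lemma measurable_roundLaw_seq (hd : IsDoublingSpace ν d) (hu : IsUniformSpace ν α) (hL : 1 ≤ L)
    (hN : 0 < numBatches ι T) (t : ℕ) :
    Measurable fun w : ℕ → X × A × ℝ => B.roundLaw ν L T Q (fun n : Fin t => w n) := by
  simp_rw [roundLaw_eq_playLaw (B := B) hd hu hL hN]
  exact measurable_comp_seqEpoch hd hu hL hN t
    fun k P => B.playLaw ν L (k + 1) (Q (k + 1) P)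

lemma isProbabilityMeasure_roundLaw_seq (hd : IsDoublingSpace ν d) (hu : IsUniformSpace ν α)
    (hL : 1 ≤ L) (hN : 0 < numBatches ι T) (hQ : B.IsSolver ν L Q) (t : ℕ)
    (w : ℕ → X × A × ℝ) :
    IsProbabilityMeasure (B.roundLaw ν L T Q (fun n : Fin t => w n)) := by
  rw [roundLaw_eq_playLaw hd hu hL hN]
  exact B.isProbabilityMeasure_playLaw hd hu hL _
    (hQ _ _ (Nat.succ_pos _) (seqState_snd_nonempty hL w _)).1

lemma lintegral_seqLaw_succ (hd : IsDoublingSpace ν d) (hu : IsUniformSpace ν α)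
    (hL : 1 ≤ L) (hN : 0 < numBatches ι T) (hQ : B.IsSolver ν L Q) (z₀ : X × A × ℝ) (t : ℕ)
    (F : (ℕ → X × A × ℝ) → ENNReal) (hF : Measurable F) :
    ∫⁻ w, F w ∂(B.seqLaw ν L T Q z₀ (t + 1)) =
      ∫⁻ w, ∫⁻ z, F (Function.update w t z) ∂(B.roundLaw ν L T Q (fun n : Fin t => w n))
        ∂(B.seqLaw ν L T Q z₀ t) := by
  have hmeas : Measurable fun H : Fin t → X × A × ℝ => B.roundLaw ν L T Q H := by
    have h := (measurable_roundLaw_seq (B := B) (Q := Q) hd hu hL hN t).comp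
      (measurable_padSeq z₀ t)
    convert h using 1
    ext1 H
    simp only [Function.comp_apply, padSeq_restrict]
  have hprob : ∀ H : Fin t → X × A × ℝ, IsProbabilityMeasure (B.roundLaw ν L T Q H) := fun H => by
    rw [← padSeq_restrict z₀ H]
    exact isProbabilityMeasure_roundLaw_seq hd hu hL hN hQ t _
  let κ : Kernel (Fin t → X × A × ℝ) (X × A × ℝ) := ⟨_, hmeas⟩
  have hκ : IsMarkovKernel κ := ⟨hprob⟩
  have hsnoc : ∀ H : Fin t → X × A × ℝ, Measurable
      fun z : X × A × ℝ => (Fin.snoc H z : Fin (t + 1) → X × A × ℝ) :=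
    fun H => (measurable_snoc t).comp measurable_prodMk_left
  have hmap : Measurable fun H : Fin t → X × A × ℝ => (B.roundLaw ν L T Q H).map
      fun z => (Fin.snoc H z : Fin (t + 1) → X × A × ℝ) := by
    refine Measure.measurable_of_measurable_coe _ fun s hs => ?_
    have h := Kernel.measurable_kernel_prodMk_left (κ := κ) (measurable_snoc t hs)
    convert h using 1
    ext1 H
    rw [Measure.map_apply (hsnoc H) hs]
    rfl
  have hFp : Measurable fun H : Fin (t + 1) → X × A × ℝ => F (padSeq z₀ H) :=
    hF.comp (measurable_padSeq z₀ (t + 1))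
  have hFu : Measurable fun p : (ℕ → X × A × ℝ) × (X × A × ℝ) => F (Function.update p.1 t p.2) :=
    hF.comp (measurable_update_prod t)
  let κ' : Kernel (ℕ → X × A × ℝ) (X × A × ℝ) :=
    ⟨_, measurable_roundLaw_seq (B := B) (Q := Q) hd hu hL hN t⟩
  have hκ' : IsMarkovKernel κ' :=
    ⟨isProbabilityMeasure_roundLaw_seq (B := B) (Q := Q) hd hu hL hN hQ t⟩
  have hF' : Measurable fun w : ℕ → X × A × ℝ => ∫⁻ z, F (Function.update w t z)
      ∂(B.roundLaw ν L T Q (fun n : Fin t => w n)) :=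
    hFu.lintegral_kernel_prod_right' (κ := κ')
  rw [seqLaw, lintegral_map hF (measurable_padSeq z₀ _), historyLaw,
    Measure.lintegral_bind hmap.aemeasurable hFp.aemeasurable, seqLaw,
    lintegral_map hF' (measurable_padSeq z₀ _)]
  refine lintegral_congr fun H => ?_
  rw [lintegral_map hFp (hsnoc H), padSeq_restrict]
  simp_rw [padSeq_snoc]

lemma isProbabilityMeasure_seqLaw (hd : IsDoublingSpace ν d) (hu : IsUniformSpace ν α)
    (hL : 1 ≤ L) (hN : 0 < numBatches ι T) (hQ : B.IsSolver ν L Q) (z₀ : X × A × ℝ) (t : ℕ) :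
    IsProbabilityMeasure (B.seqLaw ν L T Q z₀ t) := by
  induction t with
  | zero =>
    unfold seqLaw
    rw [historyLaw]
    exact Measure.isProbabilityMeasure_map (measurable_padSeq z₀ 0).aemeasurable
  | succ t ih =>
    constructor
    have h := lintegral_seqLaw_succ hd hu hL hN hQ z₀ t (fun _ => 1) measurable_const
    have hp := fun w => (isProbabilityMeasure_roundLaw_seq (B := B) (Q := Q) hd hu hL hN hQ t w)
    simpa using h

/-- The median-of-means estimate of a policy is inaccurate at the end of an epoch within the first
`T` rounds with small probability. -/
def inaccurate (B : Problem X A Ω ι) (ν : Measure A) (L : ℝ) (T : ℕ)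
    (Q : ℕ → Finset ι → ι → ℝ) (i : ι) (k : ℕ) : Set (ℕ → X × A × ℝ) :=
  {w | (B.seqState ν L T Q w (k + 1)).1 ≤ T ∧
    0 < B.batchSize ν L (k + 1) (B.seqState ν L T Q w k).2 ∧
    i ∈ (B.seqState ν L T Q w k).2 ∧ radius L (k + 1) / 2 <
      |B.seqEstimate ν L T Q w (k + 1) (B.seqState ν L T Q w k).1 (B.seqState ν L T Q w k).2 i -
        B.smoothLoss ν (bandwidth (k + 1)) i|}

/-- The epoch `k + 1` is not empty, and is over within the first `T` rounds. -/
def completed (B : Problem X A Ω ι) (ν : Measure A) (L : ℝ) (T : ℕ)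
    (Q : ℕ → Finset ι → ι → ℝ) (k : ℕ) : Set (ℕ → X × A × ℝ) :=
  {w | (B.seqState ν L T Q w (k + 1)).1 ≤ T ∧
    0 < B.batchSize ν L (k + 1) (B.seqState ν L T Q w k).2}

lemma seqState_succ_fst (w : ℕ → X × A × ℝ) (k : ℕ) : (B.seqState ν L T Q w (k + 1)).1 =
    (B.seqState ν L T Q w k).1 + B.epochLength ν L T (k + 1) (B.seqState ν L T Q w k).2 := rfl

lemma measurableSet_completed (k : ℕ) : MeasurableSet (B.completed ν L T Q k) :=
  measurableSet_seqState_mem (B := B) (ν := ν) (L := L) (T := T) (Q := Q) k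
    {c | c.1 + B.epochLength ν L T (k + 1) c.2 ≤ T ∧ 0 < B.batchSize ν L (k + 1) c.2}

/-- Rounding down a number to a positive integer loses at most a factor `2`, so the batch size times
`r_m ^ 2` is at least `160 κ V`. Accuracy `r_m / 2` costs a factor `4`, which leaves `20 * (2 κ V)`.
-/
lemma twenty_mul_le_batchSize_mul (hL : 1 ≤ L) (m : ℕ) (P : Finset ι) (h : 0 < B.batchSize ν L m P) :
    20 * (2 * (kernelSup ν (bandwidth m) * B.charVolume ν (bandwidth m) P)) ≤
      B.batchSize ν L m P * (radius L m / 2) ^ 2 := by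
  have hr := radius_pos hL m
  set y := 320 * kernelSup ν (bandwidth m) * B.charVolume ν (bandwidth m) P / radius L m ^ 2
    with hy
  have h1 : y < B.batchSize ν L m P + 1 := Nat.lt_floor_add_one y
  have h2 : (1 : ℝ) ≤ B.batchSize ν L m P := by exact_mod_cast h
  have h3 : y * radius L m ^ 2 =
      320 * kernelSup ν (bandwidth m) * B.charVolume ν (bandwidth m) P := by
    rw [hy]; field_simp
  have h4 : y ≤ 2 * B.batchSize ν L m P := by linarith
  have h5 := mul_le_mul_of_nonneg_right h4 (sq_nonneg (radius L m))
  nlinarith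

/-- Conditioning on the state at the start of the epoch fixes the weights and the batch size, and
the i.i.d. bound applies. The factor for completed epochs is kept so that the union over epochs
costs at most `T`, however many epochs are considered. -/
lemma measure_inaccurate_le (hd : IsDoublingSpace ν d) (hu : IsUniformSpace ν α)
    (hL : 1 ≤ L) (hN : 0 < numBatches ι T) (hQ : B.IsSolver ν L Q) (z₀ : X × A × ℝ)
    (i : ι) (k : ℕ) :
    B.seqLaw ν L T Q z₀ T (B.inaccurate ν L T Q i k) ≤
      B.seqLaw ν L T Q z₀ T (B.completed ν L T Q k) *
        ENNReal.ofReal (Real.exp (-(numBatches ι T : ℝ) / 2)) := by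
  set p := ENNReal.ofReal (Real.exp (-(numBatches ι T : ℝ) / 2))
  set D : Set (ℕ × Finset ι) :=
    {c | c.1 + B.epochLength ν L T (k + 1) c.2 ≤ T ∧ 0 < B.batchSize ν L (k + 1) c.2} with hD
  set E : ℕ × Finset ι → Set (ℕ → X × A × ℝ) :=
    fun c => {w | B.seqState ν L T Q w k = c} with hE
  set G : ℕ × Finset ι → Set (ℕ → X × A × ℝ) := fun c =>
    {w | radius L (k + 1) / 2 < |B.seqEstimate ν L T Q w (k + 1) c.1 c.2 i -
      B.smoothLoss ν (bandwidth (k + 1)) i|} with hG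
  have hEm : ∀ c, MeasurableSet (E c) := fun c => measurableSet_seqState_eq k c
  have hGm : ∀ c, MeasurableSet (G c) := fun c =>
    measurableSet_lt measurable_const (continuous_abs.measurable.comp
      ((measurable_seqEstimate _ _ _ i).sub_const _))
  have hprob := isProbabilityMeasure_seqLaw (B := B) (Q := Q) hd hu hL hN hQ z₀
  have hround := isProbabilityMeasure_roundLaw_seq (B := B) (Q := Q) hd hu hL hN hQ
  have hstep := lintegral_seqLaw_succ (B := B) (Q := Q) hd hu hL hN hQ z₀
  have hc : ∀ c ∈ D, i ∈ c.2 → B.seqLaw ν L T Q z₀ T (E c ∩ G c) ≤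
      B.seqLaw ν L T Q z₀ T (E c) * p := by
    rintro ⟨s, P⟩ ⟨hsT, hb⟩ hi
    simp only at hsT hb hi
    have hdepE : ∀ w w' : ℕ → X × A × ℝ, (∀ n < s, w n = w' n) → w ∈ E (s, P) →
        w' ∈ E (s, P) := fun w w' h hw => by
      have hw1 : B.seqState ν L T Q w k = (s, P) := hw
      have := seqState_congr (B := B) (ν := ν) (L := L) (T := T) (Q := Q) (w := w) (w' := w')
        (k := k) (by rw [hw1]; exact h)
      exact this.symm.trans hw1
    have hdepG : DependsOn ((G (s, P)).indicator (1 : (ℕ → X × A × ℝ) → ENNReal))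
        (Ico s (s + B.epochLength ν L T (k + 1) P)) := fun w w' h => by
      have h1 := seqEstimate_congr (B := B) (ν := ν) (L := L) (T := T) (Q := Q) (m := k + 1)
        (s := s) (P := P) (w := w) (w' := w') (fun n h1 h2 => h n ⟨h1, h2⟩) i
      have h2 : w ∈ G (s, P) ↔ w' ∈ G (s, P) := by
        simp only [hG, mem_ofPred_eq, h1]
      by_cases hw : w ∈ G (s, P)
      · rw [indicator_of_mem hw, indicator_of_mem (h2.1 hw)]; rfl
      · rw [indicator_of_notMem hw, indicator_of_notMem fun h => hw (h2.2 h)]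
    have hdepE1 : DependsOn ((E (s, P)).indicator (1 : (ℕ → X × A × ℝ) → ENNReal)) (Iio s) :=
      fun w w' h => by
      have h2 : w ∈ E (s, P) ↔ w' ∈ E (s, P) :=
        ⟨hdepE w w' fun n hn => h n hn, hdepE w' w fun n hn => (h n hn).symm⟩
      by_cases hw : w ∈ E (s, P)
      · rw [indicator_of_mem hw, indicator_of_mem (h2.1 hw)]; rfl
      · rw [indicator_of_notMem hw, indicator_of_notMem fun h => hw (h2.2 h)]
    have hdepEG : DependsOn ((E (s, P) ∩ G (s, P)).indicator
        (1 : (ℕ → X × A × ℝ) → ENNReal)) (Iio (s + B.epochLength ν L T (k + 1) P)) :=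
      fun w w' h => by
      have h1 := hdepE1 fun n (hn : n < s) => h n (by rw [mem_Iio]; omega)
      have h2 := hdepG fun n hn => h n hn.2
      rw [inter_indicator_one, Pi.mul_apply, Pi.mul_apply, h1, h2]
    have hwP := (hQ (k + 1) P (Nat.succ_pos k) ⟨i, hi⟩).1
    have hρ := B.isProbabilityMeasure_playLaw hd hu hL (k + 1) hwP
    have hmom := measure_medianOfMeans_le (ρ := B.playLaw ν L (k + 1) (Q (k + 1) P))
      (B.measurable_ipsEstimate L (k + 1) _ i) (B.memLp_ipsEstimate hd hu hL (k + 1) hwP i)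
      (B.integral_ipsEstimate_sq_le hd hu hL hQ (Nat.succ_pos k) hi)
      (half_pos (radius_pos hL (k + 1))) hb
      (twenty_mul_le_batchSize_mul hL (k + 1) P hb) s (numBatches ι T)
    rw [B.integral_ipsEstimate hd hu hL (k + 1) hwP i] at hmom
    -- The event `E` is determined before time `s`, and `G` by the rounds of the epoch.
    have hblock := setLIntegral_process_block (B.playLaw ν L (k + 1) (Q (k + 1) P)) hstep
      (hEm (s, P)) hdepE (B.epochLength ν L T (k + 1) P) (fun w hw t h1 h2 => by
        have hw1 : B.seqState ν L T Q w k = (s, P) := hw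
        have h3 : B.seqEpoch ν L T Q w t = k :=
          (seqEpoch_eq_iff hd hu hL hN w t k).2
            ⟨by rw [hw1]; exact h1, by rw [seqState_succ_fst, hw1]; exact h2⟩
        rw [roundLaw_eq_playLaw hd hu hL hN, h3, hw1]) (measurable_one.indicator (hGm (s, P))) hdepG
    rw [lintegral_indicator_one (hGm _), lintegral_indicator_one (hGm _),
      Measure.restrict_apply (hGm _)] at hblock
    calc B.seqLaw ν L T Q z₀ T (E (s, P) ∩ G (s, P))
        = B.seqLaw ν L T Q z₀ (s + B.epochLength ν L T (k + 1) P) (E (s, P) ∩ G (s, P)) := by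
          rw [← lintegral_indicator_one ((hEm _).inter (hGm _)),
            lintegral_process_of_dependsOn hround hstep
              (measurable_one.indicator ((hEm _).inter (hGm _))) hsT hdepEG,
            lintegral_indicator_one ((hEm _).inter (hGm _))]
      _ ≤ B.seqLaw ν L T Q z₀ s (E (s, P)) * p := by
          rw [inter_comm, hblock]
          gcongr
          exact hmom
      _ = B.seqLaw ν L T Q z₀ T (E (s, P)) * p := by
          congr 1
          rw [← lintegral_indicator_one (hEm _), ← lintegral_indicator_one (hEm _)]
          exact (lintegral_process_of_dependsOn hround hstep
            (measurable_one.indicator (hEm _)) (by omega) hdepE1).symm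
  have hsub : B.inaccurate ν L T Q i k ⊆ ⋃ c ∈ {c ∈ D | i ∈ c.2}, E c ∩ G c := by
    rintro w ⟨h1, h2, h3, h4⟩
    exact mem_biUnion (x := B.seqState ν L T Q w k) ⟨⟨h1, h2⟩, h3⟩ ⟨rfl, h4⟩
  calc B.seqLaw ν L T Q z₀ T (B.inaccurate ν L T Q i k)
      ≤ B.seqLaw ν L T Q z₀ T (⋃ c ∈ {c ∈ D | i ∈ c.2}, E c ∩ G c) := measure_mono hsub
    _ ≤ ∑' c : {c ∈ D | i ∈ c.2}, B.seqLaw ν L T Q z₀ T (E c ∩ G c) :=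
        measure_biUnion_le _ (to_countable _) _
    _ ≤ ∑' c : {c ∈ D | i ∈ c.2}, B.seqLaw ν L T Q z₀ T (E c) * p :=
        ENNReal.tsum_le_tsum fun c => hc c c.2.1 c.2.2
    _ = (∑' c : {c ∈ D | i ∈ c.2}, B.seqLaw ν L T Q z₀ T (E c)) * p := ENNReal.tsum_mul_right
    _ = B.seqLaw ν L T Q z₀ T (⋃ c ∈ {c ∈ D | i ∈ c.2}, E c) * p := by
        -- The events for different states are disjoint, so summing over countably many states loses
        -- nothing.
        rw [measure_biUnion (to_countable _) (fun c _ c' _ hcc => ?_) fun c _ => hEm c]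
        exact disjoint_left.2 fun w hw hw' => hcc (hw.symm.trans hw')
    _ ≤ B.seqLaw ν L T Q z₀ T (B.completed ν L T Q k) * p := by
        gcongr
        refine iUnion₂_subset fun c hc w hw => ?_
        have hw1 : B.seqState ν L T Q w k = c := hw
        change (B.seqState ν L T Q w k).1 +
            B.epochLength ν L T (k + 1) (B.seqState ν L T Q w k).2 ≤ T ∧
          0 < B.batchSize ν L (k + 1) (B.seqState ν L T Q w k).2
        rw [hw1]
        exact hc.1

/-- At most `T` nonempty epochs are over within the first `T` rounds. -/
lemma sum_indicator_completed_le (hN : 0 < numBatches ι T) (K : ℕ) (w : ℕ → X × A × ℝ) :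
    ∑ k ∈ Finset.range K, (B.completed ν L T Q k).indicator (1 : (ℕ → X × A × ℝ) → ENNReal) w ≤
      T := by
  classical
  have key : ∀ K : ℕ, ((Finset.range K).filter fun k => w ∈ B.completed ν L T Q k).card ≤
      min T (B.seqState ν L T Q w K).1 := by
    intro K
    induction K with
    | zero => simp
    | succ K ih =>
      have hmono := seqState_fst_le_succ (B := B) (ν := ν) (L := L) (T := T) (Q := Q) w K
      rw [Finset.range_add_one, Finset.filter_insert]
      split_ifs with h
      · rw [Finset.card_insert_of_notMem (by simp)]
        obtain ⟨h1, h2⟩ := h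
        have h3 : 1 ≤ B.epochLength ν L T (K + 1) (B.seqState ν L T Q w K).2 := Nat.mul_pos h2 hN
        rw [seqState_succ_fst] at h1 ⊢
        rw [le_min_iff] at ih ⊢
        omega
      · exact ih.trans (min_le_min_left _ hmono)
  have : ∑ k ∈ Finset.range K, (B.completed ν L T Q k).indicator
      (1 : (ℕ → X × A × ℝ) → ENNReal) w =
      (((Finset.range K).filter fun k => w ∈ B.completed ν L T Q k).card : ENNReal) := by
    rw [Finset.card_filter, Nat.cast_sum]
    refine Finset.sum_congr rfl fun k _ => ?_
    by_cases h : w ∈ B.completed ν L T Q k <;> simp [h]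
  rw [this]
  exact_mod_cast (key K).trans (min_le_left _ _)

/-- All estimates of the first `K` epochs are accurate, up to a small probability. -/
lemma measure_iUnion_inaccurate_le (hd : IsDoublingSpace ν d) (hu : IsUniformSpace ν α)
    (hL : 1 ≤ L) (hN : 0 < numBatches ι T) (hQ : B.IsSolver ν L Q) (z₀ : X × A × ℝ) (K : ℕ) :
    B.seqLaw ν L T Q z₀ T (⋃ i, ⋃ k ∈ Finset.range K, B.inaccurate ν L T Q i k) ≤
      ENNReal.ofReal (Fintype.card ι * (T * Real.exp (-(numBatches ι T : ℝ) / 2))) := by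
  have hprob := isProbabilityMeasure_seqLaw (B := B) (Q := Q) hd hu hL hN hQ z₀ T
  set p := ENNReal.ofReal (Real.exp (-(numBatches ι T : ℝ) / 2)) with hp
  -- The sum of the probabilities is the expected number of completed nonempty epochs.
  have hcount : ∑ k ∈ Finset.range K, B.seqLaw ν L T Q z₀ T (B.completed ν L T Q k) ≤ T := by
    simp_rw [← lintegral_indicator_one (measurableSet_completed _)]
    rw [← lintegral_finsetSum _ fun k _ => measurable_one.indicator (measurableSet_completed k)]
    calc _ ≤ ∫⁻ _, (T : ENNReal) ∂(B.seqLaw ν L T Q z₀ T) :=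
          lintegral_mono fun w => sum_indicator_completed_le hN K w
      _ = T := by simp
  calc _ ≤ ∑ i, B.seqLaw ν L T Q z₀ T (⋃ k ∈ Finset.range K, B.inaccurate ν L T Q i k) := by
        have := measure_biUnion_finset_le (μ := B.seqLaw ν L T Q z₀ T) Finset.univ
          fun i => ⋃ k ∈ Finset.range K, B.inaccurate ν L T Q i k
        simpa using this
    _ ≤ ∑ _i : ι, (T : ENNReal) * p := by
        refine Finset.sum_le_sum fun i _ => (measure_biUnion_finset_le _ _).trans ?_
        calc _ ≤ ∑ k ∈ Finset.range K, B.seqLaw ν L T Q z₀ T (B.completed ν L T Q k) * p :=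
              Finset.sum_le_sum fun k _ => measure_inaccurate_le hd hu hL hN hQ z₀ i k
          _ ≤ T * p := by rw [← Finset.sum_mul]; gcongr
    _ = _ := by
        rw [Finset.sum_const, Finset.card_univ, nsmul_eq_mul, ENNReal.ofReal_mul (by positivity),
          ENNReal.ofReal_mul (by positivity), ENNReal.ofReal_natCast, ENNReal.ofReal_natCast]

end SeqLaw

end Problem

/-! ### The regret in terms of the complexities of the scales. -/

/-- No integrability is needed: a non-integrable function has integral zero by default. -/
lemma integral_le_of_lintegral_ofReal_le {Y : Type*} [MeasurableSpace Y] {μ : Measure Y}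
    {f : Y → ℝ} {c : ℝ} (hc : 0 ≤ c)
    (h : ∫⁻ y, ENNReal.ofReal (f y) ∂μ ≤ ENNReal.ofReal c) : ∫ y, f y ∂μ ≤ c := by
  by_cases hf : Integrable f μ
  · rw [integral_eq_lintegral_pos_part_sub_lintegral_neg_part hf]
    have h1 := ENNReal.toReal_mono ENNReal.ofReal_ne_top h
    rw [ENNReal.toReal_ofReal hc] at h1
    linarith [ENNReal.toReal_nonneg (a := ∫⁻ y, ENNReal.ofReal (-f y) ∂μ)]
  · rwa [integral_undef hf]

/-- Rounds are grouped by their epoch `e t`. All those from index `K` on are charged at the rate of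
index `K`. -/
lemma sum_comp_min_le (f : ℕ → ℝ) (hf : ∀ k, 0 ≤ f k) (e : ℕ → ℕ) (K T : ℕ) :
    ∑ t ∈ Finset.range T, f (min (e t) K) ≤
      ∑ k ∈ Finset.range K, (((Finset.range T).filter fun t => e t = k).card : ℝ) * f k +
        T * f K := by
  have h1 : ∀ t, f (min (e t) K) ≤ ∑ k ∈ Finset.range K, (if e t = k then f k else 0) + f K := by
    intro t
    have h0 : ∀ k ∈ Finset.range K, 0 ≤ if e t = k then f k else 0 := fun k _ => by
      split_ifs
      exacts [hf k, le_rfl]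
    rcases lt_or_ge (e t) K with h | h
    · rw [min_eq_left h.le]
      have := Finset.single_le_sum h0 (Finset.mem_range.2 h)
      rw [if_pos rfl] at this
      linarith [hf K]
    · rw [min_eq_right h]
      linarith [Finset.sum_nonneg h0]
  calc _ ≤ ∑ t ∈ Finset.range T, (∑ k ∈ Finset.range K, (if e t = k then f k else 0) + f K) :=
        Finset.sum_le_sum fun t _ => h1 t
    _ = _ := by
        rw [Finset.sum_add_distrib, Finset.sum_comm]
        congr 1
        · refine Finset.sum_congr rfl fun k _ => ?_
          rw [← Finset.sum_filter, Finset.sum_const, nsmul_eq_mul]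
        · simp

namespace Problem

lemma radius_succ (L : ℝ) (m : ℕ) : 2 * radius L (m + 1) = radius L m := by
  unfold radius; rw [pow_succ]; ring

lemma radius_antitone {L : ℝ} (hL : 1 ≤ L) : Antitone (radius L) :=
  antitone_nat_of_succ_le fun m => by
    have := radius_succ L m
    have := radius_pos hL (m + 1)
    linarith

section Regret

variable {X A Ω ι : Type*} [MeasurableSpace X] [MetricSpace A] [MeasurableSpace A] [BorelSpace A]
  [SecondCountableTopology A] [MeasurableSpace Ω] [Fintype ι] [Nonempty ι] {B : Problem X A Ω ι}
  {ν : Measure A} [IsProbabilityMeasure ν] {d α L : ℝ} {T : ℕ} {Q : ℕ → Finset ι → ι → ℝ}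

/-- If the estimates of the first `K` epochs are accurate, then only near optimal policies remain,
and an optimal policy is never eliminated. -/
lemma seqState_snd_subset_nearOptimal (hd : IsDoublingSpace ν d) (hu : IsUniformSpace ν α)
    (hlip : B.IsLipschitz L) (hL : 1 ≤ L) {K : ℕ} {w : ℕ → X × A × ℝ}
    (hw : w ∉ ⋃ i, ⋃ k ∈ Finset.range K, B.inaccurate ν L T Q i k) {i₀ : ι}
    (hi₀ : B.expLoss i₀ = B.benchmark) :
    ∀ k ≤ K, (B.seqState ν L T Q w k).1 ≤ T → i₀ ∈ (B.seqState ν L T Q w k).2 ∧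
      ∀ i ∈ (B.seqState ν L T Q w k).2, i ∈ B.nearOptimal (12 * radius L (k + 1)) := by
  intro k
  induction k with
  | zero =>
    -- Initially `12 r_1 = 6 L ≥ 1`, so near optimality is automatic.
    refine fun _ _ => ⟨Finset.mem_univ _, fun i _ => B.mem_nearOptimal_of_one_le ?_ i⟩
    unfold radius
    linarith
  | succ k ih =>
    intro hk hT
    obtain ⟨h1, h2⟩ := ih (by omega) ((seqState_fst_le_succ w k).trans hT)
    have hr := radius_pos hL (k + 1)
    have hr2 := radius_succ L (k + 1)
    -- In an empty epoch all estimates are the same median of zeros, so nothing is eliminated. Such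
    -- an epoch has `r² > 320`, which makes near optimality trivial again.
    rcases Nat.eq_zero_or_pos (B.batchSize ν L (k + 1) (B.seqState ν L T Q w k).2) with hb | hb
    · refine ⟨mem_seqState_snd_succ.2 ⟨h1, fun j _ => ?_⟩, fun i _ =>
        B.mem_nearOptimal_of_one_le ?_ i⟩
      · have : ∀ i, B.seqEstimate ν L T Q w (k + 1) (B.seqState ν L T Q w k).1
            (B.seqState ν L T Q w k).2 i = median fun _ : Fin (numBatches ι T) => (0 : ℝ) := by
          intro i
          unfold seqEstimate
          simp [hb]
        rw [this, this]
        linarith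
      · have hκV := B.one_le_kernelSup_mul_charVolume hd hu (bandwidth_pos (k + 1)) ⟨i₀, h1⟩
        rw [batchSize, Nat.floor_eq_zero, div_lt_one (by positivity)] at hb
        nlinarith
    · have hacc : ∀ i ∈ (B.seqState ν L T Q w k).2,
          |B.seqEstimate ν L T Q w (k + 1) (B.seqState ν L T Q w k).1
            (B.seqState ν L T Q w k).2 i - B.smoothLoss ν (bandwidth (k + 1)) i| ≤
              radius L (k + 1) / 2 := fun i hi => by
        by_contra hcon
        push Not at hcon
        exact hw (mem_iUnion.2 ⟨i, mem_biUnion (x := k) (Finset.mem_coe.2 (Finset.mem_range.2 hk))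
          ⟨hT, hb, hi, hcon⟩⟩)
      have hbias : ∀ i, |B.smoothLoss ν (bandwidth (k + 1)) i - B.expLoss i| ≤
          radius L (k + 1) := fun i => B.abs_smoothLoss_sub_le hd hu hlip hL (bandwidth_pos _) i
      have e0 := abs_le.1 (hacc i₀ h1)
      have b0 := abs_le.1 (hbias i₀)
      -- Comparing two policies costs two errors `r / 2` and two biases `r`, in total `3 r`, the
      -- threshold of the algorithm. A survivor therefore loses at most `6 r`, and `r` is twice the
      -- next radius.
      refine ⟨mem_seqState_snd_succ.2 ⟨h1, fun j hj => ?_⟩, fun i hi => ?_⟩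
      · have e1 := abs_le.1 (hacc j hj)
        have b1 := abs_le.1 (hbias j)
        linarith [B.benchmark_le j]
      · obtain ⟨hi1, hi2⟩ := mem_seqState_snd_succ.1 hi
        have e1 := abs_le.1 (hacc i hi1)
        have b1 := abs_le.1 (hbias i)
        have := hi2 i₀ h1
        rw [nearOptimal, mem_ofPred_eq]
        linarith

lemma lintegral_loss_playLaw (hd : IsDoublingSpace ν d) (hu : IsUniformSpace ν α)
    (hL : 1 ≤ L) (m : ℕ) {P : Finset ι} {w : ι → ℝ} (hw : w ∈ distributionsOn P) :
    ∫⁻ z, ENNReal.ofReal z.2.2 ∂(B.playLaw ν L m w) =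
      ENNReal.ofReal (∫ z, z.2.2 ∂(B.playLaw ν L m w)) := by
  have := B.isProbabilityMeasure_playLaw hd hu hL m hw
  have hm : Measurable fun z : X × A × ℝ => z.2.2 := measurable_snd.comp measurable_snd
  have h0 : ∀ᵐ z ∂(B.playLaw ν L m w), 0 ≤ z.2.2 :=
    B.ae_playLaw L m w (measurableSet_le measurable_const hm) fun x a ω => (B.loss_mem ω a).1
  have h1 : ∀ᵐ z ∂(B.playLaw ν L m w), z.2.2 ≤ 1 :=
    B.ae_playLaw L m w (measurableSet_le hm measurable_const) fun x a ω => (B.loss_mem ω a).2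
  refine (ofReal_integral_eq_lintegral_ofReal (Integrable.of_bound hm.aestronglyMeasurable 1 ?_)
    h0).symm
  filter_upwards [h0, h1] with z hz0 hz1
  rwa [Real.norm_eq_abs, abs_of_nonneg hz0]

/-- The number of the rounds of an epoch, times its radius. -/
lemma card_epoch_mul_radius_le (hd : IsDoublingSpace ν d) (hu : IsUniformSpace ν α)
    (hL : 1 ≤ L) (hN : 0 < numBatches ι T) {w : ℕ → X × A × ℝ} {k : ℕ}
    (h : (B.seqState ν L T Q w k).1 ≤ T →
      ∀ i ∈ (B.seqState ν L T Q w k).2, i ∈ B.nearOptimal (12 * radius L (k + 1))) :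
    (((Finset.range T).filter fun t => B.seqEpoch ν L T Q w t = k).card : ℝ) *
        radius L (k + 1) ≤ 320 * α * numBatches ι T *
      (B.expPacking (12 * radius L (k + 1)) (bandwidth (k + 1)) / radius L (k + 1)) := by
  have hα := one_le_of_isUniformSpace hd hu
  have hr := radius_pos hL (k + 1)
  have hM := B.one_le_expPacking (bandwidth_pos (k + 1)) (ε := 12 * radius L (k + 1))
    (by positivity)
  set s := B.seqState ν L T Q w k with hs
  have hsub : (Finset.range T).filter (fun t => B.seqEpoch ν L T Q w t = k) ⊆
      Finset.Ico s.1 (s.1 + B.epochLength ν L T (k + 1) s.2) := fun t ht => by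
    have := (seqEpoch_eq_iff hd hu hL hN w t k).1 (Finset.mem_filter.1 ht).2
    rw [seqState_succ_fst] at this
    exact Finset.mem_Ico.2 this
  rcases le_or_gt s.1 T with hsT | hsT
  · have hcard := Finset.card_le_card hsub
    rw [Nat.card_Ico, Nat.add_sub_cancel_left] at hcard
    have hκV := B.kernelSup_mul_charVolume_le hd hu (bandwidth_pos (k + 1)) (P := s.2) (h hsT)
    have hb : (B.batchSize ν L (k + 1) s.2 : ℝ) ≤
        320 * (α * B.expPacking (12 * radius L (k + 1)) (bandwidth (k + 1))) /
          radius L (k + 1) ^ 2 := by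
      have hκ := kernelSup_pos hd hu (bandwidth_pos (k + 1)) (ν := ν)
      have hV := B.charVolume_nonneg (ν := ν) (bandwidth (k + 1)) s.2
      refine (Nat.floor_le (by positivity)).trans ?_
      rw [mul_assoc]
      exact div_le_div_of_nonneg_right (mul_le_mul_of_nonneg_left hκV (by norm_num)) (by positivity)
    calc _ ≤ (B.epochLength ν L T (k + 1) s.2 : ℝ) * radius L (k + 1) := by
          gcongr
      _ = B.batchSize ν L (k + 1) s.2 * numBatches ι T * radius L (k + 1) := by
          rw [epochLength]; push_cast; ring
      _ ≤ (320 * (α * B.expPacking (12 * radius L (k + 1)) (bandwidth (k + 1))) /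
          radius L (k + 1) ^ 2) * numBatches ι T * radius L (k + 1) := by gcongr
      _ = _ := by field_simp
  -- An epoch that would start after the horizon contains no round, and nothing is known about its
  -- version space.
  · have : (Finset.range T).filter (fun t => B.seqEpoch ν L T Q w t = k) = ∅ := by
      refine Finset.eq_empty_of_forall_notMem fun t ht => ?_
      have h1 := Finset.mem_Ico.1 (hsub ht)
      have h2 := Finset.mem_range.1 (Finset.mem_filter.1 ht).1
      omega
    rw [this]
    simp only [Finset.card_empty, Nat.cast_zero, zero_mul]
    positivity

lemma dependsOn_roundLaw (f : Measure (X × A × ℝ) → ENNReal) (t : ℕ) :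
    DependsOn (fun w : ℕ → X × A × ℝ => f (B.roundLaw ν L T Q (fun n : Fin t => w n)))
      (Iio t) := by
  intro w w' h
  have : (fun n : Fin t => w n) = fun n : Fin t => w' n := by
    ext1 n; exact h n n.2
  simp only [this]

/-- The expected total loss is the expectation of the sum of the conditional expected losses of
the rounds. -/
lemma lintegral_sum_loss_le (hd : IsDoublingSpace ν d) (hu : IsUniformSpace ν α)
    (hL : 1 ≤ L) (hN : 0 < numBatches ι T) (hQ : B.IsSolver ν L Q) (z₀ : X × A × ℝ) :
    ∫⁻ H, ENNReal.ofReal (∑ t, (H t).2.2) ∂(B.historyLaw ν L T Q T) ≤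
      ∫⁻ w, ∑ t ∈ Finset.range T, ∫⁻ z, ENNReal.ofReal z.2.2
        ∂(B.roundLaw ν L T Q (fun n : Fin t => w n)) ∂(B.seqLaw ν L T Q z₀ T) := by
  have hm : Measurable fun z : X × A × ℝ => ENNReal.ofReal z.2.2 :=
    (measurable_snd.comp measurable_snd).ennreal_ofReal
  have hmt : ∀ t : ℕ, Measurable fun w : ℕ → X × A × ℝ => ENNReal.ofReal (w t).2.2 :=
    fun t => hm.comp (measurable_pi_apply t)
  have hround := isProbabilityMeasure_roundLaw_seq (B := B) (Q := Q) hd hu hL hN hQ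
  have hstep := lintegral_seqLaw_succ (B := B) (Q := Q) hd hu hL hN hQ z₀
  have hG : ∀ t : ℕ, Measurable fun w : ℕ → X × A × ℝ => ∫⁻ z, ENNReal.ofReal z.2.2
        ∂(B.roundLaw ν L T Q (fun n : Fin t => w n)) := fun t =>
    (Measure.measurable_lintegral hm).comp (measurable_roundLaw_seq hd hu hL hN t)
  calc _ ≤ ∫⁻ H, ∑ t ∈ Finset.range T, ENNReal.ofReal (padSeq z₀ H t).2.2
        ∂(B.historyLaw ν L T Q T) := by
        refine lintegral_mono fun H => ?_
        rw [Finset.sum_range]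
        refine (ENNReal.ofReal_le_ofReal (le_of_eq ?_)).trans
          (Finset.le_sum_of_subadditive ENNReal.ofReal (by simp)
            (fun _ _ => ENNReal.ofReal_add_le) Finset.univ
            fun t : Fin T => (padSeq z₀ H t).2.2)
        refine Finset.sum_congr rfl fun t _ => ?_
        simp [padSeq]
    _ = ∫⁻ w, ∑ t ∈ Finset.range T, ENNReal.ofReal (w t).2.2 ∂(B.seqLaw ν L T Q z₀ T) := by
        rw [seqLaw, lintegral_map (Finset.measurable_sum _ fun t _ => hmt t)
          (measurable_padSeq z₀ T)]
    _ = ∑ t ∈ Finset.range T, ∫⁻ w, ENNReal.ofReal (w t).2.2 ∂(B.seqLaw ν L T Q z₀ T) :=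
        lintegral_finsetSum _ fun t _ => hmt t
    _ = ∑ t ∈ Finset.range T, ∫⁻ w, ∫⁻ z, ENNReal.ofReal z.2.2
        ∂(B.roundLaw ν L T Q (fun n : Fin t => w n)) ∂(B.seqLaw ν L T Q z₀ T) := by
        refine Finset.sum_congr rfl fun t ht => ?_
        have htT := Finset.mem_range.1 ht
        rw [lintegral_process_of_dependsOn hround hstep (hmt t) (t := t + 1) htT
          (fun w w' h => by simp only [h t (Nat.lt_succ_self t)]), hstep t _ (hmt t),
          lintegral_process_of_dependsOn hround hstep (hG t) htT.le
            (dependsOn_roundLaw (fun μ => ∫⁻ z, ENNReal.ofReal z.2.2 ∂μ) t)]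
        simp
    _ = _ := (lintegral_finsetSum _ fun t _ => hG t).symm

/-- The regret bound in terms of the complexities of the first `K` scales. -/
theorem regret_le_sum (hd : IsDoublingSpace ν d) (hu : IsUniformSpace ν α)
    (hlip : B.IsLipschitz L) (hL : 1 ≤ L) (hN : 0 < numBatches ι T) (hQ : B.IsSolver ν L Q)
    (K : ℕ) :
    B.regret ν L T Q ≤ T * (Fintype.card ι * (T * Real.exp (-(numBatches ι T : ℝ) / 2))) +
      14 * (∑ k ∈ Finset.range K, 320 * α * numBatches ι T *
        (B.expPacking (12 * radius L (k + 1)) (bandwidth (k + 1)) / radius L (k + 1)) +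
          T * radius L (K + 1)) := by
  classical
  have hα := one_le_of_isUniformSpace hd hu
  obtain ⟨x₀⟩ := nonempty_of_isProbabilityMeasure B.ctxLaw
  obtain ⟨a₀⟩ := nonempty_of_isProbabilityMeasure ν
  set z₀ : X × A × ℝ := (x₀, a₀, 0)
  obtain ⟨i₀, hi₀⟩ := B.exists_expLoss_eq_benchmark
  have hprob := isProbabilityMeasure_seqLaw (B := B) (Q := Q) hd hu hL hN hQ z₀ T
  set S : ℝ := ∑ k ∈ Finset.range K, 320 * α * numBatches ι T *
        (B.expPacking (12 * radius L (k + 1)) (bandwidth (k + 1)) / radius L (k + 1)) +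
          T * radius L (K + 1) with hS
  have hr := fun k => radius_pos hL k
  have hS0 : 0 ≤ S := by
    refine add_nonneg (Finset.sum_nonneg fun k _ => ?_) (mul_nonneg (Nat.cast_nonneg _) (hr _).le)
    have := B.one_le_expPacking (bandwidth_pos (k + 1)) (ε := 12 * radius L (k + 1))
      (by have := hr (k + 1); positivity)
    have := hr (k + 1)
    positivity
  set bad := ⋃ i, ⋃ k ∈ Finset.range K, B.inaccurate ν L T Q i k with hbad
  have hw' : ∀ (w : ℕ → X × A × ℝ) (k : ℕ), Q (k + 1) (B.seqState ν L T Q w k).2 ∈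
      distributionsOn (B.seqState ν L T Q w k).2 := fun w k =>
    (hQ _ _ (Nat.succ_pos _) (seqState_snd_nonempty hL w _)).1
  have hpt : ∀ w : ℕ → X × A × ℝ, ∑ t ∈ Finset.range T, ∫⁻ z, ENNReal.ofReal z.2.2
        ∂(B.roundLaw ν L T Q (fun n : Fin t => w n)) ≤
      ENNReal.ofReal (T * B.benchmark + 14 * S) + bad.indicator (fun _ => (T : ENNReal)) w := by
    intro w
    by_cases hw : w ∈ bad
    · rw [indicator_of_mem hw]
      refine le_add_left ?_
      calc _ ≤ ∑ _t ∈ Finset.range T, (1 : ENNReal) := by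
            refine Finset.sum_le_sum fun t _ => ?_
            rw [roundLaw_eq_playLaw hd hu hL hN, lintegral_loss_playLaw hd hu hL _ (hw' w _),
              ← ENNReal.ofReal_one]
            exact ENNReal.ofReal_le_ofReal (B.integral_loss_playLaw_le_one hd hu hL _ (hw' w _))
        _ = T := by simp
    · refine le_add_right ?_
      have hinv := seqState_snd_subset_nearOptimal hd hu hlip hL hw hi₀
      -- Version spaces decrease, so after epoch `K` the guarantee of index `K` still holds. The
      -- loss of `14 r` is `12 r` for near optimality and `2 r` for exploration and smoothing.
      calc _ ≤ ∑ t ∈ Finset.range T, ENNReal.ofReal (B.benchmark +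
              14 * radius L (min (B.seqEpoch ν L T Q w t) K + 1)) := by
            refine Finset.sum_le_sum fun t ht => ?_
            have htT := Finset.mem_range.1 ht
            rw [roundLaw_eq_playLaw hd hu hL hN, lintegral_loss_playLaw hd hu hL _ (hw' w _)]
            set k := B.seqEpoch ν L T Q w t with hk
            have h1 : (B.seqState ν L T Q w k).1 ≤ t := seqState_seqEpoch_le w t
            have h2 : (B.seqState ν L T Q w (min k K)).1 ≤ (B.seqState ν L T Q w k).1 :=
              monotone_seqState_fst w (min_le_left k K)
            have h3 := (hinv (min k K) (min_le_right k K) (by omega)).2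
            have h4 := antitone_seqState_snd (B := B) (ν := ν) (L := L) (T := T) (Q := Q) w
              (min_le_left k K)
            have h5 := radius_antitone hL (show min k K + 1 ≤ k + 1 by
              have := min_le_left k K; omega)
            refine ENNReal.ofReal_le_ofReal ((B.integral_loss_playLaw_le hd hu hlip hL (k + 1)
              (hw' w k) (c := B.benchmark + 12 * radius L (min k K + 1))
              fun i hi => h3 i (h4 hi)).trans ?_)
            linarith
        _ = ENNReal.ofReal (∑ t ∈ Finset.range T, (B.benchmark +
              14 * radius L (min (B.seqEpoch ν L T Q w t) K + 1))) :=
            (ENNReal.ofReal_sum_of_nonneg fun t _ => by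
              have := B.benchmark_nonneg
              have := hr (min (B.seqEpoch ν L T Q w t) K + 1)
              positivity).symm
        _ ≤ _ := by
            refine ENNReal.ofReal_le_ofReal ?_
            rw [Finset.sum_add_distrib, ← Finset.mul_sum]
            have h1 := sum_comp_min_le (fun k => radius L (k + 1)) (fun k => (hr (k + 1)).le)
              (B.seqEpoch ν L T Q w) K T
            have h2 : ∑ k ∈ Finset.range K, (((Finset.range T).filter
                fun t => B.seqEpoch ν L T Q w t = k).card : ℝ) * radius L (k + 1) ≤
                ∑ k ∈ Finset.range K, 320 * α * numBatches ι T *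
                  (B.expPacking (12 * radius L (k + 1)) (bandwidth (k + 1)) / radius L (k + 1)) :=
              Finset.sum_le_sum fun k hk => card_epoch_mul_radius_le hd hu hL hN
                fun hT => (hinv k (Finset.mem_range.1 hk).le hT).2
            simp only [Finset.sum_const, Finset.card_range, nsmul_eq_mul]
            rw [hS]
            linarith
  have hb0 := B.benchmark_nonneg
  have hmain : ∫⁻ H, ENNReal.ofReal (∑ t, (H t).2.2) ∂(B.historyLaw ν L T Q T) ≤
      ENNReal.ofReal (T * B.benchmark + 14 * S +
        T * (Fintype.card ι * (T * Real.exp (-(numBatches ι T : ℝ) / 2)))) := by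
    refine (lintegral_sum_loss_le hd hu hL hN hQ z₀).trans ?_
    calc _ ≤ ∫⁻ w, (ENNReal.ofReal (T * B.benchmark + 14 * S) +
          bad.indicator (fun _ => (T : ENNReal)) w) ∂(B.seqLaw ν L T Q z₀ T) :=
          lintegral_mono hpt
      _ = ENNReal.ofReal (T * B.benchmark + 14 * S) +
          ∫⁻ w, bad.indicator (fun _ => (T : ENNReal)) w ∂(B.seqLaw ν L T Q z₀ T) := by
          rw [lintegral_add_left measurable_const]; simp
      _ ≤ ENNReal.ofReal (T * B.benchmark + 14 * S) + T * ENNReal.ofReal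
          (Fintype.card ι * (T * Real.exp (-(numBatches ι T : ℝ) / 2))) := by
          gcongr
          refine (lintegral_indicator_const_le _ _).trans ?_
          gcongr
          exact measure_iUnion_inaccurate_le hd hu hL hN hQ z₀ K
      _ = _ := by
          rw [← ENNReal.ofReal_natCast (n := T), ← ENNReal.ofReal_mul (by positivity),
            ← ENNReal.ofReal_add (by positivity) (by positivity)]
  have := integral_le_of_lintegral_ofReal_le (by positivity) hmain
  unfold regret
  linarith

/-- The regret is at most the number of rounds. -/
theorem regret_le_card (hd : IsDoublingSpace ν d) (hu : IsUniformSpace ν α)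
    (hL : 1 ≤ L) (hN : 0 < numBatches ι T) (hQ : B.IsSolver ν L Q) :
    B.regret ν L T Q ≤ T := by
  obtain ⟨x₀⟩ := nonempty_of_isProbabilityMeasure B.ctxLaw
  obtain ⟨a₀⟩ := nonempty_of_isProbabilityMeasure ν
  have hprob := isProbabilityMeasure_seqLaw (B := B) (Q := Q) hd hu hL hN hQ (x₀, a₀, 0) T
  have hmain : ∫⁻ H, ENNReal.ofReal (∑ t, (H t).2.2) ∂(B.historyLaw ν L T Q T) ≤
      ENNReal.ofReal T := by
    refine (lintegral_sum_loss_le hd hu hL hN hQ (x₀, a₀, 0)).trans ?_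
    calc _ ≤ ∫⁻ _, (T : ENNReal) ∂(B.seqLaw ν L T Q (x₀, a₀, 0) T) := by
          refine lintegral_mono fun w => ?_
          calc _ ≤ ∑ _t ∈ Finset.range T, (1 : ENNReal) := by
                refine Finset.sum_le_sum fun t _ => ?_
                have hw' := (hQ (B.seqEpoch ν L T Q w t + 1) _ (Nat.succ_pos _)
                  (seqState_snd_nonempty (B := B) (ν := ν) (T := T) (Q := Q) hL w
                    (B.seqEpoch ν L T Q w t))).1
                rw [roundLaw_eq_playLaw hd hu hL hN, lintegral_loss_playLaw hd hu hL _ hw',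
                  ← ENNReal.ofReal_one]
                exact ENNReal.ofReal_le_ofReal (B.integral_loss_playLaw_le_one hd hu hL _ hw')
            _ = T := by simp
      _ = ENNReal.ofReal T := by simp
  have := integral_le_of_lintegral_ofReal_le (Nat.cast_nonneg T) hmain
  have := mul_nonneg (Nat.cast_nonneg (α := ℝ) T) B.benchmark_nonneg
  unfold regret
  linarith

end Regret

end Problem

/-! ### Optimization of the number of scales -/

lemma sum_pow_succ_le_two_mul_pow {b : ℝ} (hb : 2 ≤ b) (K : ℕ) :
    ∑ k ∈ Finset.range K, b ^ (k + 1) ≤ 2 * b ^ K := by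
  induction K with
  | zero => simp
  | succ K ih =>
    rw [Finset.sum_range_succ, pow_succ]
    have : 0 ≤ b ^ K := by positivity
    nlinarith

lemma half_pow_rpow (k : ℕ) (y : ℝ) : ((1 / 2 : ℝ) ^ k) ^ (-y) = ((2 : ℝ) ^ y) ^ k := by
  rw [one_div, inv_pow, Real.inv_rpow (by positivity), ← Real.rpow_neg (by positivity), neg_neg,
    ← Real.rpow_natCast, ← Real.rpow_natCast, ← Real.rpow_mul (by norm_num),
    ← Real.rpow_mul (by norm_num), mul_comm]

/-- Optimization under a polynomial bound of the complexities. -/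
lemma le_of_forall_scale_of_rpow {t L C₁ D D' γ z R : ℝ} {a : ℕ → ℝ} (ht : 2 ≤ t) (hL : 1 ≤ L)
    (hC : 0 ≤ C₁) (hD0 : 0 ≤ D) (hD : D ≤ 2 * D') (hD' : Real.log 2 ≤ D') (hγ : 1 ≤ γ)
    (hz : 0 ≤ z) (hR : R ≤ t)
    (hRK : ∀ K : ℕ, R ≤ 1 + C₁ * (D / L * ∑ k ∈ Finset.range K, a (k + 1) * 2 ^ (k + 1)) +
      14 * (t * (L * (1 / 2) ^ (K + 1))))
    (ha : ∀ k, a (k + 1) ≤ γ * ((1 / 2 : ℝ) ^ (k + 1)) ^ (-z)) :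
    R ≤ (15 + 4 * C₁) * (L ^ (z / (2 + z)) * t ^ ((1 + z) / (2 + z)) *
      (γ * D') ^ (1 / (2 + z))) := by
  have hlog2 : 0.6931471803 < Real.log 2 := Real.log_two_gt_d9
  have hL0 : 0 < L := by linarith
  have ht0 : 0 < t := by linarith
  have hg0 : 0 < γ * D' := by nlinarith
  have hz2 : 0 < 2 + z := by linarith
  -- This scale balances `t L ε` against `γ D' ε ^ (-(1 + z)) / L`, and `t L ε` is then exactly the
  -- claimed bound.
  set ε := (γ * D' / (t * L ^ 2)) ^ (1 / (2 + z)) with hε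
  have hε0 : 0 < ε := Real.rpow_pos_of_pos (by positivity) _
  have hεz : ε ^ (2 + z) = γ * D' / (t * L ^ 2) := by
    rw [hε, ← Real.rpow_mul (by positivity), one_div_mul_cancel hz2.ne', Real.rpow_one]
  have hX : L ^ (z / (2 + z)) * t ^ ((1 + z) / (2 + z)) * (γ * D') ^ (1 / (2 + z)) =
      t * L * ε := by
    have h1 : t ^ ((1 + z) / (2 + z)) = t * (t ^ (1 / (2 + z)))⁻¹ := by
      rw [← Real.rpow_neg ht0.le, ← Real.rpow_one_add' ht0.le]
      · congr 1; field_simp; ring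
      · have : 1 + -(1 / (2 + z)) = (1 + z) / (2 + z) := by field_simp; ring
        rw [this]; positivity
    have h2 : L ^ (z / (2 + z)) = L * ((L ^ 2) ^ (1 / (2 + z)))⁻¹ := by
      rw [← Real.rpow_natCast L 2, ← Real.rpow_mul hL0.le, ← Real.rpow_neg hL0.le]
      nth_rewrite 2 [← Real.rpow_one L]
      rw [← Real.rpow_add hL0]
      congr 1
      field_simp
      push_cast
      ring
    rw [hε, Real.div_rpow hg0.le (by positivity), Real.mul_rpow ht0.le (by positivity), h1, h2]
    field_simp
  rw [hX]
  have hX0 : 0 < t * L * ε := by positivity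
  rcases le_or_gt (1 / 2) ε with h | h
  · have h1 : t ≤ 2 * (t * L * ε) := by
      have : 1 ≤ L * (2 * ε) := by nlinarith
      nlinarith
    nlinarith
  · obtain ⟨K, hK1, hK2⟩ := exists_nat_pow_near_of_lt_one hε0 (by linarith : ε ≤ 1)
      (by norm_num : (0 : ℝ) < 1 / 2) (by norm_num)
    have hb : 2 ≤ (2 : ℝ) ^ (1 + z) := by
      calc (2 : ℝ) = 2 ^ (1 : ℝ) := (Real.rpow_one 2).symm
        _ ≤ _ := Real.rpow_le_rpow_of_exponent_le (by norm_num) (by linarith)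
    have hsum : ∑ k ∈ Finset.range K, a (k + 1) * 2 ^ (k + 1) ≤ γ * (2 * ε ^ (-(1 + z))) := by
      calc _ ≤ ∑ k ∈ Finset.range K, γ * ((2 : ℝ) ^ (1 + z)) ^ (k + 1) := by
            refine Finset.sum_le_sum fun k _ => ?_
            refine (mul_le_mul_of_nonneg_right (ha k) (by positivity)).trans (le_of_eq ?_)
            rw [half_pow_rpow, Real.rpow_add two_pos, Real.rpow_one, mul_pow]
            ring
        _ ≤ γ * (2 * ((2 : ℝ) ^ (1 + z)) ^ K) := by
            rw [← Finset.mul_sum]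
            gcongr
            exact sum_pow_succ_le_two_mul_pow hb K
        _ ≤ _ := by
            rw [← half_pow_rpow]
            gcongr γ * (2 * ?_)
            exact Real.rpow_le_rpow_of_nonpos hε0 hK2 (by linarith)
    have hkey : γ * D' * ε ^ (-(1 + z)) = t * L ^ 2 * ε := by
      have h1 : γ * D' = t * L ^ 2 * ε ^ (2 + z) := by rw [hεz]; field_simp
      rw [h1, mul_assoc, ← Real.rpow_add hε0]
      have : 2 + z + -(1 + z) = 1 := by ring
      rw [this, Real.rpow_one]
    have hmid : D / L * ∑ k ∈ Finset.range K, a (k + 1) * 2 ^ (k + 1) ≤ 4 * (t * L * ε) := by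
      have hp : 0 < ε ^ (-(1 + z)) := Real.rpow_pos_of_pos hε0 _
      calc _ ≤ D / L * (γ * (2 * ε ^ (-(1 + z)))) := by gcongr
        _ ≤ 2 * D' / L * (γ * (2 * ε ^ (-(1 + z)))) := by gcongr
        _ = 4 * (γ * D' * ε ^ (-(1 + z))) / L := by ring
        _ = 4 * (t * L * ε) := by rw [hkey]; field_simp
    have hlast : t * (L * (1 / 2) ^ (K + 1)) ≤ t * L * ε := by
      rw [mul_assoc]; gcongr
    -- The additive `1` is absorbed: `ε ^ (2 + z) ≤ ε ^ 2` gives `(t L ε)² ≥ t γ D' ≥ 2 log 2 > 1`.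
    have hone : 1 ≤ t * L * ε := by
      have h1 : ε ^ (2 + z) ≤ ε ^ 2 := by
        rw [← Real.rpow_natCast]
        exact Real.rpow_le_rpow_of_exponent_ge hε0 (by linarith) (by push_cast; linarith)
      have h2 : t * (γ * D') ≤ (t * L * ε) ^ 2 := by
        calc t * (γ * D') = (t * L) ^ 2 * ε ^ (2 + z) := by rw [hεz]; field_simp
          _ ≤ (t * L) ^ 2 * ε ^ 2 := by gcongr
          _ = _ := by ring
      have h3 : Real.log 2 ≤ γ * D' := by nlinarith
      have h4 : 1 ≤ (t * L * ε) ^ 2 := by nlinarith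
      nlinarith
    have := hRK K
    have := mul_le_mul_of_nonneg_left hmid hC
    linarith

lemma sum_min_le (j : ℕ) : ∀ n : ℕ,
    ∑ l ∈ Finset.range n, min 1 ((2 : ℝ) ^ j / 2 ^ l) ≤ j + 2 := by
  induction j with
  | zero =>
    intro n
    calc _ ≤ ∑ l ∈ Finset.range n, (1 / 2 : ℝ) ^ l :=
          Finset.sum_le_sum fun l _ => (min_le_right _ _).trans (le_of_eq (by simp))
      _ ≤ 2 := by
          have h1 : (0 : ℝ) < (1 / 2) ^ n := by positivity
          have h2 := geom_sum_eq (by norm_num : (1 / 2 : ℝ) ≠ 1) n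
          have h3 : ((1 / 2 : ℝ) ^ n - 1) / (1 / 2 - 1) = 2 - 2 * (1 / 2) ^ n := by ring
          linarith
      _ = _ := by simp
  | succ j ih =>
    intro n
    cases n with
    | zero => simp; positivity
    | succ n =>
      rw [Finset.sum_range_succ']
      have h1 : ∀ l : ℕ, (2 : ℝ) ^ (j + 1) / 2 ^ (l + 1) = 2 ^ j / 2 ^ l := fun l => by
        rw [pow_succ, pow_succ]; field_simp
      simp_rw [h1]
      have := ih n
      have h2 : min (1 : ℝ) (2 ^ (j + 1) / 2 ^ 0) ≤ 1 := min_le_left _ _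
      push_cast
      linarith

/-- The sum of the complexities of the scales is at most their maximum, up to a factor that is
logarithmic in the number `n` of policies. -/
lemma sum_le_log_card_mul {n ψ : ℝ} {a : ℕ → ℝ} {K j : ℕ} (han : ∀ k, a k ≤ n)
    (hnj : n ≤ 2 ^ j) (hψ : ∀ k ≤ K, a k * 2 ^ k ≤ ψ) (hψK : 2 ^ K ≤ ψ) :
    ∑ k ∈ Finset.range K, a (k + 1) * 2 ^ (k + 1) ≤ ψ * (j + 2) := by
  have hψ0 : 0 ≤ ψ := le_trans (by positivity) hψK
  -- The sum is read from the finest scale. The term at scale `K - l` is at most `ψ`, and also at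
  -- most `2 ^ j * 2 ^ (K - l) ≤ ψ * 2 ^ j / 2 ^ l`, so only about `j` terms matter.
  rw [← Finset.sum_range_reflect]
  calc _ ≤ ∑ l ∈ Finset.range K, ψ * min 1 ((2 : ℝ) ^ j / 2 ^ l) := by
        refine Finset.sum_le_sum fun l hl => ?_
        have hl' := Finset.mem_range.1 hl
        have hidx : K - 1 - l + 1 = K - l := by omega
        rw [hidx, mul_min_of_nonneg _ _ hψ0, mul_one]
        refine le_min (hψ _ (Nat.sub_le K l)) ?_
        have hpow : (2 : ℝ) ^ (K - l) * 2 ^ l = 2 ^ K := by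
          rw [← pow_add]; congr 1; omega
        rw [← mul_div_assoc, le_div_iff₀ (by positivity), mul_assoc, hpow, mul_comm ψ]
        calc a (K - l) * 2 ^ K ≤ 2 ^ j * 2 ^ K := by
              gcongr; exact (han _).trans hnj
          _ ≤ 2 ^ j * ψ := by gcongr
    _ ≤ ψ * (j + 2) := by
        rw [← Finset.mul_sum]
        gcongr
        exact sum_min_le j K

/-- The lower bound `Λ ≥ 1/3` turns the additive constants into multiples of `Λ`. -/
lemma clog_add_two_le {n : ℕ} (hn : 1 ≤ n) {Λ : ℝ} (hΛ : 1 / 3 ≤ Λ) (hΛn : Real.log n ≤ Λ) :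
    (Nat.clog 2 n : ℝ) + 2 ≤ 11 * Λ := by
  have hlog2 : 0.6931471803 < Real.log 2 := Real.log_two_gt_d9
  rcases hn.eq_or_lt with rfl | hn'
  · simp; linarith
  · obtain ⟨j, hj⟩ : ∃ j, Nat.clog 2 n = j + 1 :=
      ⟨_, (Nat.succ_pred_eq_of_pos (Nat.clog_pos one_lt_two hn')).symm⟩
    have h1 : 2 ^ j < n := (Nat.lt_clog_iff_pow_lt one_lt_two).1 (by omega)
    have h2 : (j : ℝ) * Real.log 2 ≤ Real.log n := by
      rw [← Real.log_pow]
      exact Real.log_le_log (by positivity) (by exact_mod_cast h1.le)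
    have h3 : (0 : ℝ) ≤ j := Nat.cast_nonneg j
    rw [hj]; push_cast
    nlinarith

/-- If `2 ^ K` is at most a small power of `t`, then exponentially growing complexities of the first
`K` scales are negligible. -/
lemma log_mul_sum_le_of_card_scale_le {t α c ε l : ℝ} {a : ℕ → ℝ} {K : ℕ} (ht : 2 ≤ t)
    (hα : 1 ≤ α) (hc : c = 1 / (4 * (Real.log (2 * α) / Real.log 2 + 1)))
    (hεl : ε = Real.exp (-l)) (hcase : l < c * Real.log t) (hKl : K * Real.log 2 ≤ l)
    (haα : ∀ k, a k ≤ α ^ (k + 2)) :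
    Real.log t * ∑ k ∈ Finset.range K, a (k + 1) * 2 ^ (k + 1) ≤ 16 * α ^ 2 * (t * ε) := by
  have hlog2 : 0.6931471803 < Real.log 2 := Real.log_two_gt_d9
  have ht0 : 0 < t := by linarith
  have hlogt : 0 < Real.log t := Real.log_pos (by linarith)
  have hβ : 0 ≤ Real.log (2 * α) / Real.log 2 :=
    div_nonneg (Real.log_nonneg (by linarith)) (by linarith)
  have hc4 : c ≤ 1 / 4 := by
    rw [hc]; exact one_div_le_one_div_of_le (by norm_num) (by linarith)
  have hct : c * Real.log t ≤ 1 / 4 * Real.log t := mul_le_mul_of_nonneg_right hc4 hlogt.le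
  -- Each of `log t`, `K` and `(2 α) ^ K` is at most `4 q`, the last because of the choice of `c`,
  -- while `ε ≥ 1 / q` gives `t ε ≥ q ^ 3`.
  set q := t ^ (1 / 4 : ℝ) with hq
  have hq0 : 0 < q := Real.rpow_pos_of_pos ht0 _
  have hqe : q = Real.exp (Real.log t * (1 / 4)) := Real.rpow_def_of_pos ht0 _
  have hSα : ∑ k ∈ Finset.range K, a (k + 1) * 2 ^ (k + 1) ≤ α ^ 2 * (K * (2 * α) ^ K) := by
    calc _ ≤ ∑ _k ∈ Finset.range K, α ^ 2 * (2 * α) ^ K := by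
          refine Finset.sum_le_sum fun k hk => ?_
          have hk' : k + 1 ≤ K := Finset.mem_range.1 hk
          calc a (k + 1) * 2 ^ (k + 1) ≤ α ^ (k + 1 + 2) * 2 ^ (k + 1) :=
                mul_le_mul_of_nonneg_right (haα _) (by positivity)
            _ = α ^ 2 * (2 * α) ^ (k + 1) := by rw [mul_pow]; ring
            _ ≤ α ^ 2 * (2 * α) ^ K :=
                mul_le_mul_of_nonneg_left (pow_le_pow_right₀ (by linarith) hk') (by positivity)
      _ = _ := by rw [Finset.sum_const, Finset.card_range, nsmul_eq_mul]; ring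
  have hpow : (2 * α) ^ K ≤ q := by
    rw [← Real.exp_log (by positivity : 0 < (2 * α) ^ K), Real.log_pow, hqe]
    refine Real.exp_le_exp.2 ?_
    have h8 : c * (Real.log (2 * α) / Real.log 2) ≤ 1 / 4 := by
      rw [hc, one_div_mul_eq_div, div_le_div_iff₀ (by positivity) (by norm_num)]
      linarith
    calc (K : ℝ) * Real.log (2 * α)
        = Real.log (2 * α) / Real.log 2 * (K * Real.log 2) := by
          have : Real.log 2 ≠ 0 := by linarith
          field_simp
      _ ≤ Real.log (2 * α) / Real.log 2 * (c * Real.log t) :=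
          mul_le_mul_of_nonneg_left (by linarith) hβ
      _ = c * (Real.log (2 * α) / Real.log 2) * Real.log t := by ring
      _ ≤ 1 / 4 * Real.log t := mul_le_mul_of_nonneg_right h8 hlogt.le
      _ = _ := by ring
  have hlt : Real.log t ≤ 4 * q := by
    have := Real.log_le_rpow_div ht0.le (by norm_num : (0 : ℝ) < 1 / 4)
    rw [← hq] at this
    linarith
  have hKt : (K : ℝ) ≤ 4 * q := by
    have h0 : (0 : ℝ) ≤ K := Nat.cast_nonneg K
    have h1 : (K : ℝ) * 0.6931471803 ≤ K * Real.log 2 := mul_le_mul_of_nonneg_left hlog2.le h0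
    linarith
  have hqt : q * q * q ≤ t * ε := by
    have h9 : q * q * q = t * Real.exp (-(Real.log t * (1 / 4))) := by
      have : t = Real.exp (Real.log t) := (Real.exp_log ht0).symm
      rw [hqe]
      conv_rhs => rw [this]
      rw [← Real.exp_add, ← Real.exp_add, ← Real.exp_add, Real.log_exp]
      congr 1; ring
    rw [h9, hεl]
    exact mul_le_mul_of_nonneg_left (Real.exp_le_exp.2 (by linarith)) ht0.le
  have hα2 : 0 < α ^ 2 := by positivity
  have h2α : 0 ≤ (2 * α) ^ K := by positivity
  calc _ ≤ Real.log t * (α ^ 2 * (K * (2 * α) ^ K)) := mul_le_mul_of_nonneg_left hSα hlogt.le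
    _ ≤ (4 * q) * (α ^ 2 * ((4 * q) * q)) := by
        refine mul_le_mul hlt (mul_le_mul_of_nonneg_left
          (mul_le_mul hKt hpow h2α (by linarith)) hα2.le) (by positivity) (by linarith)
    _ = 16 * α ^ 2 * (q * q * q) := by ring
    _ ≤ _ := mul_le_mul_of_nonneg_left hqt (by positivity)

/-- This absorbs the additive `1` of the regret bound. With `y = L ε`, the two terms are at least `2
y` and `1 / (12 y)`, whose sum is at least `1 / 2` for every `y > 0`. -/
lemma one_le_two_mul_add_of_scale {t L Λ ψ ε : ℝ} {K : ℕ} (ht : 2 ≤ t) (hL : 1 ≤ L)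
    (hΛ : 1 / 3 ≤ Λ) (hε0 : 0 < ε) (hε2 : ε < 1 / 2) (hK : (1 / 2) ^ K < 2 * ε)
    (hψ : 2 ^ K ≤ ψ) : 1 ≤ 2 * (t * L * ε + ψ / L * Λ * Real.log (1 / ε)) := by
  have hlog2 : 0.6931471803 < Real.log 2 := Real.log_two_gt_d9
  have h2K : (2 : ℝ) ^ K * (1 / 2) ^ K = 1 := by rw [← mul_pow]; norm_num
  have hψε : 1 / (2 * ε) ≤ ψ := by
    refine le_trans ?_ hψ
    rw [div_le_iff₀ (by positivity)]
    calc (1 : ℝ) = 2 ^ K * (1 / 2) ^ K := h2K.symm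
      _ ≤ 2 ^ K * (2 * ε) := mul_le_mul_of_nonneg_left hK.le (by positivity)
  have hl2 : 1 / 2 ≤ Real.log (1 / ε) := by
    have : Real.log 2 ≤ Real.log (1 / ε) := Real.log_le_log two_pos (by
      rw [le_div_iff₀ hε0]; linarith)
    linarith
  have hL0 : 0 < L := by linarith
  have hψ0 : 0 ≤ ψ := le_trans (by positivity) hψ
  have hy0 : 0 < L * ε := by positivity
  have hΛ0 : 0 ≤ Λ := by linarith
  have h12 : 1 / (12 * (L * ε)) ≤ ψ / L * Λ * Real.log (1 / ε) := by
    calc 1 / (12 * (L * ε)) = 1 / (2 * ε) / L * (1 / 3) * (1 / 2) := by field_simp; norm_num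
      _ ≤ ψ / L * Λ * Real.log (1 / ε) := by gcongr
  have h13 : 1 ≤ 2 * (2 * (L * ε) + 1 / (12 * (L * ε))) := by
    have : 2 * (2 * (L * ε) + 1 / (12 * (L * ε))) =
        (24 * (L * ε) ^ 2 + 1) / (6 * (L * ε)) := by field_simp; ring
    rw [this, le_div_iff₀ (by positivity)]
    nlinarith [sq_nonneg (8 * (L * ε) - 1)]
  have h14 : 2 * (L * ε) ≤ t * L * ε := by
    rw [mul_assoc]; exact mul_le_mul_of_nonneg_right ht hy0.le
  linarith

/-- Optimization in terms of the supremum of the complexities. -/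
lemma le_of_forall_scale_of_sup {t L C₁ D Λ α ψ ε c R : ℝ} {n : ℕ} {a : ℕ → ℝ} (ht : 2 ≤ t)
    (hL : 1 ≤ L) (hC : 0 ≤ C₁) (hD : D = Real.log t + Λ) (hΛ : 1 / 3 ≤ Λ) (hn : 1 ≤ n)
    (hΛn : Real.log n ≤ Λ) (hα : 1 ≤ α) (hc : c = 1 / (4 * (Real.log (2 * α) / Real.log 2 + 1)))
    (hε0 : 0 < ε) (hε1 : ε < 1) (hψ0 : 0 ≤ ψ) (hR : R ≤ t)
    (hRK : ∀ K : ℕ, R ≤ 1 + C₁ * (D / L * ∑ k ∈ Finset.range K, a (k + 1) * 2 ^ (k + 1)) +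
      14 * (t * (L * (1 / 2) ^ (K + 1))))
    (ha1 : ∀ k, 1 ≤ a k) (han : ∀ k, a k ≤ n) (haα : ∀ k, a k ≤ α ^ (k + 2))
    (haψ : ∀ k : ℕ, ε ≤ (1 / 2) ^ k → a k * 2 ^ k ≤ ψ) :
    R ≤ (16 + C₁ * (2 + 11 / c) + 16 * C₁ * α ^ 2) *
      (t * L * ε + ψ / L * Λ * Real.log (1 / ε)) := by
  have hlog2 : 0.6931471803 < Real.log 2 := Real.log_two_gt_d9
  have hL0 : 0 < L := by linarith
  have hΛ0 : 0 ≤ Λ := by linarith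
  have ht0 : 0 < t := by linarith
  have hlogt : 0 < Real.log t := Real.log_pos (by linarith)
  have hβ : 0 ≤ Real.log (2 * α) / Real.log 2 :=
    div_nonneg (Real.log_nonneg (by linarith)) (by linarith)
  have hc0 : 0 < c := by rw [hc]; positivity
  set l := Real.log (1 / ε) with hl
  have hl0 : 0 < l := Real.log_pos (by rw [lt_div_iff₀ hε0]; linarith)
  have hεl : ε = Real.exp (-l) := by
    rw [hl, one_div, Real.log_inv, neg_neg, Real.exp_log hε0]
  set Y := ψ / L * Λ * l with hY
  have hX1 : 0 < t * L * ε := by positivity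
  have hX2 : 0 ≤ Y := by positivity
  have hcst : 0 ≤ C₁ * (2 + 11 / c) + 16 * C₁ * α ^ 2 := by positivity
  rcases le_or_gt (1 / 2) ε with h | h
  · have h1 : t ≤ 2 * (t * L * ε) := by
      have h0 : 1 ≤ L * (2 * ε) := one_le_mul_of_one_le_of_one_le hL (by linarith)
      have := mul_le_mul_of_nonneg_left h0 ht0.le
      linarith
    have h2 : R ≤ 16 * (t * L * ε + Y) := by linarith
    have := mul_nonneg hcst (by linarith : 0 ≤ t * L * ε + Y)
    linarith
  · obtain ⟨K, hK1, hK2⟩ := exists_nat_pow_near_of_lt_one hε0 hε1.le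
      (by norm_num : (0 : ℝ) < 1 / 2) (by norm_num)
    have h2K : (2 : ℝ) ^ K * (1 / 2) ^ K = 1 := by rw [← mul_pow]; norm_num
    have hKl : K * Real.log 2 ≤ l := by
      rw [hl, ← Real.log_pow]
      refine Real.log_le_log (by positivity) ?_
      rw [le_div_iff₀ hε0]
      calc (2 : ℝ) ^ K * ε ≤ 2 ^ K * (1 / 2) ^ K := by gcongr
        _ = 1 := h2K
    have hKl2 : (K : ℝ) ≤ 2 * l := by
      have h0 : (0 : ℝ) ≤ K := Nat.cast_nonneg K
      have h1 : (K : ℝ) * 0.6931471803 ≤ K * Real.log 2 := mul_le_mul_of_nonneg_left hlog2.le h0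
      linarith
    have haψ' : ∀ k ≤ K, a k * 2 ^ k ≤ ψ := fun k hk => haψ k (hK2.trans
      (pow_le_pow_of_le_one (by norm_num) (by norm_num) hk))
    have hψK : 2 ^ K ≤ ψ :=
      (le_mul_of_one_le_left (by positivity) (ha1 K)).trans (haψ' K le_rfl)
    set S := ∑ k ∈ Finset.range K, a (k + 1) * 2 ^ (k + 1) with hS
    have hS0 : 0 ≤ S := Finset.sum_nonneg fun k _ =>
      mul_nonneg (by linarith [ha1 (k + 1)]) (by positivity)
    have hS1 : S ≤ 2 * l * ψ := by
      calc S ≤ ∑ _k ∈ Finset.range K, ψ :=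
            Finset.sum_le_sum fun k hk => haψ' (k + 1) (Finset.mem_range.1 hk)
        _ = K * ψ := by simp
        _ ≤ _ := mul_le_mul_of_nonneg_right hKl2 hψ0
    -- The factor `log t` of the number of batches is not in the claim. It is exchanged for `l / c`
    -- when `l` is large. Otherwise the whole term is absorbed into `t L ε`.
    have hlogS : Real.log t * S / L ≤ 11 / c * Y + 16 * α ^ 2 * (t * L * ε) := by
      have hfst : 0 ≤ 11 / c * Y := by positivity
      have hsnd : 0 < 16 * α ^ 2 * (t * L * ε) := by positivity
      rcases le_or_gt (c * Real.log t) l with hcase | hcase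
      · have hj : (n : ℝ) ≤ 2 ^ (Nat.clog 2 n) := by
          exact_mod_cast Nat.le_pow_clog one_lt_two _
        have hS3 : S ≤ ψ * (11 * Λ) := (sum_le_log_card_mul han hj haψ' hψK).trans
          (mul_le_mul_of_nonneg_left (clog_add_two_le hn hΛ hΛn) hψ0)
        have h5 : Real.log t ≤ l / c := by rw [le_div_iff₀ hc0]; linarith
        have h6 : Real.log t * S ≤ l / c * (ψ * (11 * Λ)) :=
          (mul_le_mul_of_nonneg_left hS3 hlogt.le).trans
            (mul_le_mul_of_nonneg_right h5 (by positivity))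
        calc Real.log t * S / L ≤ l / c * (ψ * (11 * Λ)) / L :=
              div_le_div_of_nonneg_right h6 hL0.le
          _ = 11 / c * Y := by rw [hY]; ring
          _ ≤ _ := by linarith
      · have h7 := log_mul_sum_le_of_card_scale_le ht hα hc hεl hcase hKl haα
        calc Real.log t * S / L ≤ Real.log t * S := div_le_self (by positivity) hL
          _ ≤ 16 * α ^ 2 * (t * ε) := h7
          _ ≤ 16 * α ^ 2 * (t * L * ε) := by
              refine mul_le_mul_of_nonneg_left ?_ (by positivity)
              exact mul_le_mul_of_nonneg_right (le_mul_of_one_le_right ht0.le hL) hε0.le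
          _ ≤ _ := by linarith
    have hΛS : Λ * S / L ≤ 2 * Y := by
      calc Λ * S / L ≤ Λ * (2 * l * ψ) / L :=
            div_le_div_of_nonneg_right (mul_le_mul_of_nonneg_left hS1 hΛ0) hL0.le
        _ = _ := by rw [hY]; ring
    have hmid : D / L * S ≤ (2 + 11 / c) * Y + 16 * α ^ 2 * (t * L * ε) := by
      have : D / L * S = Real.log t * S / L + Λ * S / L := by rw [hD]; ring
      rw [this]
      linarith
    have hlast : t * (L * (1 / 2) ^ (K + 1)) ≤ t * L * ε := by
      rw [mul_assoc]; gcongr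
    have hone : 1 ≤ 2 * (t * L * ε + Y) :=
      one_le_two_mul_add_of_scale ht hL hΛ hε0 h (by rw [pow_succ] at hK1; linarith) hψK
    have h15 := hRK K
    have h16 := mul_le_mul_of_nonneg_left hmid hC
    have h17 : 0 ≤ C₁ * (2 + 11 / c) * (t * L * ε) := by positivity
    have h18 : 0 ≤ 16 * C₁ * α ^ 2 * Y := by positivity
    generalize t * L * ε = x at *
    generalize D / L * S = y at *
    linarith

/-! ### The number of batches -/

section Horizon

variable {n T : ℕ}

lemma one_le_card_of_one_lt (h : 1 < (n : ℝ) * Real.logb 2 T) : 1 ≤ n := by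
  by_contra hn
  have : n = 0 := by omega
  subst this
  norm_num at h

lemma two_le_of_one_lt (h : 1 < (n : ℝ) * Real.logb 2 T) : 2 ≤ T := by
  by_contra hT
  have : T = 0 ∨ T = 1 := by omega
  rcases this with rfl | rfl <;> norm_num at h

lemma one_le_logb_of_two_le (hT : 2 ≤ T) : 1 ≤ Real.logb 2 (T : ℝ) := by
  rw [Real.le_logb_iff_rpow_le one_lt_two (by positivity), Real.rpow_one]
  exact_mod_cast hT

/-- By integrality the product is at least `3/2` as soon as it exceeds `1`. The critical case is `n
= 1`, `T = 3`, where `3² > 2³`. -/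
lemma third_le_log_card_mul (h : 1 < (n : ℝ) * Real.logb 2 T) :
    1 / 3 ≤ Real.log ((n : ℝ) * Real.logb 2 T) := by
  have hn := one_le_card_of_one_lt h
  have hT := two_le_of_one_lt h
  have hlT := one_le_logb_of_two_le hT
  have h32 : 3 / 2 ≤ (n : ℝ) * Real.logb 2 T := by
    rcases hn.eq_or_lt with rfl | hn'
    · have hT3 : 3 ≤ T := by
        by_contra hT3
        have : T = 2 := by omega
        subst this
        norm_num at h
      have : (3 / 2 : ℝ) ≤ Real.logb 2 T := by
        have h2 : (2 : ℝ) * (3 / 2) ≤ 2 * Real.logb 2 T := by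
          have : (3 : ℝ) ≤ Real.logb 2 ((T : ℝ) ^ 2) := by
            rw [Real.le_logb_iff_rpow_le one_lt_two (by positivity)]
            have : (3 : ℝ) ≤ T := by exact_mod_cast hT3
            norm_num
            nlinarith
          rw [Real.logb_pow] at this
          push_cast at this
          linarith
        linarith
      simpa using this
    · have : (2 : ℝ) ≤ n := by exact_mod_cast hn'
      nlinarith
  have h1 := Real.one_sub_inv_le_log_of_pos (by norm_num : (0 : ℝ) < 3 / 2)
  have h2 := Real.log_le_log (by norm_num) h32
  norm_num at h1
  linarith

lemma log_mul_mul_eq (h : 1 < (n : ℝ) * Real.logb 2 T) :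
    Real.log ((T : ℝ) * n * Real.logb 2 T) =
      Real.log T + Real.log ((n : ℝ) * Real.logb 2 T) := by
  have hT := two_le_of_one_lt h
  rw [mul_assoc, Real.log_mul (by positivity) (by positivity)]

lemma log_mul_mul_le (h : 1 < (n : ℝ) * Real.logb 2 T) :
    Real.log ((T : ℝ) * n * Real.logb 2 T) ≤ 2 * Real.log ((T : ℝ) * n) := by
  have hn := one_le_card_of_one_lt h
  have hT := two_le_of_one_lt h
  have hlT := one_le_logb_of_two_le hT
  have hn1 : (1 : ℝ) ≤ n := by exact_mod_cast hn
  have hT2 : (2 : ℝ) ≤ T := by exact_mod_cast hT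
  have h1 : Real.logb 2 (T : ℝ) ≤ T := by
    rw [Real.logb_le_iff_le_rpow one_lt_two (by positivity), Real.rpow_natCast]
    exact_mod_cast Nat.lt_two_pow_self.le
  have h2 : (T : ℝ) * n * Real.logb 2 T ≤ ((T : ℝ) * n) ^ 2 := by
    rw [pow_two]
    refine mul_le_mul_of_nonneg_left (h1.trans ?_) (by positivity)
    exact le_mul_of_one_le_right (by positivity) hn1
  rw [show 2 * Real.log ((T : ℝ) * n) = Real.log (((T : ℝ) * n) ^ 2) by
    rw [Real.log_pow]; norm_num]
  exact Real.log_le_log (by positivity) h2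

lemma log_two_le_log_mul (hn : 1 ≤ n) (hT : 2 ≤ T) : Real.log 2 ≤ Real.log ((T : ℝ) * n) := by
  refine Real.log_le_log two_pos ?_
  have hn1 : (1 : ℝ) ≤ n := by exact_mod_cast hn
  have hT2 : (2 : ℝ) ≤ T := by exact_mod_cast hT
  nlinarith

end Horizon

namespace Problem

variable {ι : Type*} [Fintype ι] {T : ℕ}

lemma log_two_le_log_mul_mul (h : 1 < (Fintype.card ι : ℝ) * Real.logb 2 T) :
    Real.log 2 ≤ Real.log ((T : ℝ) * Fintype.card ι * Real.logb 2 T) := by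
  refine (log_two_le_log_mul le_rfl (two_le_of_one_lt h)).trans ?_
  have hT := two_le_of_one_lt h
  rw [log_mul_mul_eq h]
  have := third_le_log_card_mul h
  simp only [Nat.cast_one, mul_one]
  linarith

lemma numBatches_pos (h : 1 < (Fintype.card ι : ℝ) * Real.logb 2 T) : 0 < numBatches ι T := by
  have h1 := log_two_le_log_mul_mul h
  have h2 := Real.log_pos one_lt_two
  have : 0 < ⌈Real.log ((T : ℝ) * Fintype.card ι * Real.logb 2 T)⌉₊ :=
    Nat.ceil_pos.2 (by linarith)
  unfold numBatches
  omega

lemma numBatches_le (h : 1 < (Fintype.card ι : ℝ) * Real.logb 2 T) :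
    (numBatches ι T : ℝ) ≤ 13 * Real.log ((T : ℝ) * Fintype.card ι * Real.logb 2 T) := by
  have h1 := log_two_le_log_mul_mul h
  have hlog2 : 0.6931471803 < Real.log 2 := Real.log_two_gt_d9
  -- The ceiling adds at most `5` to five times the logarithm, and `8 log 2 > 5`.
  have := Nat.ceil_lt_add_one
    (by linarith : 0 ≤ Real.log ((T : ℝ) * Fintype.card ι * Real.logb 2 T))
  unfold numBatches
  push_cast
  linarith

/-- With `Y = T |Π| log₂ T`, the factor `5` in the number of batches makes the failure probability
of one estimate at most `Y⁻²`. This pays for the union over policies and completed epochs and for a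
loss of at most `T` on failure. -/
lemma mul_exp_neg_numBatches_le (h : 1 < (Fintype.card ι : ℝ) * Real.logb 2 T) :
    (T : ℝ) * (Fintype.card ι * (T * Real.exp (-(numBatches ι T : ℝ) / 2))) ≤ 1 := by
  have hn := one_le_card_of_one_lt h
  have hT := two_le_of_one_lt h
  have hlT := one_le_logb_of_two_le hT
  have h0 := log_two_le_log_mul_mul h
  have hlog2 : 0.6931471803 < Real.log 2 := Real.log_two_gt_d9
  have hn1 : (1 : ℝ) ≤ Fintype.card ι := by exact_mod_cast hn
  have hT0 : (0 : ℝ) < T := by positivity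
  set n : ℝ := (Fintype.card ι : ℝ)
  set Y : ℝ := (T : ℝ) * n * Real.logb 2 T with hY
  have hY0 : 0 < Y := by positivity
  have hTY : (T : ℝ) ≤ Y := by
    rw [hY, mul_assoc]
    exact le_mul_of_one_le_right hT0.le (one_le_mul_of_one_le_of_one_le hn1 hlT)
  have hTn : (T : ℝ) * n ≤ Y := le_mul_of_one_le_right (by positivity) hlT
  have hN : 2 * Real.log Y ≤ (numBatches ι T : ℝ) / 2 := by
    have := Nat.le_ceil (Real.log Y)
    unfold numBatches
    push_cast
    linarith
  have hexp : Real.exp (-(numBatches ι T : ℝ) / 2) ≤ (Y ^ 2)⁻¹ := by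
    rw [← Real.exp_log (by positivity : 0 < (Y ^ 2)⁻¹), Real.log_inv, Real.log_pow]
    refine Real.exp_le_exp.2 ?_
    push_cast
    linarith
  calc (T : ℝ) * (n * (T * Real.exp (-(numBatches ι T : ℝ) / 2)))
      = T * (T * n) * Real.exp (-(numBatches ι T : ℝ) / 2) := by ring
    _ ≤ Y * Y * (Y ^ 2)⁻¹ := by gcongr
    _ = 1 := by field_simp

variable {X A Ω : Type*} [MeasurableSpace X] [MetricSpace A] [MeasurableSpace A]
  [BorelSpace A] [SecondCountableTopology A] [MeasurableSpace Ω] [Nonempty ι] {ν : Measure A}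
  [IsProbabilityMeasure ν] {B : Problem X A Ω ι} {d α L : ℝ} {Q : ℕ → Finset ι → ι → ℝ}

/-- The regret bound in terms of the logarithmic factor `log (T |Π| log₂ T)`. -/
lemma regret_le_log_mul_sum (hd : IsDoublingSpace ν d) (hu : IsUniformSpace ν α)
    (hlip : B.IsLipschitz L) (hL : 1 ≤ L) (h : 1 < (Fintype.card ι : ℝ) * Real.logb 2 T)
    (hQ : B.IsSolver ν L Q) (K : ℕ) :
    B.regret ν L T Q ≤ 1 + 58240 * α *
      (Real.log ((T : ℝ) * Fintype.card ι * Real.logb 2 T) / L *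
        ∑ k ∈ Finset.range K,
          B.expPacking (12 * L * (1 / 2) ^ (k + 1)) ((1 / 2) ^ (k + 1)) * 2 ^ (k + 1)) +
      14 * (T * (L * (1 / 2) ^ (K + 1))) := by
  have hα := one_le_of_isUniformSpace hd hu
  have hL0 : 0 < L := by linarith
  have h1 := regret_le_sum hd hu hlip hL (numBatches_pos h) hQ K
  have h2 := mul_exp_neg_numBatches_le h
  have h3 := numBatches_le h
  have h4 : ∑ k ∈ Finset.range K, 320 * α * numBatches ι T *
        (B.expPacking (12 * radius L (k + 1)) (bandwidth (k + 1)) / radius L (k + 1)) =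
      320 * α * (numBatches ι T / L) * ∑ k ∈ Finset.range K,
          B.expPacking (12 * L * (1 / 2) ^ (k + 1)) ((1 / 2) ^ (k + 1)) * 2 ^ (k + 1) := by
    rw [Finset.mul_sum]
    refine Finset.sum_congr rfl fun k _ => ?_
    unfold radius bandwidth
    rw [mul_assoc 12 L]
    have : (2 : ℝ) ^ (k + 1) = ((1 / 2) ^ (k + 1))⁻¹ := by rw [one_div, inv_pow, inv_inv]
    rw [this]
    have : (1 / 2 : ℝ) ^ (k + 1) ≠ 0 := by positivity
    field_simp
  rw [h4] at h1
  set S := ∑ k ∈ Finset.range K,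
    B.expPacking (12 * L * (1 / 2) ^ (k + 1)) ((1 / 2) ^ (k + 1)) * 2 ^ (k + 1)
  have hS : 0 ≤ S := Finset.sum_nonneg fun k _ => mul_nonneg
    (zero_le_one.trans (B.one_le_expPacking (by positivity) (by positivity))) (by positivity)
  have h5 : 320 * α * (numBatches ι T / L) * S ≤ 320 * α *
      (13 * Real.log ((T : ℝ) * Fintype.card ι * Real.logb 2 T) / L) * S := by gcongr
  -- The constant is `58240 = 14 * 320 * 13`.
  have h6 : 14 * (320 * α *
      (13 * Real.log ((T : ℝ) * Fintype.card ι * Real.logb 2 T) / L) * S) = 58240 * α *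
      (Real.log ((T : ℝ) * Fintype.card ι * Real.logb 2 T) / L * S) := by ring
  have h7 : radius L (K + 1) = L * (1 / 2) ^ (K + 1) := rfl
  rw [h7] at h1
  linarith

lemma zoomingCoeff_nonneg (B : Problem X A Ω ι) {ε₀ : ℝ} (hε₀ : 0 < ε₀) :
    0 ≤ B.zoomingCoeff L ε₀ :=
  Real.iSup_nonneg fun ε => div_nonneg (integral_nonneg fun _ => Nat.cast_nonneg _)
    (hε₀.le.trans ε.2)

lemma expPacking_mul_two_pow_le_zoomingCoeff (B : Problem X A Ω ι) {ε₀ : ℝ} (hε₀ : 0 < ε₀)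
    {k : ℕ} (hk : ε₀ ≤ (1 / 2) ^ k) :
    B.expPacking (12 * L * (1 / 2) ^ k) ((1 / 2) ^ k) * 2 ^ k ≤ B.zoomingCoeff L ε₀ := by
  -- Without a bound the supremum would be zero by default. Finiteness of the policy set provides
  -- one.
  have hb : BddAbove (range fun ε : Ici ε₀ =>
      B.expPacking (12 * L * (ε : ℝ)) (ε : ℝ) / (ε : ℝ)) := by
    refine ⟨Fintype.card ι / ε₀, ?_⟩
    rintro _ ⟨ε, rfl⟩
    have h1 : ε₀ ≤ (ε : ℝ) := ε.2
    exact div_le_div₀ (Nat.cast_nonneg _) (B.expPacking_le_card (hε₀.trans_le h1) _) hε₀ h1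
  have h2 := le_ciSup hb ⟨(1 / 2) ^ k, hk⟩
  have h3 : B.expPacking (12 * L * (1 / 2) ^ k) ((1 / 2) ^ k) * 2 ^ k =
      B.expPacking (12 * L * (1 / 2) ^ k) ((1 / 2) ^ k) / (1 / 2) ^ k := by
    rw [one_div, inv_pow, div_inv_eq_mul]
  rw [h3]
  exact h2

lemma zoomingDim_nonneg (B : Problem X A Ω ι) (γ : ℝ) : 0 ≤ B.zoomingDim L γ :=
  Real.sInf_nonneg fun _ hx => hx.1.le

/-- The infimum that defines the zooming dimension is attained, up to positivity. -/
lemma expPacking_le_of_zoomingDim (B : Problem X A Ω ι) {γ ε : ℝ} (hγ : 0 < γ)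
    (hne : (B.zoomingExponents L γ).Nonempty) (hε : ε ∈ Ioo (0 : ℝ) 1) :
    B.expPacking (12 * L * ε) ε ≤ γ * ε ^ (-B.zoomingDim L γ) := by
  -- Every exponent above the infimum is admissible, since `ε < 1`. Continuity in the exponent
  -- passes the bound to the infimum.
  have hcont : Continuous fun y : ℝ => γ * ε ^ (-y) :=
    continuous_const.mul ((Real.continuous_const_rpow hε.1.ne').comp continuous_neg)
  have hlim := (hcont.tendsto (B.zoomingDim L γ)).mono_left
    (nhdsWithin_le_nhds (s := Ioi (B.zoomingDim L γ)))
  refine ge_of_tendsto hlim ?_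
  filter_upwards [self_mem_nhdsWithin] with y hy
  obtain ⟨e, he, hey⟩ := exists_lt_of_csInf_lt hne hy
  refine (he.2 ε hε).trans (mul_le_mul_of_nonneg_left ?_ hγ.le)
  exact Real.rpow_le_rpow_of_exponent_ge hε.1 hε.2.le (by linarith)

/-- The packing numbers are at least one, and `ε ^ (-e)` tends to one as `ε` increases to one. -/
lemma one_le_of_nonempty_zoomingExponents (B : Problem X A Ω ι) {γ : ℝ} (hL : 0 ≤ L)
    (hne : (B.zoomingExponents L γ).Nonempty) : 1 ≤ γ := by
  obtain ⟨e, -, he⟩ := hne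
  have hcont : ContinuousAt (fun ε : ℝ => γ * ε ^ (-e)) 1 :=
    continuousAt_const.mul (Real.continuousAt_rpow_const 1 (-e) (Or.inl one_ne_zero))
  have hlim := hcont.tendsto.mono_left (nhdsWithin_le_nhds (s := Iio 1))
  simp only [Real.one_rpow, mul_one] at hlim
  refine ge_of_tendsto hlim ?_
  filter_upwards [Ioo_mem_nhdsLT zero_lt_one] with ε hε
  exact (B.one_le_expPacking hε.1 (mul_nonneg (by positivity) hε.1.le)).trans (he ε hε)

theorem regret_le_zoomingCoeff (hd : IsDoublingSpace ν d) (hu : IsUniformSpace ν α)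
    (hlip : B.IsLipschitz L) (hL : 1 ≤ L) (h : 1 < (Fintype.card ι : ℝ) * Real.logb 2 T)
    (hQ : B.IsSolver ν L Q) {c ε₀ : ℝ}
    (hc : c = 1 / (4 * (Real.log (2 * α) / Real.log 2 + 1))) (hε0 : 0 < ε₀) (hε1 : ε₀ < 1) :
    B.regret ν L T Q ≤ (16 + 58240 * α * (2 + 11 / c) + 16 * (58240 * α) * α ^ 2) *
      ((T : ℝ) * L * ε₀ + B.zoomingCoeff L ε₀ / L *
        Real.log ((Fintype.card ι : ℝ) * Real.logb 2 T) * Real.log (1 / ε₀)) := by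
  have hα := one_le_of_isUniformSpace hd hu
  have hn := one_le_card_of_one_lt h
  have hT := two_le_of_one_lt h
  have hn1 : (1 : ℝ) ≤ Fintype.card ι := by exact_mod_cast hn
  exact le_of_forall_scale_of_sup (n := Fintype.card ι)
    (a := fun k => B.expPacking (12 * L * (1 / 2) ^ k) ((1 / 2) ^ k))
    (by exact_mod_cast hT) hL (by positivity) (log_mul_mul_eq h) (third_le_log_card_mul h) hn
    (Real.log_le_log (by positivity)
      (le_mul_of_one_le_right (by positivity) (one_le_logb_of_two_le hT)))
    hα hc hε0 hε1 (B.zoomingCoeff_nonneg hε0)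
    (regret_le_card hd hu hL (numBatches_pos h) hQ)
    (regret_le_log_mul_sum hd hu hlip hL h hQ)
    (fun k => B.one_le_expPacking (by positivity) (by positivity))
    (fun k => B.expPacking_le_card (by positivity) _)
    (fun k => B.expPacking_half_pow_le hd hu k _)
    (fun k hk => B.expPacking_mul_two_pow_le_zoomingCoeff hε0 hk)

theorem regret_le_zoomingDim (hd : IsDoublingSpace ν d) (hu : IsUniformSpace ν α)
    (hlip : B.IsLipschitz L) (hL : 1 ≤ L) (h : 1 < (Fintype.card ι : ℝ) * Real.logb 2 T)
    (hQ : B.IsSolver ν L Q) {γ : ℝ} (hγ : 0 < γ) (hne : (B.zoomingExponents L γ).Nonempty) :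
    B.regret ν L T Q ≤ (15 + 4 * (58240 * α)) *
      (L ^ (B.zoomingDim L γ / (2 + B.zoomingDim L γ)) *
        (T : ℝ) ^ ((1 + B.zoomingDim L γ) / (2 + B.zoomingDim L γ)) *
        (γ * Real.log ((T : ℝ) * Fintype.card ι)) ^ (1 / (2 + B.zoomingDim L γ))) := by
  have hα := one_le_of_isUniformSpace hd hu
  have hn := one_le_card_of_one_lt h
  have hT := two_le_of_one_lt h
  exact le_of_forall_scale_of_rpow
    (a := fun k => B.expPacking (12 * L * (1 / 2) ^ k) ((1 / 2) ^ k))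
    (by exact_mod_cast hT) hL (by positivity)
    ((Real.log_pos one_lt_two).le.trans (log_two_le_log_mul_mul h)) (log_mul_mul_le h)
    (log_two_le_log_mul hn hT) (B.one_le_of_nonempty_zoomingExponents (by linarith) hne)
    (B.zoomingDim_nonneg γ) (regret_le_card hd hu hL (numBatches_pos h) hQ)
    (regret_le_log_mul_sum hd hu hlip hL h hQ)
    (fun k => B.expPacking_le_of_zoomingDim hγ hne
      ⟨by positivity, pow_lt_one₀ (by norm_num) (by norm_num) (Nat.succ_ne_zero k)⟩)

end Problem

end ZoomingBandit

end

theorem theorem5 (α : ℝ) :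
    ∃ C : ℝ, 0 < C ∧
      ∀ (X A Ω ι : Type*) [MeasurableSpace X] [MetricSpace A] [MeasurableSpace A] [BorelSpace A]
        [MeasurableSpace Ω] [Fintype ι] (ν : Measure A) [IsProbabilityMeasure ν] (d : ℝ)
        (_ : ZoomingBandit.IsDoublingSpace ν d) (_ : ZoomingBandit.IsUniformSpace ν α)
        (B : ZoomingBandit.Problem X A Ω ι) (L : ℝ) (_ : 1 ≤ L) (_ : B.IsLipschitz L)
        (T : ℕ) (_ : 1 < (Fintype.card ι : ℝ) * Real.logb 2 (T : ℝ))
        (Q : ℕ → Finset ι → ι → ℝ) (_ : B.IsSolver ν L Q),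
        (∀ ε₀ : ℝ, 0 < ε₀ → ε₀ < 1 →
          B.regret ν L T Q ≤ C * ((T : ℝ) * L * ε₀ +
            B.zoomingCoeff L ε₀ / L * Real.log ((Fintype.card ι : ℝ) * Real.logb 2 (T : ℝ)) *
              Real.log (1 / ε₀))) ∧
        (∀ γ : ℝ, 0 < γ → (B.zoomingExponents L γ).Nonempty →
          B.regret ν L T Q ≤ C *
            (L ^ (B.zoomingDim L γ / (2 + B.zoomingDim L γ)) *
              (T : ℝ) ^ ((1 + B.zoomingDim L γ) / (2 + B.zoomingDim L γ)) *
              (γ * Real.log ((T : ℝ) * (Fintype.card ι : ℝ))) ^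
                (1 / (2 + B.zoomingDim L γ)))) := by
  by_cases hα : 1 ≤ α
  · set c := 1 / (4 * (Real.log (2 * α) / Real.log 2 + 1)) with hc
    have hβ : 0 ≤ Real.log (2 * α) / Real.log 2 :=
      div_nonneg (Real.log_nonneg (by linarith)) (Real.log_nonneg one_le_two)
    have hc0 : 0 < c := by rw [hc]; positivity
    refine ⟨max (16 + 58240 * α * (2 + 11 / c) + 16 * (58240 * α) * α ^ 2)
      (15 + 4 * (58240 * α)), lt_max_of_lt_left (by positivity), ?_⟩
    intro X A Ω ι _ _ _ _ _ _ ν _ d hd hu B L hL hlip T h Q hQ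
    have hn := ZoomingBandit.one_le_card_of_one_lt h
    have hT := ZoomingBandit.two_le_of_one_lt h
    have : Nonempty ι := Fintype.card_pos_iff.1 hn
    have : SecondCountableTopology A := hu.secondCountableTopology hd
    have hL0 : 0 < L := by linarith
    refine ⟨fun ε₀ hε0 hε1 => ?_, fun γ hγ hne => ?_⟩
    · refine (ZoomingBandit.Problem.regret_le_zoomingCoeff hd hu hlip hL h hQ hc hε0 hε1).trans
        (mul_le_mul_of_nonneg_right (le_max_left _ _) ?_)
      have h1 := B.zoomingCoeff_nonneg (L := L) hε0
      have h2 : 0 ≤ Real.log (1 / ε₀) :=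
        Real.log_nonneg (by rw [le_div_iff₀ hε0]; linarith)
      have h3 := ZoomingBandit.third_le_log_card_mul h
      have h4 : 0 ≤ Real.log ((Fintype.card ι : ℝ) * Real.logb 2 (T : ℝ)) := by linarith
      positivity
    · refine (ZoomingBandit.Problem.regret_le_zoomingDim hd hu hlip hL h hQ hγ hne).trans
        (mul_le_mul_of_nonneg_right (le_max_right _ _) ?_)
      have h1 := (Real.log_pos one_lt_two).le.trans (ZoomingBandit.log_two_le_log_mul hn hT)
      positivity
  -- Uniformity forces `1 ≤ α`, so there is nothing to prove for smaller `α`.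
  · refine ⟨1, one_pos, ?_⟩
    intro X A Ω ι _ _ _ _ _ _ ν _ d hd hu
    exact absurd (ZoomingBandit.one_le_of_isUniformSpace hd hu) hα
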